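/- **Good atlases.** Let $X$ be a paracompact, second countable Hausdorff space. A *chart* of dimension $n$ on $X$ is a triple $(\tilde U,G,\pi)$ with $\tilde U\subseteq\mathbb R^n$ connected and open (possibly empty), $G$ a finite group of diffeomorphisms of $\tilde U$ (acting effectively), and $\pi:\tilde U\to X$ a continuous $G$-invariant map with open image $U=\pi(\tilde U)$ that induces a homeomorphism $\tilde U/G\cong U$. If $U\subseteq V$, an *embedding* of charts $(\tilde U,G,\pi)\to(\tilde V,H,\tau)$ is a smooth embedding $\lambda:\tilde U\to\tilde V$ with $\tau\circ\lambda=\pi$. An *atlas* is a family of charts of the same dimension whose images cover $X$ and such that each $x\in U_i\cap U_j$ lies in some $U_k\subseteq U_i\cap U_j$ from the family which admits embeddings of its chart into the $i$-th and the $j$-th chart. A *good atlas* $\mathcal U$ on $X$ is an atlas $\{(\tilde U_I,G_I,\pi_I)\mid I\in F(V_{\mathcal U})\}$ indexed by the set $F(V_{\mathcal U})$ of non-empty finite subsets of a countable set $V_{\mathcal U}$, such that, with $U_I=\pi_I(\tilde U_I)$: $\{U_{\{i\}}\}_{i\in V_{\mathcal U}}$ is a locally finite cover of $X$; every non-empty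 $\tilde U_I$ and every non-empty $U_I$ is contractible; $U_{I_0\cup\dots\cup I_p}=U_{I_0}\cap\dots\cap U_{I_p}$; and there is an embedding of the $I$-th chart into the $J$-th whenever $U_I\subseteq U_J$. A good atlas is a small category, with its charts as objects and all their embeddings as morphisms. **The 2-category $\mathrm{GPreOrb}$.** Its objects are the good atlases (with their spaces). A 1-cell is a *compatible system* $\tilde f:\mathcal U\to\mathcal V$ for a continuous map $f:X\to Y$: a functor $\tilde f:\mathcal U\to\mathcal V$ with $f(U_I)\subseteq V_{\tilde fI}$ and $\tilde f(I_1\cup\dots\cup I_p)=\tilde fI_1\cup\dots\cup\tilde fI_p$, together with smooth maps $\tilde f_I:\tilde U_I\to\tilde V_{\tilde fI}$ lifting $f|_{U_I}$ and satisfying $\tilde f_J\circ\lambda=(\tilde f\lambda)\circ\tilde f_I$ for each embedding $\lambda$ from the $I$-th to the $J$-th chart. A 2-cell $\alpha:\tilde f^1\Rightarrow\tilde f^2$, for compatible systems of the same map $f$, is a natural transformation of functors with $\tilde f^2_I=\alpha_I\circ\tilde f^1_I$ for all $I$. Compositions are the evident ones. **The 2-category $\mathrm{SpCx}$.** A *spark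 complex* is a cochain complex $F^*$ of abelian groups vanishing in negative degrees with subcomplexes $E^*,I^*$ such that $I^k\cap E^k=0$ for $k>0$ and the inclusion induces $H^*(E^*)\cong H^*(F^*)$. 1-cells are *spark homomorphisms*: cochain maps preserving $E^*$ and $I^*$. A *spark homotopy* $\Phi:f\Rightarrow g$ is a degree $-1$ homomorphism with $d\Phi+\Phi d=g-f$, vanishing on $E^*$ and mapping $I^*$ into $I^*$. Write $\Phi\sim\Psi$ if $d\Gamma-\Gamma d=\Psi-\Phi$ for some degree $-2$ homomorphism $\Gamma$ vanishing on $E^*$ and mapping $I^*$ into $I^*$; 2-cells are the classes $[\Phi]$. **Spark characters.** A *spark* of degree $k$ is $a\in F^k$ with $da=e-r$, $e\in E^{k+1}$, $r\in I^{k+1}$; sparks $a,a'$ are equivalent if $a-a'=db+s$ with $b\in F^{k-1}$, $s\in I^k$. Let $\hat H^k(F,E,I)$ be the group of equivalence classes. Let $\mathrm{GAb}$ be the category of $\mathbb Z$-graded abelian groups, regarded as a 2-category with only identity 2-cells. $\mathrm{Char}:\mathrm{SpCx}\to\mathrm{GAb}$ is the 2-functor sending a spark complex to $\hat H^*(F,E,I)$,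 a spark homomorphism $f$ to $f_*:[a]\mapsto[fa]$, and each 2-cell to an identity. **The triple $S_{\mathcal U}$.** For a string $\mathbf I=I_0\dots I_p$ in $F(V_{\mathcal U})$ put $\tilde U_{\mathbf I}=\tilde U_{I_0\cup\dots\cup I_p}$. Let $C^p(\mathcal U,\Omega^q)$ be the group of families $\omega=(\omega_{\mathbf I})$ of $G$-invariant smooth $q$-forms $\omega_{\mathbf I}$ on $\tilde U_{\mathbf I}$, over all strings $\mathbf I$ of length $p+1$, which change sign when two entries of $\mathbf I$ in different positions are exchanged. If $U_I\subseteq U_J$, restriction of invariant forms from $\tilde U_J$ to $\tilde U_I$ is pullback along any embedding (it does not depend on the choice). Put $(\delta\omega)_{\mathbf I}=\sum_k(-1)^k\,\omega_{I_0\dots\widehat{I_k}\dots I_{p+1}}|_{\tilde U_{\mathbf I}}$. Let $F^*_{\mathcal U}$ be the total complex of $C^*(\mathcal U,\Omega^*)$, with differential $D=\delta+(-1)^pd$. Let $E^*_{\mathcal U}=\Omega^*(\mathcal U)\subseteq C^0(\mathcal U,\Omega^*)$ consist of the families of invariant forms $(\omega_I)$ with $\lambda^*\omega_J=\omega_I$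 for every embedding $\lambda$ from the $I$-th to the $J$-th chart, and let $I^*_{\mathcal U}=C^*(\mathcal U,\mathbb Z)\subseteq C^*(\mathcal U,\Omega^0)$ be the group of cochains all of whose components are integer constants. Put $S_{\mathcal U}=(F^*_{\mathcal U},E^*_{\mathcal U},I^*_{\mathcal U})$ and $\hat H^*(\mathcal U)=\hat H^*(S_{\mathcal U})$. A compatible system $\tilde f:\mathcal U\to\mathcal V$ acts by $(\underline{\tilde f}\,\omega)_{\mathbf I}=\tilde f_{\mathbf I}^*(\omega_{\tilde f\mathbf I})$, where $\tilde f_{\mathbf I}=\tilde f_{I_0\cup\dots\cup I_p}$ and $\tilde f\mathbf I=\tilde fI_0\dots\tilde fI_p$. Given a strict total order on $F(V_{\mathcal U})$ and a 2-cell $\alpha:\tilde f^1\Rightarrow\tilde f^2$, let $\underline\alpha$ be the map sending $\omega\in C^{p+1}(\mathcal V,\Omega^q)$ to the alternating family in $C^{p}(\mathcal U,\Omega^q)$ that is given on strictly increasing strings $\mathbf I=I_0\dots I_p$ by $$(\underline\alpha\,\omega)_{\mathbf I}=\sum_{j=0}^p(-1)^j(\tilde f^1_{\mathbf I})^*\bigl(\omega_{\tilde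 f^1I_0\dots\tilde f^1I_j\,\tilde f^2I_j\dots\tilde f^2I_p}|_{\tilde V_{\tilde f^1\mathbf I}}\bigr),$$ and vanishing on $C^0(\mathcal V,\Omega^q)$. **Theorem.** For every good atlas $\mathcal U$, $S_{\mathcal U}$ is a spark complex; every compatible system $\tilde f:\mathcal U\to\mathcal V$ induces a spark homomorphism $\underline{\tilde f}:S_{\mathcal V}\to S_{\mathcal U}$; and every natural transformation $\alpha:\tilde f^1\Rightarrow\tilde f^2$ of compatible systems induces a spark homotopy $\underline\alpha:\underline{\tilde f^1}\Rightarrow\underline{\tilde f^2}$, whose class $[\underline\alpha]$ does not depend on the order. The assignments $\mathcal U\mapsto S_{\mathcal U}$, $\tilde f\mapsto\underline{\tilde f}$, $\alpha\mapsto[\underline\alpha]$ form a strict 2-functor $S:\mathrm{GPreOrb}^{\mathrm{op}}\to\mathrm{SpCx}$ (where $\mathrm{op}$ reverses the 1-cells only). There is a strict 2-functor $\hat H:\mathrm{GPreOrb}^{\mathrm{op}}\to\mathrm{GAb}$ that sends 1. each good atlas $\mathcal U$ to the graded abelian group $\hat H^*(\mathcal U)$ of spark characters; 2. each compatible system $\tilde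 f:\mathcal U\to\mathcal V$ to the homomorphism $\underline{\tilde f}_*:\hat H^*(\mathcal V)\to\hat H^*(\mathcal U)$ of graded abelian groups; 3. each natural transformation $\alpha:\tilde f^1\Rightarrow\tilde f^2$ of compatible systems to the identity 2-cell on $\underline{\tilde f^1}_*=\underline{\tilde f^2}_*$ (in particular, compatible systems related by a natural transformation, e.g. naturally isomorphic ones, induce equal homomorphisms). Moreover $\hat H=\mathrm{Char}\circ S$. -/

import Mathlib

open CategoryTheory Topology
open scoped ContDiff

universe u v

namespace SparkOrb

noncomputable section

/-! ### Smooth maps and differential forms on open subsets of Euclidean spaces -/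

/-- `ℝⁿ`. -/
abbrev E (n : ℕ) : Type := EuclideanSpace ℝ (Fin n)

/-- Extension by zero of a function on a subset of `ℝⁿ`. -/
def zeroExt {n : ℕ} {s : Set (E n)} {B : Type*} [Zero B] (f : s → B) : E n → B :=
  Function.extend Subtype.val f 0

theorem zeroExt_apply {n : ℕ} {s : Set (E n)} {B : Type*} [Zero B] (f : s → B) (x : s) :
    zeroExt f (x : E n) = f x :=
  Subtype.val_injective.extend_apply _ _ _

/-- Open subsets of `ℝⁿ`. -/
abbrev Op (n : ℕ) : Type := TopologicalSpace.Opens (E n)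

/-- Smoothness of a map between open subsets of Euclidean spaces. -/
def IsSmooth {m n : ℕ} {s : Op m} {t : Op n} (f : s → t) : Prop :=
  ContDiffOn ℝ ∞ (zeroExt (s := (s : Set (E m))) fun x => (f x : E n)) s

/-- The differential at `x` of a map between open subsets of Euclidean spaces. -/
def mapDeriv {m n : ℕ} {s : Op m} {t : Op n} (f : s → t) (x : s) : E m →L[ℝ] E n :=
  fderiv ℝ (zeroExt (s := (s : Set (E m))) fun y => (f y : E n)) x

theorem IsSmooth.id {n : ℕ} {s : Op n} : IsSmooth (id : s → s) := by
  refine contDiffOn_id.congr fun x hx => ?_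
  exact zeroExt_apply (s := (s : Set (E n))) (fun y => (y : E n)) ⟨x, hx⟩

theorem IsSmooth.comp {l m n : ℕ} {r : Op l} {s : Op m} {t : Op n} {g : s → t} {f : r → s}
    (hg : IsSmooth g) (hf : IsSmooth f) : IsSmooth (g ∘ f) := by
  refine (ContDiffOn.comp (t := (s : Set (E m))) hg hf ?_).congr ?_
  · intro x hx
    have := zeroExt_apply (s := (r : Set (E l))) (fun y => (f y : E m)) ⟨x, hx⟩
    simp only at this
    rw [this]
    exact (f ⟨x, hx⟩).2
  · intro x hx
    have h1 := zeroExt_apply (s := (r : Set (E l))) (fun y => (f y : E m)) ⟨x, hx⟩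
    have h2 := zeroExt_apply (s := (r : Set (E l))) (fun y => ((g ∘ f) y : E n)) ⟨x, hx⟩
    have h3 := zeroExt_apply (s := (s : Set (E m))) (fun y => (g y : E n)) (f ⟨x, hx⟩)
    simp only at h1 h2 h3
    rw [h2, Function.comp_apply, Function.comp_apply, h1, h3]

theorem IsSmooth.differentiableAt {m n : ℕ} {s : Op m} {t : Op n} {f : s → t}
    (hf : IsSmooth f) (x : s) :
    DifferentiableAt ℝ (zeroExt (s := (s : Set (E m))) fun y => (f y : E n)) x :=
  (hf.contDiffAt (s.isOpen.mem_nhds x.2)).differentiableAt (by simp)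

theorem mapDeriv_id {n : ℕ} {s : Op n} (x : s) :
    mapDeriv (id : s → s) x = ContinuousLinearMap.id ℝ (E n) := by
  rw [← fderiv_id (𝕜 := ℝ) (x := (x : E n))]
  refine Filter.EventuallyEq.fderiv_eq ?_
  filter_upwards [s.isOpen.mem_nhds x.2] with y hy
  exact zeroExt_apply (s := (s : Set (E n))) (fun y => (y : E n)) ⟨y, hy⟩

theorem mapDeriv_comp {l m n : ℕ} {r : Op l} {s : Op m} {t : Op n} {g : s → t} {f : r → s}
    (hg : IsSmooth g) (hf : IsSmooth f) (x : r) :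
    mapDeriv (g ∘ f) x = (mapDeriv g (f x)).comp (mapDeriv f x) := by
  have h1 := zeroExt_apply (s := (r : Set (E l))) (fun y => (f y : E m)) x
  have hg' := hg.differentiableAt (f x)
  rw [← h1] at hg'
  have h := fderiv_comp (x : E l) hg' (hf.differentiableAt x)
  rw [h1] at h
  refine Eq.trans ?_ h
  refine Filter.EventuallyEq.fderiv_eq ?_
  filter_upwards [r.isOpen.mem_nhds x.2] with y hy
  have h1 := zeroExt_apply (s := (r : Set (E l))) (fun y => (f y : E m)) ⟨y, hy⟩
  have h2 := zeroExt_apply (s := (r : Set (E l))) (fun y => ((g ∘ f) y : E n)) ⟨y, hy⟩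
  have h3 := zeroExt_apply (s := (s : Set (E m))) (fun y => (g y : E n)) (f ⟨y, hy⟩)
  simp only at h1 h2 h3
  rw [h2, Function.comp_apply, Function.comp_apply, h1, h3]

/-- Alternating `q`-linear forms on `ℝⁿ`. -/
abbrev Alt (n q : ℕ) : Type := E n [⋀^Fin q]→L[ℝ] ℝ

/-- `Ω^q(s)`: smooth differential `q`-forms on an open subset `s` of `ℝⁿ`. -/
def Form {n : ℕ} (s : Op n) (q : ℕ) : AddSubgroup (s → Alt n q) where
  carrier := {w | ContDiffOn ℝ ∞ (zeroExt (s := (s : Set (E n))) w) s}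
  zero_mem' := by
    refine contDiffOn_const (c := 0) |>.congr fun x hx => ?_
    exact zeroExt_apply (s := (s : Set (E n))) (0 : s → Alt n q) ⟨x, hx⟩
  add_mem' := by
    intro a b ha hb
    refine (ContDiffOn.add ha hb).congr fun x hx => ?_
    have h1 := zeroExt_apply (s := (s : Set (E n))) a ⟨x, hx⟩
    have h2 := zeroExt_apply (s := (s : Set (E n))) b ⟨x, hx⟩
    have h3 := zeroExt_apply (s := (s : Set (E n))) (a + b) ⟨x, hx⟩
    simp only at h1 h2 h3
    rw [h3, h1, h2]
    rfl
  neg_mem' := by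
    intro a ha
    refine (ContDiffOn.neg ha).congr fun x hx => ?_
    have h1 := zeroExt_apply (s := (s : Set (E n))) a ⟨x, hx⟩
    have h3 := zeroExt_apply (s := (s : Set (E n))) (-a) ⟨x, hx⟩
    simp only at h1 h3
    rw [h3, h1]
    rfl

/-- The alternation of continuous multilinear maps as a continuous linear map. -/
def alternation (n q : ℕ) :
    ContinuousMultilinearMap ℝ (fun _ : Fin q => E n) ℝ →L[ℝ] Alt n q :=
  LinearMap.mkContinuous
    { toFun := fun f => ContinuousMultilinearMap.alternatization f
      map_add' := fun f g => map_add _ f g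
      map_smul' := fun c f => by
        ext v
        simp [ContinuousMultilinearMap.alternatization_apply_apply, Finset.mul_sum,
          Units.smul_def, mul_left_comm] }
    (Fintype.card (Equiv.Perm (Fin q)))
    (fun f => by
      refine ContinuousAlternatingMap.opNorm_le_bound _ (by positivity) fun v => ?_
      simp only [LinearMap.coe_mk, AddHom.coe_mk,
        ContinuousMultilinearMap.alternatization_apply_apply]
      refine (norm_sum_le _ _).trans ?_
      refine (Finset.sum_le_card_nsmul _ _ (‖f‖ * ∏ i, ‖v i‖) ?_).trans ?_
      · intro σ _
        have h : ‖Equiv.Perm.sign σ • f (v ∘ σ)‖ = ‖f (v ∘ σ)‖ := by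
          rcases Int.units_eq_one_or (Equiv.Perm.sign σ) with h | h <;> simp [h]
        rw [h]
        refine (f.le_opNorm _).trans_eq ?_
        congr 1
        exact Equiv.prod_comp σ (fun i => ‖v i‖)
      · simp [mul_assoc])

theorem alternation_coe {n q : ℕ} (a : Alt n q) :
    alternation n q a.toContinuousMultilinearMap = (q.factorial : ℝ) • a := by
  ext v
  simp only [alternation, LinearMap.mkContinuous_apply, LinearMap.coe_mk, AddHom.coe_mk,
    ContinuousMultilinearMap.alternatization_apply_apply,
    ContinuousAlternatingMap.smul_apply]
  have h : ∀ σ : Equiv.Perm (Fin q), σ ∈ Finset.univ →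
      Equiv.Perm.sign σ • a.toContinuousMultilinearMap (v ∘ σ) = a v := by
    intro σ _
    have h' : a.toContinuousMultilinearMap (v ∘ σ) = Equiv.Perm.sign σ • a v :=
      a.toAlternatingMap.map_perm v σ
    rw [h', smul_smul, Int.units_mul_self, one_smul]
  rw [Finset.sum_congr rfl h]
  simp [Fintype.card_perm]

theorem contDiffOn_compContinuousLinearMap {l m n q : ℕ} {S : Set (E l)} {w : E l → Alt n q}
    {A : E l → E m →L[ℝ] E n} (hw : ContDiffOn ℝ ∞ w S) (hA : ContDiffOn ℝ ∞ A S) :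
    ContDiffOn ℝ ∞ (fun x => (w x).compContinuousLinearMap (A x)) S := by
  have h1 : ContDiffOn ℝ ∞ (fun x =>
      ContinuousMultilinearMap.compContinuousLinearMapContinuousMultilinear ℝ
        (fun _ : Fin q => E m) (fun _ : Fin q => E n) ℝ (fun _ => A x)) S :=
    (ContinuousMultilinearMap.contDiff _).comp_contDiffOn (contDiffOn_pi.2 fun _ => hA)
  have h2 : ContDiffOn ℝ ∞ (fun x => (w x).toContinuousMultilinearMap) S :=
    (ContinuousAlternatingMap.toContinuousMultilinearMapCLM (𝕜 := ℝ) (E := E n) (F := ℝ)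
      (ι := Fin q) ℝ).contDiff.comp_contDiffOn hw
  have h3 := ((alternation m q).contDiff.comp_contDiffOn (h1.clm_apply h2)).const_smul
    ((q.factorial : ℝ)⁻¹)
  refine h3.congr fun x _ => ?_
  have h4 := alternation_coe ((w x).compContinuousLinearMap (A x))
  have h5 : (q.factorial : ℝ) ≠ 0 := by positivity
  have h6 : (w x).compContinuousLinearMap (A x) = ((q.factorial : ℝ)⁻¹) •
      alternation m q ((w x).compContinuousLinearMap (A x)).toContinuousMultilinearMap := by
    rw [h4, smul_smul, inv_mul_cancel₀ h5, one_smul]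
  exact h6

/-- Pullback of differential forms along a smooth map:
`(f^* w)_x(v₁, …, v_q) = w_{f x}(df_x v₁, …, df_x v_q)`. -/
def Form.pullback {m n : ℕ} {s : Op m} {t : Op n} (f : s → t) (hf : IsSmooth f) (q : ℕ) :
    Form t q →+ Form s q where
  toFun w := ⟨fun x => (w.1 (f x)).compContinuousLinearMap (mapDeriv f x), by
    have hd : ContDiffOn ℝ ∞
        (fderiv ℝ (zeroExt (s := (s : Set (E m))) fun y => (f y : E n))) s :=
      hf.fderiv_of_isOpen s.isOpen (by simp)
    have hc : ContDiffOn ℝ ∞ (fun x => zeroExt (s := (t : Set (E n))) w.1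
        (zeroExt (s := (s : Set (E m))) (fun y => (f y : E n)) x)) s := by
      refine ContDiffOn.comp (t := (t : Set (E n))) w.2 hf fun x hx => ?_
      have := zeroExt_apply (s := (s : Set (E m))) (fun y => (f y : E n)) ⟨x, hx⟩
      simp only at this
      rw [this]
      exact (f ⟨x, hx⟩).2
    refine (contDiffOn_compContinuousLinearMap hc hd).congr fun x hx => ?_
    have h1 := zeroExt_apply (s := (s : Set (E m))) (fun y => (f y : E n)) ⟨x, hx⟩
    have h2 := zeroExt_apply (s := (t : Set (E n))) w.1 (f ⟨x, hx⟩)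
    have h3 := zeroExt_apply (s := (s : Set (E m)))
      (fun x => (w.1 (f x)).compContinuousLinearMap (mapDeriv f x)) ⟨x, hx⟩
    simp only at h1 h2 h3
    refine h3.trans ?_
    rw [h1, h2]
    rfl⟩
  map_zero' := rfl
  map_add' _ _ := rfl

/-- The exterior derivative of differential forms. -/
def Form.d {n : ℕ} {s : Op n} (q : ℕ) : Form s q →+ Form s (q + 1) :=
  AddMonoidHom.mk' (fun w => ⟨fun x => extDeriv (zeroExt (s := (s : Set (E n))) w.1) x, by
    have hd : ContDiffOn ℝ ∞ (fderiv ℝ (zeroExt (s := (s : Set (E n))) w.1)) s :=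
      w.2.fderiv_of_isOpen s.isOpen (by simp)
    refine ((ContinuousAlternatingMap.alternatizeUncurryFinCLM ℝ (E n) ℝ
      (n := q)).contDiff.comp_contDiffOn hd).congr fun x hx => ?_
    exact zeroExt_apply (s := (s : Set (E n)))
      (fun x : s => extDeriv (zeroExt (s := (s : Set (E n))) w.1) x) ⟨x, hx⟩⟩) (by
    intro a b
    ext x : 2
    have hab (c : Form s q) :
        DifferentiableAt ℝ (zeroExt (s := (s : Set (E n))) c.1) (x : E n) :=
      (c.2.contDiffAt (s.isOpen.mem_nhds x.2)).differentiableAt (by simp)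
    refine Eq.trans ?_ (extDeriv_add (hab a) (hab b))
    refine congrArg (fun w => extDeriv w (x : E n)) ?_
    funext y
    by_cases hy : y ∈ (s : Set (E n))
    · have h1 := zeroExt_apply (s := (s : Set (E n))) a.1 ⟨y, hy⟩
      have h2 := zeroExt_apply (s := (s : Set (E n))) b.1 ⟨y, hy⟩
      have h3 := zeroExt_apply (s := (s : Set (E n))) (a + b).1 ⟨y, hy⟩
      simp only at h1 h2 h3
      rw [Pi.add_apply, h3, h1, h2]
      rfl
    · have h (c : s → Alt n q) : zeroExt (s := (s : Set (E n))) c y = 0 :=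
        Function.extend_apply' _ _ _ (by rintro ⟨z, rfl⟩; exact hy z.2)
      rw [Pi.add_apply, h, h, h, add_zero])
/-! ### Effective orbifold charts and their embeddings -/

/-- An effective orbifold chart `(Ũ, G, π)` of dimension `n` on `X`, over the open set
`U = π(Ũ)`.  A subgroup of the permutations of `Ũ` acts effectively on `Ũ`; since its elements are
smooth, so are their inverses.  The empty chart is allowed. -/
structure Chart (X : Type u) [TopologicalSpace X] (n : ℕ) where
  /-- the connected open set `Ũ ⊆ ℝⁿ` -/
  dom : Op n
  isPreconnected_dom : IsPreconnected (dom : Set (E n))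
  /-- the finite group `G` of diffeomorphisms of `Ũ` -/
  grp : Subgroup (Equiv.Perm dom)
  finite_grp : Finite grp
  smooth_grp : ∀ g ∈ grp, IsSmooth (g : dom → dom)
  /-- the projection `π : Ũ → U` -/
  proj : dom → X
  continuous_proj : Continuous proj
  isOpen_range : IsOpen (Set.range proj)
  invariant : ∀ g ∈ grp, ∀ x, proj (g x) = proj x
  homeo : ∃ e : MulAction.orbitRel.Quotient grp dom ≃ₜ Set.range proj,
    ∀ x : dom, (e (Quotient.mk (MulAction.orbitRel grp dom) x) : X) = proj x

/-- The uniformized set `U = π(Ũ)`. -/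
def Chart.image {X : Type u} [TopologicalSpace X] {n : ℕ} (c : Chart X n) : Set X :=
  Set.range c.proj

/-- An embedding of charts: a smooth embedding `Ũ → Ṽ` which lifts the inclusion `U ⊆ V`. -/
@[ext]
structure Embedding {X : Type u} [TopologicalSpace X] {n : ℕ} (c d : Chart X n) where
  toFun : c.dom → d.dom
  smooth : IsSmooth toFun
  immersion : ∀ x, Function.Injective (mapDeriv toFun x)
  isEmbedding : IsEmbedding toFun
  proj_comp : ∀ x, d.proj (toFun x) = c.proj x

theorem Embedding.image_subset {X : Type u} [TopologicalSpace X] {n : ℕ} {c d : Chart X n}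
    (l : Embedding c d) : c.image ⊆ d.image := by
  rintro _ ⟨x, rfl⟩
  exact ⟨l.toFun x, l.proj_comp x⟩

/-- Charts and their embeddings form a category. -/
instance chartCategory (X : Type u) [TopologicalSpace X] (n : ℕ) : Category (Chart X n) where
  Hom c d := Embedding c d
  id c :=
    { toFun := id
      smooth := IsSmooth.id
      immersion := fun x => by rw [mapDeriv_id]; exact fun _ _ h => h
      isEmbedding := IsEmbedding.id
      proj_comp := fun _ => rfl }
  comp f g :=
    { toFun := g.toFun ∘ f.toFun
      smooth := g.smooth.comp f.smooth
      immersion := fun x => by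
        rw [mapDeriv_comp g.smooth f.smooth]
        exact (g.immersion _).comp (f.immersion x)
      isEmbedding := g.isEmbedding.comp f.isEmbedding
      proj_comp := fun x => (g.proj_comp _).trans (f.proj_comp x) }

/-! ### Good atlases -/

/-- `F(V)`: the (non-empty) finite subsets of `V`. -/
def FinSub (V : Type v) : Type v := {I : Finset V // I.Nonempty}

/-- The singleton `{i}`. -/
def FinSub.single {V : Type v} (i : V) : FinSub V := ⟨{i}, Finset.singleton_nonempty i⟩

/-- The union `I₀ ∪ ⋯ ∪ I_p` of a string of finite sets. -/
def FinSub.union {V : Type v} {p : ℕ} (s : Fin (p + 1) → FinSub V) : FinSub V := by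
  classical
  exact ⟨Finset.univ.biUnion fun k => (s k).1,
    Finset.Nonempty.mono (Finset.subset_biUnion_of_mem (fun k => (s k).1) (Finset.mem_univ 0))
      (s 0).2⟩

/-- A family of charts is an effective orbifold atlas if the uniformized sets cover `X`, and if
any two charts are locally compatible. -/
structure IsAtlas {X : Type u} [TopologicalSpace X] {n : ℕ} {ι : Type v}
    (chart : ι → Chart X n) : Prop where
  cover : ⋃ i, (chart i).image = Set.univ
  compatible : ∀ i j, ∀ x ∈ (chart i).image ∩ (chart j).image, ∃ k,
    x ∈ (chart k).image ∧ (chart k).image ⊆ (chart i).image ∩ (chart j).image ∧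
      Nonempty (chart k ⟶ chart i) ∧ Nonempty (chart k ⟶ chart j)

/-- A good (effective orbifold) atlas, together with its underlying paracompact, second countable
Hausdorff space.  These are the objects of the 2-category `GPreOrb`. -/
structure GPreOrb : Type (max u v + 1) where
  X : Type u
  [top : TopologicalSpace X]
  [t2 : T2Space X]
  [paracompact : ParacompactSpace X]
  [secondCountable : SecondCountableTopology X]
  dim : ℕ
  /-- the index set `V` of the good cover -/
  V : Type v
  [countable : Countable V]
  chart : FinSub V → Chart X dim
  isAtlas : IsAtlas chart
  locallyFinite : LocallyFinite fun i : V => (chart (FinSub.single i)).image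
  cover : ⋃ i : V, (chart (FinSub.single i)).image = Set.univ
  contractible_dom : ∀ I, Nonempty (chart I).dom → ContractibleSpace (chart I).dom
  contractible_image : ∀ I, (chart I).image.Nonempty → ContractibleSpace (chart I).image
  image_union : ∀ (p : ℕ) (s : Fin (p + 1) → FinSub V),
    (chart (FinSub.union s)).image = ⋂ k, (chart (s k)).image
  exists_embedding : ∀ I J, (chart I).image ⊆ (chart J).image → Nonempty (chart I ⟶ chart J)

namespace GPreOrb

attribute [instance] top t2 paracompact secondCountable countable

/-- The index set `F(V)` of a good atlas. -/
def Idx (U : GPreOrb.{u, v}) : Type v := FinSub U.V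

/-- The good atlas as a category: its objects are the (indices of the) charts and its morphisms are
the embeddings of charts. -/
instance (U : GPreOrb.{u, v}) : Category U.Idx where
  Hom I J := U.chart I ⟶ U.chart J
  id I := 𝟙 (U.chart I)
  comp f g := CategoryStruct.comp (obj := Chart U.X U.dim) f g

/-- `Ũ_I`. -/
def dom (U : GPreOrb.{u, v}) (I : U.Idx) : Op U.dim := (U.chart I).dom

/-- `U_I`. -/
def image (U : GPreOrb.{u, v}) (I : U.Idx) : Set U.X := (U.chart I).image

/-- `∪𝐈 = I₀ ∪ ⋯ ∪ I_p` for a string `𝐈 = I₀ … I_p` of elements of `F(V)`. -/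
def union {U : GPreOrb.{u, v}} {p : ℕ} (s : Fin (p + 1) → U.Idx) : U.Idx := FinSub.union s

/-- The map `Ũ_I → Ũ_J` underlying an embedding of charts. -/
def emb {U : GPreOrb.{u, v}} {I J : U.Idx} (l : I ⟶ J) : U.dom I → U.dom J := Embedding.toFun l

theorem emb_smooth {U : GPreOrb.{u, v}} {I J : U.Idx} (l : I ⟶ J) : IsSmooth (emb l) :=
  Embedding.smooth l

theorem emb_comp {U : GPreOrb.{u, v}} {I J K : U.Idx} (l : I ⟶ J) (m : J ⟶ K) (x : U.dom I) :
    emb (l ≫ m) x = emb m (emb l x) := rfl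

end GPreOrb

/-! ### Compatible systems and their natural transformations -/

/-- A compatible system `U → V`, for a continuous map `base` of the underlying spaces: a functor
between the atlases, together with compatible liftings of `base` to the charts. -/
structure CompatSystem (U V : GPreOrb.{u, v}) where
  /-- the underlying continuous map -/
  base : C(U.X, V.X)
  /-- the functor between atlases -/
  functor : U.Idx ⥤ V.Idx
  image_subset : ∀ I, base '' U.image I ⊆ V.image (functor.obj I)
  map_union : ∀ (p : ℕ) (s : Fin (p + 1) → U.Idx),
    functor.obj (GPreOrb.union s) = GPreOrb.union fun k => functor.obj (s k)
  /-- the liftings -/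
  lift : ∀ I, U.dom I → V.dom (functor.obj I)
  lift_smooth : ∀ I, IsSmooth (lift I)
  lift_proj : ∀ I x, (V.chart (functor.obj I)).proj (lift I x) = base ((U.chart I).proj x)
  lift_emb : ∀ {I J : U.Idx} (l : I ⟶ J) (x : U.dom I),
    lift J (GPreOrb.emb l x) = GPreOrb.emb (functor.map l) (lift I x)

/-- A natural transformation of compatible systems of the same continuous map. -/
@[ext]
structure CompatNatTrans {U V : GPreOrb.{u, v}} (f g : CompatSystem U V) where
  base_eq : f.base = g.base
  /-- the natural transformation of functors -/
  trans : f.functor ⟶ g.functor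
  lift_eq : ∀ I x, g.lift I x = GPreOrb.emb (trans.app I) (f.lift I x)

/-- The identity compatible system. -/
def CompatSystem.id (U : GPreOrb.{u, v}) : CompatSystem U U where
  base := ContinuousMap.id _
  functor := 𝟭 _
  image_subset I := by simp
  map_union _ _ := rfl
  lift _ := _root_.id
  lift_smooth _ := IsSmooth.id
  lift_proj _ _ := rfl
  lift_emb _ _ := rfl

/-- Composition of compatible systems: `(g ∘ f)_I = g_{f I} ∘ f_I`. -/
def CompatSystem.comp {U V W : GPreOrb.{u, v}} (f : CompatSystem U V) (g : CompatSystem V W) :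
    CompatSystem U W where
  base := g.base.comp f.base
  functor := f.functor ⋙ g.functor
  image_subset I := by
    rw [ContinuousMap.coe_comp, Set.image_comp]
    exact (Set.image_mono (f.image_subset I)).trans (g.image_subset _)
  map_union p s := by
    rw [Functor.comp_obj, f.map_union, g.map_union]
    rfl
  lift I := g.lift (f.functor.obj I) ∘ f.lift I
  lift_smooth I := (g.lift_smooth _).comp (f.lift_smooth I)
  lift_proj I x := by
    refine (g.lift_proj _ _).trans ?_
    rw [f.lift_proj]
    rfl
  lift_emb l x := by
    simp only [Function.comp_apply, f.lift_emb, g.lift_emb, Functor.comp_map]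

/-- Natural transformations of compatible systems, composed vertically. -/
instance compatSystemCategory (U V : GPreOrb.{u, v}) : Category (CompatSystem U V) where
  Hom f g := CompatNatTrans f g
  id f := ⟨rfl, 𝟙 _, fun _ _ => rfl⟩
  comp a b := ⟨a.base_eq.trans b.base_eq, a.trans ≫ b.trans, fun I x => by
    rw [b.lift_eq, a.lift_eq]; rfl⟩

/-- Whiskering of natural transformations of compatible systems. -/
def CompatNatTrans.whiskerLeft {U V W : GPreOrb.{u, v}} (f : CompatSystem U V)
    {g h : CompatSystem V W} (b : CompatNatTrans g h) : CompatNatTrans (f.comp g) (f.comp h) where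
  base_eq := congrArg (fun k : C(V.X, W.X) => k.comp f.base) b.base_eq
  trans := Functor.whiskerLeft f.functor b.trans
  lift_eq _ _ := b.lift_eq _ _

/-- Whiskering of natural transformations of compatible systems. -/
def CompatNatTrans.whiskerRight {U V W : GPreOrb.{u, v}} {f g : CompatSystem U V}
    (a : CompatNatTrans f g) (h : CompatSystem V W) : CompatNatTrans (f.comp h) (g.comp h) where
  base_eq := congrArg (fun k : C(U.X, V.X) => h.base.comp k) a.base_eq
  trans := Functor.whiskerRight a.trans h.functor
  lift_eq I x := by
    refine (congrArg (h.lift _) (a.lift_eq I x)).trans ?_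
    exact h.lift_emb _ _

theorem CompatNatTrans.hom_ext {U V : GPreOrb.{u, v}} {f g : CompatSystem U V} {a b : f ⟶ g}
    (h : ∀ I, a.trans.app I = b.trans.app I) : a = b :=
  CompatNatTrans.ext (NatTrans.ext (funext h))

/-- The 2-category `GPreOrb` of good atlases, compatible systems and natural transformations of
compatible systems. -/
instance : Bicategory GPreOrb.{u, v} where
  Hom U V := CompatSystem U V
  id U := CompatSystem.id U
  comp f g := f.comp g
  homCategory U V := compatSystemCategory U V
  whiskerLeft f _ _ b := CompatNatTrans.whiskerLeft f b
  whiskerRight a h := CompatNatTrans.whiskerRight a h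
  associator {U V W Z} f g h := Iso.refl ((CompatSystem.comp f (CompatSystem.comp g h)))
  leftUnitor f := Iso.refl f
  rightUnitor f := Iso.refl f
  whiskerLeft_id f g := rfl
  whiskerLeft_comp f g h i a b := rfl
  id_whiskerLeft a := by
    apply CompatNatTrans.hom_ext; intro I
    exact (Category.comp_id _).symm.trans (Category.id_comp _).symm
  comp_whiskerLeft f g h h' a := by
    apply CompatNatTrans.hom_ext; intro I
    exact (Category.comp_id _).symm.trans (Category.id_comp _).symm
  id_whiskerRight f g := by
    apply CompatNatTrans.hom_ext; intro I
    exact g.functor.map_id _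
  comp_whiskerRight a b i := by
    apply CompatNatTrans.hom_ext; intro I
    exact i.functor.map_comp _ _
  whiskerRight_id a := by
    apply CompatNatTrans.hom_ext; intro I
    exact (Category.comp_id _).symm.trans (Category.id_comp _).symm
  whiskerRight_comp a g h := by
    apply CompatNatTrans.hom_ext; intro I
    exact (Category.comp_id _).symm.trans (Category.id_comp _).symm
  whisker_assoc f g g' a h := by
    apply CompatNatTrans.hom_ext; intro I
    exact (Category.comp_id _).symm.trans (Category.id_comp _).symm
  whisker_exchange a b := by
    apply CompatNatTrans.hom_ext; intro I
    exact (b.trans.naturality (a.trans.app I)).symm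
  pentagon f g h i := by
    apply CompatNatTrans.hom_ext; intro I
    exact congrArg (fun m => m ≫ (𝟙 _ ≫ 𝟙 _)) (i.functor.map_id _)
  triangle f g := by
    apply CompatNatTrans.hom_ext; intro I
    exact (Category.id_comp _).trans (g.functor.map_id _).symm

instance : Bicategory.Strict GPreOrb.{u, v} where
  id_comp _ := rfl
  comp_id _ := rfl
  assoc _ _ _ := rfl
  leftUnitor_eqToIso _ := rfl
  rightUnitor_eqToIso _ := rfl
  associator_eqToIso _ _ _ := rfl

/-! ### The 2-category of spark complexes -/

open CochainComplex.HomComplex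

/-- A subcomplex of a cochain complex of abelian groups. -/
structure Subcomplex (F : CochainComplex AddCommGrpCat.{v} ℤ) where
  carrier : ∀ k, AddSubgroup (F.X k)
  d_mem : ∀ i j, ∀ x ∈ carrier i, F.d i j x ∈ carrier j

/-- A subcomplex as a cochain complex. -/
def Subcomplex.toComplex {F : CochainComplex AddCommGrpCat.{v} ℤ} (A : Subcomplex F) :
    CochainComplex AddCommGrpCat.{v} ℤ where
  X k := AddCommGrpCat.of (A.carrier k)
  d i j := AddCommGrpCat.ofHom
    (((F.d i j).hom.comp (A.carrier i).subtype).codRestrict (A.carrier j)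
      fun x => A.d_mem i j x.1 x.2)
  shape i j h := by
    ext x
    change F.d i j x.1 = 0
    rw [F.shape i j h]
    rfl
  d_comp_d' i j k _ _ := by
    ext x
    change F.d j k (F.d i j x.1) = 0
    rw [← AddCommGrpCat.comp_apply, F.d_comp_d]
    rfl

/-- The inclusion of a subcomplex. -/
def Subcomplex.ι {F : CochainComplex AddCommGrpCat.{v} ℤ} (A : Subcomplex F) :
    A.toComplex ⟶ F where
  f k := AddCommGrpCat.ofHom (A.carrier k).subtype
  comm' i j _ := by
    ext x
    rfl

/-- A triple `(F, E, I)` consisting of a cochain complex `F` and two subcomplexes `E` and `I`. -/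
structure Triple where
  F : CochainComplex AddCommGrpCat.{v} ℤ
  E : Subcomplex F
  I : Subcomplex F

/-- The triple `(F, E, I)` is a spark complex: `Iᵏ ∩ Eᵏ = 0` for `k > 0`, everything vanishes in
negative degrees, and the inclusion induces an isomorphism `H^*(E) ≅ H^*(F)`. -/
structure Triple.IsSpark (T : Triple.{v}) : Prop where
  inter : ∀ k > 0, T.I.carrier k ⊓ T.E.carrier k = ⊥
  neg : ∀ k < 0, ∀ x : T.F.X k, x = 0
  quasiIso : QuasiIso T.E.ι

/-- Spark complexes. -/
structure SpCx : Type (v + 1) extends Triple.{v} where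
  isSpark : toTriple.IsSpark

/-- Spark homomorphisms: cochain maps which preserve the subcomplexes `E` and `I`. -/
@[ext]
structure SparkHom (A B : Triple.{v}) where
  hom : A.F ⟶ B.F
  map_E : ∀ k, ∀ x ∈ A.E.carrier k, hom.f k x ∈ B.E.carrier k
  map_I : ∀ k, ∀ x ∈ A.I.carrier k, hom.f k x ∈ B.I.carrier k

/-- The identity spark homomorphism. -/
def SparkHom.id (A : Triple.{v}) : SparkHom A A where
  hom := 𝟙 _
  map_E _ _ h := h
  map_I _ _ h := h

/-- Composition of spark homomorphisms. -/
def SparkHom.comp {A B C : Triple.{v}} (f : SparkHom A B) (g : SparkHom B C) : SparkHom A C where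
  hom := f.hom ≫ g.hom
  map_E k x h := g.map_E k _ (f.map_E k x h)
  map_I k x h := g.map_I k _ (f.map_I k x h)

/-- The subgroup of the homomorphisms `F → F'` of degree `n` (not necessarily compatible with the
differentials) which vanish on `E` and map `I` into `I'`. -/
def sparkCochains (A B : Triple.{v}) (n : ℤ) : AddSubgroup (Cochain A.F B.F n) where
  carrier := {z | (∀ p q hpq, ∀ x ∈ A.E.carrier p, z.v p q hpq x = 0) ∧
    ∀ p q hpq, ∀ x ∈ A.I.carrier p, z.v p q hpq x ∈ B.I.carrier q}
  zero_mem' := ⟨fun _ _ _ _ _ => rfl, fun _ _ _ _ _ => zero_mem _⟩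
  add_mem' {y z} hy hz := by
    refine ⟨fun p q hpq x hx => ?_, fun p q hpq x hx => ?_⟩
    · change y.v p q hpq x + z.v p q hpq x = 0
      rw [hy.1 p q hpq x hx, hz.1 p q hpq x hx, add_zero]
    · exact add_mem (hy.2 p q hpq x hx) (hz.2 p q hpq x hx)
  neg_mem' {y} hy := by
    refine ⟨fun p q hpq x hx => ?_, fun p q hpq x hx => ?_⟩
    · change -(y.v p q hpq x) = 0
      rw [hy.1 p q hpq x hx, neg_zero]
    · exact neg_mem (hy.2 p q hpq x hx)

/-- A spark homotopy `Φ : f ⟹ g`, i.e. a homomorphism of degree `-1` with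
`d ∘ Φ + Φ ∘ d = g - f` which vanishes on `E` and maps `I` into `I'`. -/
structure SparkHomotopy {A B : Triple.{v}} (f g : SparkHom A B) where
  hom : Cochain A.F B.F (-1)
  mem : hom ∈ sparkCochains A B (-1)
  comm : δ (-1) 0 hom = Cochain.ofHom g.hom - Cochain.ofHom f.hom

/-- `Φ ∼ Ψ`: there is a homotopy `Γ` of spark homotopies, i.e. a homomorphism of degree `-2` with
`d ∘ Γ - Γ ∘ d = Ψ - Φ` which vanishes on `E` and maps `I` into `I'`. -/
def sparkHomotopySetoid {A B : Triple.{v}} (f g : SparkHom A B) : Setoid (SparkHomotopy f g) where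
  r a b := ∃ c ∈ sparkCochains A B (-2), δ (-2) (-1) c = b.hom - a.hom
  iseqv :=
    { refl := fun a => ⟨0, zero_mem _, by simp⟩
      symm := by
        rintro a b ⟨c, hc, h⟩
        exact ⟨-c, neg_mem hc, by rw [δ_neg, h, neg_sub]⟩
      trans := by
        rintro a b c ⟨x, hx, h⟩ ⟨y, hy, h'⟩
        exact ⟨x + y, add_mem hx hy, by rw [δ_add, h, h']; abel⟩ }

/-- Spark homotopy classes. -/
def SparkHomotopyClass {A B : Triple.{v}} (f g : SparkHom A B) : Type v :=
  Quotient (sparkHomotopySetoid f g)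

/-- The class `[Φ]` of a spark homotopy `Φ`. -/
def SparkHomotopy.cls {A B : Triple.{v}} {f g : SparkHom A B} (a : SparkHomotopy f g) :
    SparkHomotopyClass f g := Quotient.mk (sparkHomotopySetoid f g) a

theorem SparkHomotopy.cls_eq {A B : Triple.{v}} {f g : SparkHom A B} {a b : SparkHomotopy f g}
    (h : a.hom = b.hom) : a.cls = b.cls := by
  cases a; cases b; cases h; rfl

/-- The vertical composition `Ψ + Φ`. -/
def SparkHomotopy.vcomp {A B : Triple.{v}} {f g h : SparkHom A B} (a : SparkHomotopy f g)
    (b : SparkHomotopy g h) : SparkHomotopy f h where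
  hom := a.hom + b.hom
  mem := add_mem a.mem b.mem
  comm := by rw [δ_add, a.comm, b.comm]; abel

theorem comp_mem_left {A B C : Triple.{v}} (f : SparkHom A B) {n : ℤ} {z : Cochain B.F C.F n}
    (hz : z ∈ sparkCochains B C n) :
    (Cochain.ofHom f.hom).comp z (zero_add n) ∈ sparkCochains A C n := by
  refine ⟨fun p q hpq x hx => ?_, fun p q hpq x hx => ?_⟩
  · rw [Cochain.zero_cochain_comp_v, Cochain.ofHom_v]
    exact hz.1 p q hpq _ (f.map_E p x hx)
  · rw [Cochain.zero_cochain_comp_v, Cochain.ofHom_v]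
    exact hz.2 p q hpq _ (f.map_I p x hx)

theorem comp_mem_right {A B C : Triple.{v}} {n : ℤ} {z : Cochain A.F B.F n}
    (hz : z ∈ sparkCochains A B n) (g : SparkHom B C) :
    z.comp (Cochain.ofHom g.hom) (add_zero n) ∈ sparkCochains A C n := by
  refine ⟨fun p q hpq x hx => ?_, fun p q hpq x hx => ?_⟩
  · rw [Cochain.comp_zero_cochain_v, Cochain.ofHom_v]
    change g.hom.f q (z.v p q hpq x) = 0
    rw [hz.1 p q hpq x hx, map_zero]
  · rw [Cochain.comp_zero_cochain_v, Cochain.ofHom_v]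
    exact g.map_I q _ (hz.2 p q hpq x hx)

theorem comp_mem {A B C : Triple.{v}} {m n k : ℤ} {y : Cochain A.F B.F m}
    (hy : y ∈ sparkCochains A B m) {z : Cochain B.F C.F n} (hz : z ∈ sparkCochains B C n)
    (h : m + n = k) : y.comp z h ∈ sparkCochains A C k := by
  refine ⟨fun p q hpq x hx => ?_, fun p q hpq x hx => ?_⟩
  · rw [Cochain.comp_v y z h p (p + m) q rfl (by lia)]
    change z.v _ _ _ (y.v _ _ _ x) = 0
    rw [hy.1 _ _ _ x hx, map_zero]
  · rw [Cochain.comp_v y z h p (p + m) q rfl (by lia)]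
    exact hz.2 _ _ _ _ (hy.2 _ _ _ x hx)

/-- Precomposition of a spark homotopy with a spark homomorphism. -/
def SparkHomotopy.whiskerLeft {A B C : Triple.{v}} (f : SparkHom A B) {g h : SparkHom B C}
    (a : SparkHomotopy g h) : SparkHomotopy (f.comp g) (f.comp h) where
  hom := (Cochain.ofHom f.hom).comp a.hom (zero_add _)
  mem := comp_mem_left f a.mem
  comm := by
    rw [δ_zero_cochain_comp _ _ 0 (by norm_num), a.comm, δ_ofHom, Cochain.zero_comp, smul_zero,
      add_zero, Cochain.comp_sub, ← Cochain.ofHom_comp, ← Cochain.ofHom_comp]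
    rfl

/-- Postcomposition of a spark homotopy with a spark homomorphism. -/
def SparkHomotopy.whiskerRight {A B C : Triple.{v}} {f g : SparkHom A B}
    (a : SparkHomotopy f g) (h : SparkHom B C) : SparkHomotopy (f.comp h) (g.comp h) where
  hom := a.hom.comp (Cochain.ofHom h.hom) (add_zero _)
  mem := comp_mem_right a.mem h
  comm := by
    rw [δ_comp_zero_cochain _ _ 0 (by norm_num), a.comm, δ_ofHom, Cochain.comp_zero,
      zero_add, Cochain.sub_comp, ← Cochain.ofHom_comp, ← Cochain.ofHom_comp]
    rfl

/-- Spark homotopy classes as morphisms, with vertical composition. -/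
instance sparkHomCategory (A B : Triple.{v}) : Category (SparkHom A B) where
  Hom f g := SparkHomotopyClass f g
  id f := SparkHomotopy.cls ⟨0, zero_mem _, by simp⟩
  comp a b := Quotient.map₂ SparkHomotopy.vcomp (by
    rintro a a' ⟨x, hx, h⟩ b b' ⟨y, hy, h'⟩
    refine ⟨x + y, add_mem hx hy, ?_⟩
    rw [δ_add, h, h']
    simp only [SparkHomotopy.vcomp]
    abel) a b
  id_comp a := by
    induction a using Quotient.inductionOn
    exact SparkHomotopy.cls_eq (zero_add _)
  comp_id a := by
    induction a using Quotient.inductionOn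
    exact SparkHomotopy.cls_eq (add_zero _)
  assoc a b c := by
    induction a using Quotient.inductionOn
    induction b using Quotient.inductionOn
    induction c using Quotient.inductionOn
    exact SparkHomotopy.cls_eq (add_assoc _ _ _)

/-- Whiskering of spark homotopy classes. -/
def SparkHomotopyClass.whiskerLeft {A B C : Triple.{v}} (f : SparkHom A B) {g h : SparkHom B C}
    (a : SparkHomotopyClass g h) : SparkHomotopyClass (f.comp g) (f.comp h) :=
  Quotient.map (SparkHomotopy.whiskerLeft f) (by
    rintro a b ⟨c, hc, h⟩
    refine ⟨(Cochain.ofHom f.hom).comp c (zero_add _), comp_mem_left f hc, ?_⟩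
    rw [δ_zero_cochain_comp _ _ (-1) (by norm_num), h, δ_ofHom, Cochain.zero_comp, smul_zero,
      add_zero, Cochain.comp_sub]
    rfl) a

/-- Whiskering of spark homotopy classes. -/
def SparkHomotopyClass.whiskerRight {A B C : Triple.{v}} {f g : SparkHom A B}
    (a : SparkHomotopyClass f g) (h : SparkHom B C) :
    SparkHomotopyClass (f.comp h) (g.comp h) :=
  Quotient.map (fun a => SparkHomotopy.whiskerRight a h) (by
    rintro a b ⟨c, hc, h'⟩
    refine ⟨c.comp (Cochain.ofHom h.hom) (add_zero _), comp_mem_right hc h, ?_⟩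
    rw [δ_comp_zero_cochain _ _ (-1) (by norm_num), h', δ_ofHom, Cochain.comp_zero,
      zero_add, Cochain.sub_comp]
    rfl) a

/-- The 2-category `SpCx` of spark complexes, spark homomorphisms and spark homotopy classes. -/
instance : Bicategory SpCx.{v} where
  Hom A B := SparkHom A.toTriple B.toTriple
  id A := SparkHom.id A.toTriple
  comp f g := f.comp g
  homCategory A B := sparkHomCategory A.toTriple B.toTriple
  whiskerLeft f _ _ a := SparkHomotopyClass.whiskerLeft f a
  whiskerRight a h := SparkHomotopyClass.whiskerRight a h
  associator f g h := Iso.refl (SparkHom.comp f (SparkHom.comp g h))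
  leftUnitor f := Iso.refl f
  rightUnitor f := Iso.refl f
  whiskerLeft_id f g := SparkHomotopy.cls_eq (by simp [SparkHomotopy.whiskerLeft])
  whiskerLeft_comp f g h i a b := by
    induction a using Quotient.inductionOn
    induction b using Quotient.inductionOn
    exact SparkHomotopy.cls_eq (Cochain.comp_add _ _ _ (zero_add _))
  id_whiskerLeft a := by
    induction a using Quotient.inductionOn
    exact SparkHomotopy.cls_eq (by
      simp [SparkHomotopy.whiskerLeft, SparkHomotopy.whiskerRight, SparkHomotopy.vcomp,
        SparkHom.id, SparkHom.comp])
  comp_whiskerLeft f g h h' a := by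
    induction a using Quotient.inductionOn
    exact SparkHomotopy.cls_eq (by
      simp [SparkHomotopy.whiskerLeft, SparkHomotopy.whiskerRight, SparkHomotopy.vcomp,
        SparkHom.id, SparkHom.comp])
  id_whiskerRight f g := SparkHomotopy.cls_eq (by
      simp [SparkHomotopy.whiskerLeft, SparkHomotopy.whiskerRight, SparkHomotopy.vcomp,
        SparkHom.id, SparkHom.comp])
  comp_whiskerRight a b i := by
    induction a using Quotient.inductionOn
    induction b using Quotient.inductionOn
    exact SparkHomotopy.cls_eq (Cochain.add_comp _ _ _ (add_zero _))
  whiskerRight_id a := by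
    induction a using Quotient.inductionOn
    exact SparkHomotopy.cls_eq (by
      simp [SparkHomotopy.whiskerLeft, SparkHomotopy.whiskerRight, SparkHomotopy.vcomp,
        SparkHom.id, SparkHom.comp])
  whiskerRight_comp a g h := by
    induction a using Quotient.inductionOn
    exact SparkHomotopy.cls_eq (by
      simp [SparkHomotopy.whiskerLeft, SparkHomotopy.whiskerRight, SparkHomotopy.vcomp,
        SparkHom.id, SparkHom.comp])
  whisker_assoc f g g' a h := by
    induction a using Quotient.inductionOn
    exact SparkHomotopy.cls_eq (by
      simp [SparkHomotopy.whiskerLeft, SparkHomotopy.whiskerRight, SparkHomotopy.vcomp,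
        SparkHom.id, SparkHom.comp])
  whisker_exchange a b := by
    induction a using Quotient.inductionOn with | h a
    induction b using Quotient.inductionOn with | h b
    refine Quotient.sound ⟨-a.hom.comp b.hom (by norm_num), neg_mem (comp_mem a.mem b.mem _), ?_⟩
    rw [δ_neg, δ_comp _ _ _ 0 0 (-1) (by norm_num) (by norm_num) (by norm_num), a.comm, b.comm]
    simp only [SparkHomotopy.whiskerLeft, SparkHomotopy.whiskerRight, SparkHomotopy.vcomp,
      Cochain.comp_sub, Cochain.sub_comp, Int.negOnePow_neg, Int.negOnePow_one, Units.neg_smul,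
      one_smul]
    abel
  pentagon f g h i := SparkHomotopy.cls_eq (by
      simp [SparkHomotopy.whiskerLeft, SparkHomotopy.whiskerRight, SparkHomotopy.vcomp,
        SparkHom.id, SparkHom.comp])
  triangle f g := SparkHomotopy.cls_eq (by
      simp [SparkHomotopy.whiskerLeft, SparkHomotopy.whiskerRight, SparkHomotopy.vcomp,
        SparkHom.id, SparkHom.comp])

instance : Bicategory.Strict SpCx.{v} where
  id_comp _ := rfl
  comp_id _ := rfl
  assoc _ _ _ := rfl
  leftUnitor_eqToIso _ := rfl
  rightUnitor_eqToIso _ := rfl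
  associator_eqToIso _ _ _ := rfl

/-! ### Spark characters -/

/-- The group of sparks of degree `k`: the `a ∈ Fᵏ` with `da = e - r` for some `e ∈ Eᵏ⁺¹` and
`r ∈ Iᵏ⁺¹`. -/
def sparks (T : Triple.{v}) (k : ℤ) : AddSubgroup (T.F.X k) :=
  (T.E.carrier (k + 1) ⊔ T.I.carrier (k + 1)).comap (T.F.d k (k + 1)).hom

theorem mem_sparks {T : Triple.{v}} {k : ℤ} {a : T.F.X k} :
    a ∈ sparks T k ↔ ∃ e ∈ T.E.carrier (k + 1), ∃ r ∈ T.I.carrier (k + 1),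
      T.F.d k (k + 1) a = e - r := by
  refine AddSubgroup.mem_sup.trans ⟨?_, ?_⟩
  · rintro ⟨e, he, r, hr, h⟩
    exact ⟨e, he, -r, neg_mem hr, by rw [sub_neg_eq_add]; exact h.symm⟩
  · rintro ⟨e, he, r, hr, h⟩
    exact ⟨e, he, -r, neg_mem hr, by rw [← sub_eq_add_neg]; exact h.symm⟩

/-- The subgroup of the elements of `Fᵏ` of the form `db + s` with `b ∈ Fᵏ⁻¹` and `s ∈ Iᵏ`. -/
def trivialSparks (T : Triple.{v}) (k : ℤ) : AddSubgroup (T.F.X k) :=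
  (T.F.d (k - 1) k).hom.range ⊔ T.I.carrier k

theorem mem_trivialSparks {T : Triple.{v}} {k : ℤ} {a : T.F.X k} :
    a ∈ trivialSparks T k ↔ ∃ b : T.F.X (k - 1), ∃ s ∈ T.I.carrier k,
      a = T.F.d (k - 1) k b + s := by
  refine AddSubgroup.mem_sup.trans ⟨?_, ?_⟩
  · rintro ⟨_, ⟨b, rfl⟩, s, hs, h⟩
    exact ⟨b, s, hs, h.symm⟩
  · rintro ⟨b, s, hs, h⟩
    exact ⟨_, ⟨b, rfl⟩, s, hs, h.symm⟩

/-- The group `Ĥᵏ` of spark characters of degree `k`: two sparks `a`, `a'` are equivalent if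
`a - a' = db + s` for some `b ∈ Fᵏ⁻¹` and `s ∈ Iᵏ`. -/
abbrev SparkChar (T : Triple.{v}) (k : ℤ) : Type v :=
  sparks T k ⧸ (trivialSparks T k).addSubgroupOf (sparks T k)

/-- The map on sparks induced by a spark homomorphism. -/
def SparkHom.sparkMap {A B : Triple.{v}} (f : SparkHom A B) (k : ℤ) :
    sparks A k →+ sparks B k :=
  ((f.hom.f k).hom.comp (sparks A k).subtype).codRestrict (sparks B k) (by
    rintro ⟨a, ha⟩
    obtain ⟨e, he, r, hr, h⟩ := mem_sparks.1 ha
    refine mem_sparks.2 ⟨_, f.map_E _ e he, _, f.map_I _ r hr, ?_⟩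
    change B.F.d k (k + 1) (f.hom.f k a) = _
    rw [← map_sub, ← h, ← AddCommGrpCat.comp_apply, ← AddCommGrpCat.comp_apply, f.hom.comm])

/-- The induced homomorphism `f_* : Ĥᵏ → Ĥᵏ`, `[a] ↦ [f a]`. -/
def SparkHom.charMap {A B : Triple.{v}} (f : SparkHom A B) (k : ℤ) :
    SparkChar A k →+ SparkChar B k :=
  QuotientAddGroup.map _ _ (f.sparkMap k) (by
    rintro ⟨a, ha⟩ h
    obtain ⟨b, s, hs, h⟩ := mem_trivialSparks.1 (AddSubgroup.mem_addSubgroupOf.1 h)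
    refine AddSubgroup.mem_addSubgroupOf.2
      (mem_trivialSparks.2 ⟨f.hom.f _ b, _, f.map_I _ s hs, ?_⟩)
    change f.hom.f k a = _
    simp only at h
    rw [h, map_add, ← AddCommGrpCat.comp_apply, ← AddCommGrpCat.comp_apply, f.hom.comm])

theorem SparkHom.charMap_id (A : Triple.{v}) (k : ℤ) :
    (SparkHom.id A).charMap k = AddMonoidHom.id _ :=
  QuotientAddGroup.addMonoidHom_ext _ (AddMonoidHom.ext fun _ => rfl)

theorem SparkHom.charMap_comp {A B C : Triple.{v}} (f : SparkHom A B) (g : SparkHom B C)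
    (k : ℤ) : (f.comp g).charMap k = (g.charMap k).comp (f.charMap k) :=
  QuotientAddGroup.addMonoidHom_ext _ (AddMonoidHom.ext fun _ => rfl)

theorem SparkHomotopy.charMap_eq {A B : Triple.{v}} {f g : SparkHom A B}
    (a : SparkHomotopy f g) (k : ℤ) : f.charMap k = g.charMap k := by
  refine QuotientAddGroup.addMonoidHom_ext _ (AddMonoidHom.ext ?_)
  rintro ⟨x, hx⟩
  refine QuotientAddGroup.eq.2 (AddSubgroup.mem_addSubgroupOf.2 (mem_trivialSparks.2 ?_))
  obtain ⟨e, he, r, hr, h⟩ := mem_sparks.1 hx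
  refine ⟨a.hom.v k (k - 1) (by lia) x, -(a.hom.v (k + 1) k (by lia) r),
    neg_mem (a.mem.2 _ _ _ r hr), ?_⟩
  have h1 := Cochain.congr_v a.comm k k (by lia)
  rw [δ_v (-1) 0 (by norm_num) _ k k (by lia) (k - 1) (k + 1) rfl rfl, Cochain.sub_v,
    Cochain.ofHom_v, Cochain.ofHom_v, Int.negOnePow_zero, one_smul] at h1
  have h2 := ConcreteCategory.congr_hom h1 x
  change B.F.d (k - 1) k (a.hom.v k (k - 1) _ x) + a.hom.v (k + 1) k _ (A.F.d k (k + 1) x) =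
    g.hom.f k x - f.hom.f k x at h2
  rw [h, map_sub, a.mem.1 _ _ _ e he, zero_sub] at h2
  rw [h2]
  change -(f.hom.f k x) + g.hom.f k x = _
  abel

/-- The category `GAb` of `ℤ`-graded abelian groups and their homomorphisms. -/
abbrev GAb : Type (v + 1) := GradedObject ℤ AddCommGrpCat.{v}

/-- The graded abelian group `Ĥ^*` of spark characters. -/
def charGroup (T : Triple.{v}) : GAb.{v} := fun k => AddCommGrpCat.of (SparkChar T k)

/-- The homomorphism `f_* : Ĥ^* → Ĥ^*` of graded abelian groups. -/
def SparkHom.charHom {A B : Triple.{v}} (f : SparkHom A B) : charGroup A ⟶ charGroup B :=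
  fun k => AddCommGrpCat.ofHom (f.charMap k)

theorem SparkHomotopyClass.charHom_eq {A B : Triple.{v}} {f g : SparkHom A B}
    (a : SparkHomotopyClass f g) : f.charHom = g.charHom := by
  induction a using Quotient.inductionOn with
  | h a =>
    funext k
    exact congrArg AddCommGrpCat.ofHom (a.charMap_eq k)

/-- The 2-functor `Char : SpCx → GAb`, where the 2-cells of `GAb` are trivial. -/
def Char : StrictPseudofunctor SpCx.{v} (LocallyDiscrete GAb.{v}) :=
  StrictPseudofunctor.mk''
    { obj := fun A => ⟨charGroup A.toTriple⟩
      map := fun f => ⟨SparkHom.charHom f⟩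
      map₂ := fun a => eqToHom (congrArg Discrete.mk (SparkHomotopyClass.charHom_eq a))
      map₂_id := fun _ => Subsingleton.elim _ _
      map₂_comp := fun _ _ => Subsingleton.elim _ _
      map_id := fun A => congrArg Discrete.mk
        (funext fun k => congrArg AddCommGrpCat.ofHom (SparkHom.charMap_id A.toTriple k))
      map_comp := fun f g => congrArg Discrete.mk
        (funext fun k => congrArg AddCommGrpCat.ofHom (SparkHom.charMap_comp f g k))
      map₂_whisker_left := fun _ _ _ _ => Subsingleton.elim _ _
      map₂_whisker_right := fun _ _ => Subsingleton.elim _ _ }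

/-! ### The double complex of a good atlas -/

namespace GPreOrb

/-- The pullback of forms along an embedding of charts in the atlas. -/
def pull {U : GPreOrb.{u, v}} {I J : U.Idx} (l : I ⟶ J) (q : ℕ) :
    Form (U.dom J) q →+ Form (U.dom I) q :=
  Form.pullback (emb l) (emb_smooth l) q

/-- A form on `Ũ_I` is invariant under the group `G_I`. -/
def IsInvariant {U : GPreOrb.{u, v}} {I : U.Idx} {q : ℕ} (w : Form (U.dom I) q) : Prop :=
  ∀ (g : Equiv.Perm (U.chart I).dom) (hg : g ∈ (U.chart I).grp),
    Form.pullback (g : (U.chart I).dom → (U.chart I).dom) ((U.chart I).smooth_grp g hg) q w = w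

/-- The restriction of forms from `Ũ_J` to `Ũ_I`, for `U_I ⊆ U_J`: the pullback along some embedding
(on invariant forms it does not depend on the choice of the embedding). -/
def restrict {U : GPreOrb.{u, v}} {I J : U.Idx} (h : U.image I ⊆ U.image J) (q : ℕ) :
    Form (U.dom J) q →+ Form (U.dom I) q :=
  pull (I := I) (J := J) (U.exists_embedding I J h).some q

theorem image_face {U : GPreOrb.{u, v}} {p : ℕ} (s : Fin (p + 2) → U.Idx) (k : Fin (p + 2)) :
    U.image (union s) ⊆ U.image (union (s ∘ k.succAbove)) := by
  have h1 : U.image (union s) = _ := U.image_union _ s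
  have h2 : U.image (union (s ∘ k.succAbove)) = _ := U.image_union _ (s ∘ k.succAbove)
  rw [h1, h2]
  exact Set.subset_iInter fun j => Set.iInter_subset _ (k.succAbove j)

theorem union_swap {U : GPreOrb.{u, v}} {p : ℕ} (s : Fin (p + 1) → U.Idx) (j k : Fin (p + 1)) :
    union s = union (s ∘ Equiv.swap j k) := by
  classical
  apply Subtype.ext
  ext i
  simp only [union, FinSub.union, Finset.mem_biUnion, Finset.mem_univ, true_and,
    Function.comp_apply]
  exact (Equiv.swap j k).exists_congr_left.trans (by simp)

theorem union_zero {U : GPreOrb.{u, v}} (s : Fin 1 → U.Idx) : union s = s 0 := by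
  classical
  apply Subtype.ext
  ext i
  simp [union, FinSub.union]

variable (U : GPreOrb.{u, v})

/-- Families `(ω_𝐈)` of forms `ω_𝐈 ∈ Ω^q(Ũ_𝐈)`, for all strings `𝐈 = I₀ … I_p` of elements of `F(V)`,
where `Ũ_𝐈 = Ũ_{∪𝐈}`. -/
abbrev RawCochain (p q : ℕ) : Type v :=
  ∀ s : Fin (p + 1) → U.Idx, Form (U.dom (union s)) q

/-- `C^p(U, Ω^q)`: the alternating families of invariant forms. -/
def cochains (p q : ℕ) : AddSubgroup (U.RawCochain p q) where
  carrier := {w | (∀ s, IsInvariant (w s)) ∧ ∀ s j k, j ≠ k →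
    w s = -pull (eqToHom (union_swap s j k)) q (w (s ∘ Equiv.swap j k))}
  zero_mem' := ⟨fun _ _ _ => map_zero _, fun _ _ _ _ => by
    simp only [Pi.zero_apply, map_zero, neg_zero]⟩
  add_mem' {a b} ha hb := by
    refine ⟨fun s g hg => ?_, fun s j k hjk => ?_⟩
    · exact (map_add _ _ _).trans (congrArg₂ (· + ·) (ha.1 s g hg) (hb.1 s g hg))
    · refine (congrArg₂ (· + ·) (ha.2 s j k hjk) (hb.2 s j k hjk)).trans ?_
      exact (neg_add _ _).symm.trans (congrArg (- ·) (map_add _ _ _).symm)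
  neg_mem' {a} ha := by
    refine ⟨fun s g hg => ?_, fun s j k hjk => ?_⟩
    · exact (map_neg _ _).trans (congrArg (- ·) (ha.1 s g hg))
    · exact congrArg (- ·) ((ha.2 s j k hjk).trans (map_neg _ _).symm)

/-- The differential `δ`, `(δω)_𝐈 = ∑_k (-1)^k ω_{𝐈 without I_k}|_{Ũ_𝐈}`. -/
def delta (p q : ℕ) : U.RawCochain p q →+ U.RawCochain (p + 1) q :=
  AddMonoidHom.mk' (fun w s => ∑ k : Fin (p + 2),
    (-1 : ℤ) ^ (k : ℕ) • restrict (image_face s k) q (w (s ∘ k.succAbove)))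
    (fun a b => by
      funext s
      refine Eq.trans (Finset.sum_congr rfl fun k _ => ?_) Finset.sum_add_distrib
      exact (congrArg (((-1 : ℤ) ^ (k : ℕ)) • ·) (map_add _ _ _)).trans (zsmul_add _ _ _))

/-- The exterior derivative on families of forms. -/
def extd (p q : ℕ) : U.RawCochain p q →+ U.RawCochain p (q + 1) :=
  AddMonoidHom.mk' (fun w s => Form.d q (w s)) (fun a b => by
    funext s
    simp only [Pi.add_apply, map_add])

/-- `Ω^q(U)`: the `q`-forms on the orbifold atlas. -/
def orbiForms (q : ℕ) : AddSubgroup (∀ I : U.Idx, Form (U.dom I) q) where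
  carrier := {w | (∀ I, IsInvariant (w I)) ∧ ∀ (I J : U.Idx) (l : I ⟶ J), pull l q (w J) = w I}
  zero_mem' := ⟨fun _ _ _ => map_zero _, fun _ _ _ => map_zero _⟩
  add_mem' {a b} ha hb := by
    refine ⟨fun s g hg => ?_, fun I J l => ?_⟩
    · exact (map_add _ _ _).trans (congrArg₂ (· + ·) (ha.1 s g hg) (hb.1 s g hg))
    · exact (map_add _ _ _).trans (congrArg₂ (· + ·) (ha.2 I J l) (hb.2 I J l))
  neg_mem' {a} ha := by
    refine ⟨fun s g hg => ?_, fun I J l => ?_⟩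
    · exact (map_neg _ _).trans (congrArg (- ·) (ha.1 s g hg))
    · exact (map_neg _ _).trans (congrArg (- ·) (ha.2 I J l))

/-- The identification of families `(ω_I)` with families indexed by the strings of length one. -/
def ofFamily (q : ℕ) : (∀ I : U.Idx, Form (U.dom I) q) →+ U.RawCochain 0 q :=
  AddMonoidHom.mk' (fun w s => pull (eqToHom (union_zero s)) q (w (s 0))) (fun a b => by
    funext s
    simp only [Pi.add_apply, map_add])

/-- `C^p(U, ℤ)`: the cochains in `C^p(U, Ω⁰)` all of whose components are constant functions with
integer values. -/
def intCochains (p : ℕ) : AddSubgroup (U.RawCochain p 0) where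
  carrier := {w | w ∈ U.cochains p 0 ∧ ∀ s, ∃ m : ℤ, ∀ x, (w s).1 x ![] = m}
  zero_mem' := ⟨zero_mem _, fun s => ⟨0, fun x => by simp⟩⟩
  add_mem' {a b} ha hb := ⟨add_mem ha.1 hb.1, fun s => by
    obtain ⟨m, hm⟩ := ha.2 s
    obtain ⟨n, hn⟩ := hb.2 s
    refine ⟨m + n, fun x => ?_⟩
    push_cast
    rw [← hm x, ← hn x]
    rfl⟩
  neg_mem' {a} ha := ⟨neg_mem ha.1, fun s => by
    obtain ⟨m, hm⟩ := ha.2 s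
    refine ⟨-m, fun x => ?_⟩
    push_cast
    rw [← hm x]
    rfl⟩

/-! ### The total complex -/

/-- The bidegrees `(p, q)` with `p + q = k`. -/
structure Bideg (k : ℤ) where
  p : ℕ
  q : ℕ
  eq : (p : ℤ) + q = k

/-- Families of elements of bidegrees `(p, q)` with `p + q = k`. -/
abbrev RawTot (k : ℤ) : Type v := ∀ t : Bideg k, U.RawCochain t.p t.q

/-- The horizontal part of the differential of the total complex. -/
def totDelta {i j : ℤ} (h : i + 1 = j) (x : U.RawTot i) : U.RawTot j
  | ⟨0, _, _⟩ => 0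
  | ⟨p + 1, q, e⟩ => U.delta p q (x ⟨p, q, by push_cast at e; lia⟩)

/-- The vertical part of the differential of the total complex. -/
def totExtd {i j : ℤ} (h : i + 1 = j) (x : U.RawTot i) : U.RawTot j
  | ⟨_, 0, _⟩ => 0
  | ⟨p, q + 1, e⟩ => (-1 : ℤ) ^ p • U.extd p q (x ⟨p, q, by push_cast at e; lia⟩)

/-- The differential `D = δ + (-1)^p d` of the total complex. -/
def totD {i j : ℤ} (h : i + 1 = j) : U.RawTot i →+ U.RawTot j :=
  AddMonoidHom.mk' (fun x => U.totDelta h x + U.totExtd h x) (fun a b => by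
    funext ⟨p, q, e⟩
    have h1 : U.totDelta h (a + b) ⟨p, q, e⟩ =
        U.totDelta h a ⟨p, q, e⟩ + U.totDelta h b ⟨p, q, e⟩ := by
      cases p with
      | zero => exact (add_zero _).symm
      | succ p => exact map_add (U.delta p q) _ _
    have h2 : U.totExtd h (a + b) ⟨p, q, e⟩ =
        U.totExtd h a ⟨p, q, e⟩ + U.totExtd h b ⟨p, q, e⟩ := by
      cases q with
      | zero => exact (add_zero _).symm
      | succ q =>
        exact (congrArg (((-1 : ℤ) ^ p) • ·) (map_add (U.extd p q) _ _)).trans (zsmul_add _ _ _)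
    exact (congrArg₂ (· + ·) h1 h2).trans (add_add_add_comm _ _ _ _))

/-- `F^k = ⨁_{p + q = k} C^p(U, Ω^q)`. -/
def totF (k : ℤ) : AddSubgroup (U.RawTot k) where
  carrier := {x | ∀ t, x t ∈ U.cochains t.p t.q}
  zero_mem' _ := zero_mem _
  add_mem' ha hb t := add_mem (ha t) (hb t)
  neg_mem' ha t := neg_mem (ha t)

/-- `E^k = Ω^k(U)`, in bidegree `(0, k)`. -/
def totE (k : ℤ) : AddSubgroup (U.RawTot k) where
  carrier := {x | (∀ p q e, x ⟨p + 1, q, e⟩ = 0) ∧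
    ∀ q e, x ⟨0, q, e⟩ ∈ (U.orbiForms q).map (U.ofFamily q)}
  zero_mem' := ⟨fun _ _ _ => rfl, fun _ _ => zero_mem _⟩
  add_mem' {a b} ha hb := ⟨fun p q e => by
    rw [Pi.add_apply, ha.1, hb.1, add_zero],
    fun q e => add_mem (ha.2 q e) (hb.2 q e)⟩
  neg_mem' {a} ha := ⟨fun p q e => by
    rw [Pi.neg_apply, ha.1, neg_zero], fun q e => neg_mem (ha.2 q e)⟩

/-- `I^k = C^k(U, ℤ)`, in bidegree `(k, 0)`. -/
def totI (k : ℤ) : AddSubgroup (U.RawTot k) where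
  carrier := {x | (∀ p q e, x ⟨p, q + 1, e⟩ = 0) ∧ ∀ p e, x ⟨p, 0, e⟩ ∈ U.intCochains p}
  zero_mem' := ⟨fun _ _ _ => rfl, fun _ _ => zero_mem _⟩
  add_mem' {a b} ha hb := ⟨fun p q e => by
    rw [Pi.add_apply, ha.1, hb.1, add_zero],
    fun q e => add_mem (ha.2 q e) (hb.2 q e)⟩
  neg_mem' {a} ha := ⟨fun p q e => by
    rw [Pi.neg_apply, ha.1, neg_zero], fun q e => neg_mem (ha.2 q e)⟩

/-- `F = Tot(C^*(U, Ω^*))` is a complex, and `E = Ω^*(U)` and `I = C^*(U, ℤ)` are subcomplexes. -/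
structure IsTriple : Prop where
  D_mem : ∀ {i j : ℤ} (h : i + 1 = j), ∀ x ∈ U.totF i, U.totD h x ∈ U.totF j
  D_D : ∀ {i j k : ℤ} (h : i + 1 = j) (h' : j + 1 = k), ∀ x ∈ U.totF i,
    U.totD h' (U.totD h x) = 0
  E_le : ∀ k, U.totE k ≤ U.totF k
  D_mem_E : ∀ {i j : ℤ} (h : i + 1 = j), ∀ x ∈ U.totE i, U.totD h x ∈ U.totE j
  I_le : ∀ k, U.totI k ≤ U.totF k
  D_mem_I : ∀ {i j : ℤ} (h : i + 1 = j), ∀ x ∈ U.totI i, U.totD h x ∈ U.totI j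

variable {U}

/-- The differential of the total complex. -/
def IsTriple.d (hU : U.IsTriple) (i j : ℤ) : U.totF i →+ U.totF j :=
  if h : i + 1 = j then
    ((U.totD h).comp (U.totF i).subtype).codRestrict (U.totF j) fun x => hU.D_mem h x.1 x.2
  else 0

theorem IsTriple.d_apply (hU : U.IsTriple) {i j : ℤ} (h : i + 1 = j) (x : U.totF i) :
    ((hU.d i j x : U.totF j) : U.RawTot j) = U.totD h x.1 := by
  rw [IsTriple.d, dif_pos h]; rfl

theorem IsTriple.d_of_ne (hU : U.IsTriple) {i j : ℤ} (h : ¬ i + 1 = j) : hU.d i j = 0 :=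
  dif_neg h

/-- The total complex `F = Tot(C^*(U, Ω^*))`. -/
def IsTriple.tot (hU : U.IsTriple) : CochainComplex AddCommGrpCat.{v} ℤ where
  X k := AddCommGrpCat.of (U.totF k)
  d i j := AddCommGrpCat.ofHom (hU.d i j)
  shape i j h := by rw [hU.d_of_ne h]; rfl
  d_comp_d' i j k hij hjk := by
    ext (x : U.totF i) : 2
    refine Subtype.ext ?_
    change ((hU.d j k (hU.d i j x) : U.totF k) : U.RawTot k) = 0
    exact (hU.d_apply hjk _).trans
      ((congrArg (U.totD hjk) (hU.d_apply hij x)).trans (hU.D_D hij hjk _ x.2))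

/-- The family of components of an element of the total complex. -/
def IsTriple.components (hU : U.IsTriple) {k : ℤ} (x : hU.tot.X k) : U.RawTot k :=
  Subtype.val (p := fun y => y ∈ U.totF k) x

/-- The triple `S_U = (Tot(C^*(U, Ω^*)), Ω^*(U), C^*(U, ℤ))`. -/
def IsTriple.triple (hU : U.IsTriple) : Triple.{v} where
  F := hU.tot
  E :=
    { carrier := fun k => (U.totE k).addSubgroupOf (U.totF k)
      d_mem := fun i j (x : U.totF i) hx => by
        refine AddSubgroup.mem_addSubgroupOf.2 ?_
        change ((hU.d i j x : U.totF j) : U.RawTot j) ∈ _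
        by_cases h : i + 1 = j
        · rw [hU.d_apply h]
          exact hU.D_mem_E h _ (AddSubgroup.mem_addSubgroupOf.1 hx)
        · rw [hU.d_of_ne h]
          exact zero_mem _ }
  I :=
    { carrier := fun k => (U.totI k).addSubgroupOf (U.totF k)
      d_mem := fun i j (x : U.totF i) hx => by
        refine AddSubgroup.mem_addSubgroupOf.2 ?_
        change ((hU.d i j x : U.totF j) : U.RawTot j) ∈ _
        by_cases h : i + 1 = j
        · rw [hU.d_apply h]
          exact hU.D_mem_I h _ (AddSubgroup.mem_addSubgroupOf.1 hx)
        · rw [hU.d_of_ne h]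
          exact zero_mem _ }

end GPreOrb

/-! ### The action of compatible systems -/

namespace CompatSystem

variable {U V : GPreOrb.{u, v}}

/-- `(f^* ω)_𝐈 = f_𝐈^* (ω_{f 𝐈})`, for `ω ∈ C^p(V, Ω^q)`. -/
def pullCochain (f : CompatSystem U V) (p q : ℕ) : V.RawCochain p q →+ U.RawCochain p q :=
  AddMonoidHom.mk' (fun w s => Form.pullback (f.lift (GPreOrb.union s)) (f.lift_smooth _) q
    (GPreOrb.pull (eqToHom (f.map_union p s)) q (w fun k => f.functor.obj (s k))))
    (fun a b => by
      funext s
      simp only [Pi.add_apply, map_add])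

/-- The induced homomorphism on the total complexes. -/
def pullTot (f : CompatSystem U V) (k : ℤ) : V.RawTot k →+ U.RawTot k :=
  AddMonoidHom.mk' (fun x t => f.pullCochain t.p t.q (x t)) (fun a b => by
    funext t
    exact map_add (f.pullCochain t.p t.q) _ _)

/-- The induced homomorphism is a homomorphism of triples. -/
structure IsSparkHom (f : CompatSystem U V) : Prop where
  map_F : ∀ k, ∀ x ∈ V.totF k, f.pullTot k x ∈ U.totF k
  map_D : ∀ {i j : ℤ} (h : i + 1 = j), ∀ x ∈ V.totF i,
    f.pullTot j (V.totD h x) = U.totD h (f.pullTot i x)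
  map_E : ∀ k, ∀ x ∈ V.totE k, f.pullTot k x ∈ U.totE k
  map_I : ∀ k, ∀ x ∈ V.totI k, f.pullTot k x ∈ U.totI k

/-- The spark homomorphism `S_V → S_U` induced by a compatible system `U → V`. -/
def IsSparkHom.sparkHom {f : CompatSystem U V} (hf : f.IsSparkHom) (hU : U.IsTriple)
    (hV : V.IsTriple) : SparkHom hV.triple hU.triple where
  hom :=
    { f := fun k => AddCommGrpCat.ofHom
        (((f.pullTot k).comp (V.totF k).subtype).codRestrict (U.totF k)
          fun x => hf.map_F k x.1 x.2)
      comm' := fun i j hij => by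
        ext x
        refine Subtype.ext ?_
        refine (hU.d_apply hij _).trans ?_
        refine (hf.map_D hij x.1 x.2).symm.trans ?_
        exact congrArg (f.pullTot j) (hV.d_apply hij x).symm }
  map_E k x hx := AddSubgroup.mem_addSubgroupOf.2
    (hf.map_E k _ (AddSubgroup.mem_addSubgroupOf.1 hx))
  map_I k x hx := AddSubgroup.mem_addSubgroupOf.2
    (hf.map_I k _ (AddSubgroup.mem_addSubgroupOf.1 hx))

/-- The string `f I₀ … f I_j g I_j … g I_p`. -/
def prismString (f g : CompatSystem U V) {p : ℕ} (s : Fin (p + 1) → U.Idx) (j : Fin (p + 1)) :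
    Fin (p + 2) → V.Idx := fun k =>
  if k ≤ j.castSucc then f.functor.obj (s (j.predAbove k)) else g.functor.obj (s (j.predAbove k))

theorem prism_subset {f g : CompatSystem U V} (a : CompatNatTrans f g) {p : ℕ}
    (s : Fin (p + 1) → U.Idx) (j : Fin (p + 1)) :
    V.image (f.functor.obj (GPreOrb.union s)) ⊆ V.image (GPreOrb.union (prismString f g s j)) := by
  have h1 : V.image (GPreOrb.union (prismString f g s j)) = _ := V.image_union _ _
  have h2 : V.image (GPreOrb.union fun k => f.functor.obj (s k)) = _ := V.image_union _ _
  rw [f.map_union, h1, h2]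
  refine Set.subset_iInter fun k => (Set.iInter_subset _ (j.predAbove k)).trans ?_
  unfold prismString
  split_ifs
  · exact subset_rfl
  · exact Embedding.image_subset (a.trans.app _)

/-- The form `∑_j (-1)^j f_𝐈^* (ω_{f I₀ … f I_j g I_j … g I_p} |_{f 𝐈})`. -/
def prism {f g : CompatSystem U V} (a : CompatNatTrans f g) {p q : ℕ}
    (w : V.RawCochain (p + 1) q) (s : Fin (p + 1) → U.Idx) : Form (U.dom (GPreOrb.union s)) q :=
  ∑ j : Fin (p + 1), (-1 : ℤ) ^ (j : ℕ) •
    Form.pullback (f.lift (GPreOrb.union s)) (f.lift_smooth _) q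
      (GPreOrb.restrict (prism_subset a s j) q (w (prismString f g s j)))

/-- The spark homotopy `Φ` is the one associated to the natural transformation `a`, with respect to
the strict total order `r` on `F(V_U)`: on the strings `𝐈` which are strictly increasing for `r`
one has `(Φ ω)_𝐈 = ∑_j (-1)^j f_𝐈^* (ω_{f I₀ … f I_j g I_j … g I_p} |_{f 𝐈})`.  As the
cochains are alternating, this determines `Φ`. -/
def IsPrism {f g : CompatSystem U V} (a : CompatNatTrans f g) (r : U.Idx → U.Idx → Prop)
    {hU : U.IsTriple} {hV : V.IsTriple} {hf : f.IsSparkHom} {hg : g.IsSparkHom}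
    (Φ : SparkHomotopy (hf.sparkHom hU hV) (hg.sparkHom hU hV)) : Prop :=
  ∀ (i j : ℤ) (hij : i + (-1) = j) (x : hV.tot.X i) (p q : ℕ) (e : (p : ℤ) + q = j)
    (s : Fin (p + 1) → U.Idx), (∀ k l, k < l → r (s k) (s l)) →
      hU.components (Φ.hom.v i j hij x) ⟨p, q, e⟩ s =
        prism a (hV.components x ⟨p + 1, q, by push_cast; lia⟩) s

end CompatSystem


end

end SparkOrb

open SparkOrb

namespace SparkOrb

/-! ### Calculus of differential forms -/

/-! The horizontal direction of the double complex is reduced to the combinatorics of a full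
simplex. A string of indices is a product of vertices in the exterior algebra `Chains` on the free
abelian group on `F(V)`, and the boundary `bd` is contraction with the augmentation. An alternating
cochain `ω`, a compatible system `f` and an index `I` give a linear map `f.ev I ω` from chains to
forms on `Ũ_I`. On the chains carried by `f` at `I`, spanned by strings of indices `K` with `V_{fI}
⊆ V_K`, `δ` is dual to `bd` (`ev_delta`). An operator on chains that respects carriers thus acts on
cochains, and identities between chain operators become identities between cochain operators. The
analytic input is `IsInvariant.pullback_eq`: two smooth maps into a chart with the same projection
to the base differ, near each point of a dense open set, by a group element, so they pull an
invariant form back to the same form. Restrictions are therefore independent of the embedding, and a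
2-cell `f¹ ⇒ f²` enters the computations only through the equality of base maps and the inclusions
`V_{f¹I} ⊆ V_{f²I}`. A chain homotopy from `f¹` to `f²` that is carried by `f¹` induces a spark
homotopy; the prism operator of an ordering is one. Two such homotopies differ by the boundary of a
cone with apex `f¹(∪𝐈)` (acyclic carriers, `cls_eq_of_isChainHomotopy`), so the class does not
depend on the order. The same uniqueness proves all axioms for 2-cells: it suffices to exhibit some
chain homotopy, namely zero, a sum, or a composite with an induced map. For the spark complex
property, `E` is the kernel of `δ` in column zero, and the rows are exact in positive degrees, so a
staircase argument makes `E → F` a quasi-isomorphism. Exactness comes from the contraction `(Kω)_𝐈 =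
∑ₐ ρₐ ω_{a𝐈}` with a smooth partition of unity. The functions `ρₐ` come from bump functions summed
over the finite chart groups; the forms `ω_{a𝐈}` are moved to `Ũ_𝐈` by local lifts supplied by the
inverse function theorem. Finally, spark homotopic homomorphisms agree on characters
(`SparkHomotopy.charMap_eq`), so `Char ∘ S` has identity 2-cells and is the required `Ĥ`. -/

theorem zeroExt_of_mem {n : ℕ} {s : Set (E n)} {B : Type*} [Zero B] (f : s → B) {x : E n}
    (hx : x ∈ s) : zeroExt f x = f ⟨x, hx⟩ :=
  zeroExt_apply f ⟨x, hx⟩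

theorem Form.ext {n q : ℕ} {s : Op n} {a b : Form s q} (h : ∀ x, a.1 x = b.1 x) : a = b :=
  Subtype.ext (funext h)

theorem Form.pullback_apply {m n : ℕ} {s : Op m} {t : Op n} (f : s → t) (hf : IsSmooth f) (q : ℕ)
    (w : Form t q) (x : s) :
    (Form.pullback f hf q w).1 x = (w.1 (f x)).compContinuousLinearMap (mapDeriv f x) := rfl

theorem Form.pullback_id {n q : ℕ} {s : Op n} (w : Form s q) :
    Form.pullback (id : s → s) IsSmooth.id q w = w := by
  refine Form.ext fun x => ?_
  rw [Form.pullback_apply, mapDeriv_id]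
  ext v
  rfl

theorem Form.pullback_comp {l m n q : ℕ} {r : Op l} {s : Op m} {t : Op n} {g : s → t} {f : r → s}
    (hg : IsSmooth g) (hf : IsSmooth f) (w : Form t q) :
    Form.pullback f hf q (Form.pullback g hg q w) =
      Form.pullback (g ∘ f) (hg.comp hf) q w := by
  refine Form.ext fun x => ?_
  rw [Form.pullback_apply, Form.pullback_apply, Form.pullback_apply, mapDeriv_comp hg hf]
  ext v
  rfl

theorem IsSmooth.continuous {m n : ℕ} {s : Op m} {t : Op n} {f : s → t} (hf : IsSmooth f) :
    Continuous f := by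
  have h : Continuous fun x : s => (f x : E n) := by
    have h1 := continuousOn_iff_continuous_domRestrict.1 hf.continuousOn
    refine h1.congr fun x => ?_
    exact zeroExt_apply (s := (s : Set (E m))) (fun y => (f y : E n)) x
  exact continuous_induced_rng.2 h

theorem Form.continuous {n q : ℕ} {s : Op n} (w : Form s q) : Continuous w.1 := by
  have h1 := continuousOn_iff_continuous_domRestrict.1 w.2.continuousOn
  exact h1.congr fun x => zeroExt_apply (s := (s : Set (E n))) w.1 x

theorem mapDeriv_congr {m n : ℕ} {s : Op m} {t : Op n} {f g : s → t} {x : s}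
    (h : f =ᶠ[𝓝 x] g) : mapDeriv f x = mapDeriv g x := by
  refine Filter.EventuallyEq.fderiv_eq ?_
  have h1 : ∀ᶠ y in 𝓝 (x : E m), ∀ hy : y ∈ (s : Set (E m)), f ⟨y, hy⟩ = g ⟨y, hy⟩ := by
    have h2 := (s.isOpen.isOpenEmbedding_subtypeVal.map_nhds_eq x).symm
    rw [h2, Filter.eventually_map]
    filter_upwards [h] with z hz _ using hz
  filter_upwards [s.isOpen.mem_nhds x.2, h1] with y hy h1
  rw [zeroExt_of_mem _ hy, zeroExt_of_mem _ hy, h1 hy]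

theorem Form.d_apply {n q : ℕ} {s : Op n} (w : Form s q) (x : s) :
    (Form.d q w).1 x = extDeriv (zeroExt (s := (s : Set (E n))) w.1) x := rfl

theorem Form.d_pullback {m n q : ℕ} {s : Op m} {t : Op n} {f : s → t} (hf : IsSmooth f)
    (w : Form t q) :
    Form.d q (Form.pullback f hf q w) = Form.pullback f hf (q + 1) (Form.d q w) := by
  refine Form.ext fun x => ?_
  rw [Form.pullback_apply, Form.d_apply, Form.d_apply]
  have hx := zeroExt_apply (s := (s : Set (E m))) (fun y => (f y : E n)) x
  have h1 : DifferentiableAt ℝ (zeroExt (s := (t : Set (E n))) w.1)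
      (zeroExt (s := (s : Set (E m))) (fun y => (f y : E n)) x) := by
    rw [hx]
    exact (w.2.contDiffAt (t.isOpen.mem_nhds (f x).2)).differentiableAt (by simp)
  have h := extDeriv_pullback h1 (hf.contDiffAt (s.isOpen.mem_nhds x.2))
    (by rw [minSmoothness_of_isRCLikeNormedField]; exact WithTop.coe_le_coe.2 (le_top : (2 : ℕ∞) ≤ ⊤))
  rw [hx] at h
  -- The exterior derivative is local, and near `x` the zero extension of the pullback coincides
  -- with the pullback of the zero extensions.
  refine Eq.trans (Filter.EventuallyEq.extDeriv_eq ?_) h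
  filter_upwards [s.isOpen.mem_nhds x.2] with y hy
  rw [zeroExt_of_mem _ hy, zeroExt_of_mem (fun y => (f y : E n)) hy]
  exact congrArg (fun z => ContinuousAlternatingMap.compContinuousLinearMap z _)
    (zeroExt_apply (s := (t : Set (E n))) w.1 (f ⟨y, hy⟩)).symm

theorem Form.d_d {n q : ℕ} {s : Op n} (w : Form s q) : Form.d (q + 1) (Form.d q w) = 0 := by
  refine Form.ext fun x => ?_
  rw [Form.d_apply]
  have h := extDeriv_extDeriv_apply (r := ∞) (x := (x : E n))
    (w.2.contDiffAt (s.isOpen.mem_nhds x.2))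
    (by rw [minSmoothness_of_isRCLikeNormedField]; exact WithTop.coe_le_coe.2 (le_top : (2 : ℕ∞) ≤ ⊤))
  refine Eq.trans (Filter.EventuallyEq.extDeriv_eq ?_) h
  filter_upwards [s.isOpen.mem_nhds x.2] with y hy
  rw [zeroExt_of_mem _ hy]
  rfl

end SparkOrb

namespace SparkOrb

/-! ### Pullbacks of invariant forms along maps with the same projection -/

/-- Injectivity of `Ũ/G ≅ U`: the fibres of the projection are single orbits. -/
theorem Chart.exists_smul_eq {X : Type u} [TopologicalSpace X] {n : ℕ} (c : Chart X n)
    {x y : c.dom} (h : c.proj x = c.proj y) : ∃ g ∈ c.grp, g x = y := by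
  obtain ⟨e, he⟩ := c.homeo
  have h1 : (Quotient.mk (MulAction.orbitRel c.grp c.dom) y) =
      Quotient.mk (MulAction.orbitRel c.grp c.dom) x := by
    refine e.injective (Subtype.ext ?_)
    rw [he, he, h]
  obtain ⟨g, hg⟩ := MulAction.orbitRel_apply.1 (Quotient.exact h1)
  exact ⟨g.1, g.2, hg⟩

namespace GPreOrb

/-- The projection `Ũ_I → X`. -/
def proj (U : GPreOrb.{u, v}) (I : U.Idx) : U.dom I → U.X := (U.chart I).proj

theorem continuous_proj (U : GPreOrb.{u, v}) (I : U.Idx) : Continuous (U.proj I) :=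
  (U.chart I).continuous_proj

theorem proj_mem_image {U : GPreOrb.{u, v}} (I : U.Idx) (x : U.dom I) :
    U.proj I x ∈ U.image I := ⟨x, rfl⟩

theorem proj_emb {U : GPreOrb.{u, v}} {I J : U.Idx} (l : I ⟶ J) (x : U.dom I) :
    U.proj J (emb l x) = U.proj I x := Embedding.proj_comp l x

theorem image_subset_of_hom {U : GPreOrb.{u, v}} {I J : U.Idx} (l : I ⟶ J) :
    U.image I ⊆ U.image J := Embedding.image_subset l

theorem image_union_eq {U : GPreOrb.{u, v}} {p : ℕ} (s : Fin (p + 1) → U.Idx) :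
    U.image (union s) = ⋂ k, U.image (s k) := U.image_union p s

/-- Pullbacks of an invariant form along two smooth maps with the same projection agree. -/
theorem IsInvariant.pullback_eq {U : GPreOrb.{u, v}} {J : U.Idx} {q : ℕ} {w : Form (U.dom J) q}
    (hw : IsInvariant w) {m : ℕ} {s : Op m} {a b : s → U.dom J} (ha : IsSmooth a)
    (hb : IsSmooth b) (h : ∀ x, U.proj J (a x) = U.proj J (b x)) :
    Form.pullback a ha q w = Form.pullback b hb q w := by
  have : Finite (U.chart J).grp := (U.chart J).finite_grp
  -- Pointwise, `b x` is a translate of `a x` by some group element, which may jump with `x`. The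
  -- sets where a fixed element works are closed, and there are finitely many of them.
  let C : (U.chart J).grp → Set s := fun g => {x | g.1 (a x) = b x}
  have hC : ∀ g, IsClosed (C g) := fun g =>
    isClosed_eq (((U.chart J).smooth_grp g.1 g.2).continuous.comp ha.continuous) hb.continuous
  have hU : ⋃ g, C g = Set.univ := by
    refine Set.eq_univ_of_forall fun x => ?_
    obtain ⟨g, hg, hgx⟩ := (U.chart J).exists_smul_eq (h x)
    exact Set.mem_iUnion.2 ⟨⟨g, hg⟩, hgx⟩
  have : LocallyCompactSpace s := s.isOpen.isOpenEmbedding_subtypeVal.locallyCompactSpace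
  -- By Baire's theorem the interiors have dense union. In an interior `g ∘ a = b` near the point,
  -- so the derivatives agree as well and invariance under `g` gives equality there; continuity of
  -- forms does the rest.
  have hd := dense_iUnion_interior_of_closed hC hU
  refine Subtype.ext (Continuous.ext_on hd (Form.continuous _) (Form.continuous _) ?_)
  rintro x hx
  obtain ⟨g, hg⟩ := Set.mem_iUnion.1 hx
  have hs := (U.chart J).smooth_grp g.1 g.2
  have h1 : (g.1 : (U.chart J).dom → (U.chart J).dom) ∘ a =ᶠ[𝓝 x] b :=
    Filter.mem_of_superset (mem_interior_iff_mem_nhds.1 hg) fun y hy => hy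
  have h2 := hw g.1 g.2
  conv_lhs => rw [← h2]
  refine (congrArg (fun z : Form s q => z.1 x) (Form.pullback_comp hs ha w)).trans ?_
  refine (congrArg (fun D => (w.1 (((g.1 : (U.chart J).dom → (U.chart J).dom) ∘
    a) x)).compContinuousLinearMap D)
    (mapDeriv_congr h1)).trans ?_
  exact congrArg (fun z => (w.1 z).compContinuousLinearMap (mapDeriv b x)) h1.eq_of_nhds

/-- This makes the arbitrary choice of embedding in `restrict` harmless. -/
theorem restrict_eq_pull {U : GPreOrb.{u, v}} {I J : U.Idx} {q : ℕ} {w : Form (U.dom J) q}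
    (hw : IsInvariant w) (h : U.image I ⊆ U.image J) (l : I ⟶ J) :
    restrict h q w = pull l q w :=
  hw.pullback_eq (emb_smooth _) (emb_smooth _) fun x => by rw [proj_emb, proj_emb]

theorem pull_id {U : GPreOrb.{u, v}} {I : U.Idx} {q : ℕ} (w : Form (U.dom I) q) :
    pull (𝟙 I) q w = w := Form.pullback_id w

end GPreOrb

namespace CompatSystem

open GPreOrb

variable {U V W : GPreOrb.{u, v}}

theorem lift_proj' (f : CompatSystem U V) (I : U.Idx) (x : U.dom I) :
    V.proj _ (f.lift I x) = f.base (U.proj I x) := f.lift_proj I x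

open Classical in
/-- The pullback of forms on `Ṽ_K` to `Ũ_I` along `f`, if `V_{f I} ⊆ V_K`; zero otherwise. -/
noncomputable def res (f : CompatSystem U V) (I : U.Idx) (K : V.Idx) (q : ℕ) :
    Form (V.dom K) q →+ Form (U.dom I) q :=
  -- The default zero makes the map total in `K`, so that cochains can be evaluated on arbitrary
  -- strings. The rules below are meaningful only where the inclusion holds.
  if h : V.image (f.functor.obj I) ⊆ V.image K then
    (Form.pullback (f.lift I) (f.lift_smooth I) q).comp (restrict h q) else 0

theorem res_of_not (f : CompatSystem U V) {I : U.Idx} {K : V.Idx} {q : ℕ}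
    (h : ¬ V.image (f.functor.obj I) ⊆ V.image K) : f.res I K q = 0 := dif_neg h

theorem res_apply (f : CompatSystem U V) {I : U.Idx} {K : V.Idx} {q : ℕ}
    (h : V.image (f.functor.obj I) ⊆ V.image K) (w : Form (V.dom K) q) :
    f.res I K q w = Form.pullback (f.lift I) (f.lift_smooth I) q (restrict h q w) := by
  rw [res, dif_pos h]; rfl

/-- An embedding after `f_I` is a smooth lift of the base map, and an invariant form does not
distinguish two such lifts. The formal rules for `res` follow by choosing convenient lifts. -/
theorem res_eq_pullback (f : CompatSystem U V) {I : U.Idx} {K : V.Idx} {q : ℕ}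
    (h : V.image (f.functor.obj I) ⊆ V.image K) {w : Form (V.dom K) q} (hw : IsInvariant w)
    {b : U.dom I → V.dom K} (hb : IsSmooth b) (h' : ∀ x, V.proj K (b x) = f.base (U.proj I x)) :
    f.res I K q w = Form.pullback b hb q w := by
  rw [res_apply f h]
  refine (Form.pullback_comp (emb_smooth _) (f.lift_smooth I) w).trans ?_
  refine hw.pullback_eq _ _ fun x => ?_
  rw [h', Function.comp_apply, proj_emb, lift_proj']

theorem exists_lift (f : CompatSystem U V) {I : U.Idx} {K : V.Idx}
    (h : V.image (f.functor.obj I) ⊆ V.image K) :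
    ∃ b : U.dom I → V.dom K, IsSmooth b ∧ ∀ x, V.proj K (b x) = f.base (U.proj I x) :=
  ⟨_, (emb_smooth (V.exists_embedding _ _ h).some).comp (f.lift_smooth I), fun x =>
    (proj_emb _ _).trans (f.lift_proj' I x)⟩

theorem pullback_res (f : CompatSystem U V) {I J : U.Idx} {K : V.Idx} {q : ℕ}
    (hI : V.image (f.functor.obj I) ⊆ V.image K)
    (hJ : V.image (f.functor.obj J) ⊆ V.image K) {w : Form (V.dom K) q} (hw : IsInvariant w)
    {a : U.dom I → U.dom J} (ha : IsSmooth a) (h : ∀ x, U.proj J (a x) = U.proj I x) :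
    Form.pullback a ha q (f.res J K q w) = f.res I K q w := by
  obtain ⟨b, hb, hb'⟩ := f.exists_lift hJ
  rw [res_eq_pullback f hJ hw hb hb', Form.pullback_comp]
  refine (res_eq_pullback f hI hw (hb.comp ha) fun x => ?_).symm
  rw [Function.comp_apply, hb', h]

theorem isInvariant_res (f : CompatSystem U V) {I : U.Idx} {K : V.Idx} {q : ℕ}
    {w : Form (V.dom K) q} (hw : IsInvariant w) : IsInvariant (f.res I K q w) := by
  intro g hg
  by_cases h : V.image (f.functor.obj I) ⊆ V.image K
  · exact pullback_res f h h hw _ fun x => (U.chart I).invariant g hg x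
  · rw [res_of_not f h]
    exact map_zero _

theorem image_obj_mono (f : CompatSystem U V) {I J : U.Idx} (h : U.image I ⊆ U.image J) :
    V.image (f.functor.obj I) ⊆ V.image (f.functor.obj J) :=
  image_subset_of_hom (f.functor.map (U.exists_embedding I J h).some)

theorem d_res (f : CompatSystem U V) (I : U.Idx) (K : V.Idx) {q : ℕ} (w : Form (V.dom K) q) :
    Form.d q (f.res I K q w) = f.res I K (q + 1) (Form.d q w) := by
  by_cases h : V.image (f.functor.obj I) ⊆ V.image K
  · rw [res_apply f h, res_apply f h, Form.d_pullback]
    exact congrArg _ (Form.d_pullback (emb_smooth _) w)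
  · rw [res_of_not f h, res_of_not f h]
    exact map_zero _

theorem res_pull_eqToHom (f : CompatSystem U V) (I : U.Idx) {K L : V.Idx} (e : K = L) {q : ℕ}
    (w : Form (V.dom L) q) : f.res I K q (pull (eqToHom e) q w) = f.res I L q w := by
  subst e
  exact congrArg _ (pull_id w)

theorem res_res (f : CompatSystem U V) (g : CompatSystem V W) {I : U.Idx} {K : V.Idx} {L : W.Idx}
    {q : ℕ} (hK : V.image (f.functor.obj I) ⊆ V.image K)
    (hL : W.image (g.functor.obj K) ⊆ W.image L) {w : Form (W.dom L) q} (hw : IsInvariant w) :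
    f.res I K q (g.res K L q w) = (f.comp g).res I L q w := by
  obtain ⟨a, ha, ha'⟩ := f.exists_lift hK
  obtain ⟨b, hb, hb'⟩ := g.exists_lift hL
  rw [res_eq_pullback f hK (g.isInvariant_res hw) ha ha', res_eq_pullback g hL hw hb hb',
    Form.pullback_comp]
  refine (res_eq_pullback (f.comp g) ((g.image_obj_mono hK).trans hL) hw _ fun x => ?_).symm
  rw [Function.comp_apply, hb', ha']
  rfl

/-- Since `f` and `g` have the same base map, a lift of one is a lift of the other. The embeddings
that make up `a` matter only through the inclusions they imply. -/
theorem res_eq_of_trans {f g : CompatSystem U V} (a : CompatNatTrans f g) {I : U.Idx} {K : V.Idx}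
    {q : ℕ} (h : V.image (g.functor.obj I) ⊆ V.image K) {w : Form (V.dom K) q}
    (hw : IsInvariant w) : g.res I K q w = f.res I K q w := by
  obtain ⟨b, hb, hb'⟩ := g.exists_lift h
  rw [res_eq_pullback g h hw hb hb']
  refine (res_eq_pullback f ((image_subset_of_hom (a.trans.app I)).trans h) hw hb fun x => ?_).symm
  rw [hb', a.base_eq]

theorem id_res {I J : U.Idx} {q : ℕ} (h : U.image I ⊆ U.image J) (w : Form (U.dom J) q) :
    (CompatSystem.id U).res I J q w = restrict h q w := by
  rw [res_apply _ h]
  exact Form.pullback_id _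

theorem id_res_self {I : U.Idx} {q : ℕ} {w : Form (U.dom I) q} (hw : IsInvariant w) :
    (CompatSystem.id U).res I I q w = w := by
  rw [id_res subset_rfl, restrict_eq_pull hw _ (𝟙 I), pull_id]

theorem res_apply_const (f : CompatSystem U V) {I : U.Idx} {K : V.Idx}
    {w : Form (V.dom K) 0} {m : ℤ} (hw : ∀ x, w.1 x ![] = m) :
    ∃ m : ℤ, ∀ x, (f.res I K 0 w).1 x ![] = m := by
  by_cases h : V.image (f.functor.obj I) ⊆ V.image K
  · refine ⟨m, fun x => ?_⟩
    rw [res_apply f h, Form.pullback_apply]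
    exact Eq.trans (congrArg (w.1 (emb (V.exists_embedding _ _ h).some (f.lift I x)))
      (Subsingleton.elim _ _)) (hw _)
  · exact ⟨0, fun x => by rw [res_of_not f h]; simp⟩

end CompatSystem

end SparkOrb

namespace SparkOrb

/-! ### Alternating chains of a full simplex -/

noncomputable section

/-- The (augmented) alternating chains of the full simplex on a set `A` of vertices. -/
abbrev Chains (A : Type*) : Type _ := ExteriorAlgebra ℤ (A →₀ ℤ)

namespace Chains

variable {A B : Type*} {N : Type*} [AddCommGroup N]

/-- The chain of a vertex. -/
def vert (a : A) : Chains A := ExteriorAlgebra.ι ℤ (Finsupp.single a 1)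

/-- The chain of a string of vertices. -/
def str {n : ℕ} (t : Fin n → A) : Chains A :=
  ExteriorAlgebra.ιMulti ℤ n fun i => Finsupp.single (t i) 1

theorem str_zero (t : Fin 0 → A) : str t = 1 := ExteriorAlgebra.ιMulti_zero_apply _

theorem str_succ {n : ℕ} (t : Fin (n + 1) → A) : str t = vert (t 0) * str (Fin.tail t) :=
  ExteriorAlgebra.ιMulti_succ_apply _

theorem str_cons {n : ℕ} (a : A) (t : Fin n → A) : str (Fin.cons a t : Fin (n + 1) → A) =
    vert a * str t := by
  rw [str_succ, Fin.cons_zero, Fin.tail_cons]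

/-- A function of strings which changes sign under transpositions and vanishes on the strings with
repetitions. -/
structure IsAlt {n : ℕ} (F : (Fin n → A) → N) : Prop where
  swap : ∀ t j k, j ≠ k → F t = -F (t ∘ Equiv.swap j k)
  zero : ∀ t, ¬ Function.Injective t → F t = 0

theorem IsAlt.perm {n : ℕ} {F : (Fin n → A) → N} (hF : IsAlt F) (σ : Equiv.Perm (Fin n)) :
    ∀ t, F (t ∘ σ) = Equiv.Perm.sign σ • F t := by
  induction σ using Equiv.Perm.swap_induction_on with
  | one => intro t; simp
  | swap_mul σ j k hjk ih =>
    intro t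
    have h : t ∘ (Equiv.swap j k * σ : Equiv.Perm (Fin n)) = (t ∘ Equiv.swap j k) ∘ σ := rfl
    rw [h, ih, hF.swap t j k hjk]
    simp [Equiv.Perm.sign_swap hjk]

theorem isAlt_str {n : ℕ} : IsAlt (str : (Fin n → A) → Chains A) where
  swap t j k h := by
    have h1 := (ExteriorAlgebra.ιMulti ℤ n).map_swap
      (fun i => (Finsupp.single (t i) 1 : A →₀ ℤ)) h
    exact (neg_eq_iff_eq_neg.2 h1).symm
  zero t h := by
    exact ExteriorAlgebra.ιMulti_eq_zero_of_not_inj fun h' => h fun i j hij =>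
      h' (by simp only [hij])

theorem IsAlt.map {n : ℕ} {F : (Fin n → A) → N} (hF : IsAlt F) {M : Type*} [AddCommGroup M]
    (T : N →+ M) : IsAlt fun t => T (F t) where
  swap t j k h := by rw [hF.swap t j k h, map_neg]
  zero t h := by rw [hF.zero t h, map_zero]

section sorted

variable [LinearOrder A]

/-- The basis of increasing strings. -/
def basis (A : Type*) [LinearOrder A] : Module.Basis (Finset A) ℤ (Chains A) :=
  (Finsupp.basisSingleOne (R := ℤ) (ι := A)).ExteriorAlgebra

theorem basis_apply {n : ℕ} (S : Finset A) (h : S.card = n) :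
    basis A S = str (S.orderEmbOfFin h) := by
  rw [basis, ExteriorAlgebra.basis_apply_ofCard _ h]
  simp only [ExteriorAlgebra.ιMulti_family, str]
  congr 1

theorem str_eq_basis {n : ℕ} {t : Fin n → A} (ht : StrictMono t) :
    ∃ (S : Finset A) (h : S.card = n), t = S.orderEmbOfFin h := by
  refine ⟨Finset.univ.map ⟨t, ht.injective⟩, by simp, ?_⟩
  exact Finset.orderEmbOfFin_unique _ (fun x => by simp) ht

/-- The linear map with given values on the increasing strings. -/
def sortedLift (F : ∀ n, (Fin n → A) → N) : Chains A →ₗ[ℤ] N :=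
  (basis A).constr ℤ fun S => F S.card (S.orderEmbOfFin rfl)

theorem sortedLift_str (F : ∀ n, (Fin n → A) → N) {n : ℕ} {t : Fin n → A} (ht : StrictMono t) :
    sortedLift F (str t) = F n t := by
  obtain ⟨S, h, rfl⟩ := str_eq_basis ht
  rw [← basis_apply S h, sortedLift, Module.Basis.constr_basis]
  subst h
  rfl

theorem ext_sorted {T T' : Chains A →ₗ[ℤ] N}
    (h : ∀ n (t : Fin n → A), StrictMono t → T (str t) = T' (str t)) : T = T' := by
  refine (basis A).ext fun S => ?_
  rw [basis_apply S rfl]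
  exact h _ _ (S.orderEmbOfFin rfl).strictMono

theorem exists_sort {n : ℕ} {t : Fin n → A} (ht : Function.Injective t) :
    ∃ σ : Equiv.Perm (Fin n), StrictMono (t ∘ σ) :=
  ⟨Tuple.sort t, (Tuple.monotone_sort t).strictMono_of_injective
    (ht.comp (Tuple.sort t).injective)⟩

/-- Sorting `t` multiplies both sides by the same sign, and a repetition kills both, so for
alternating values the auxiliary order drops out. -/
theorem sortedLift_str_of_isAlt {F : ∀ n, (Fin n → A) → N} (hF : ∀ n, IsAlt (F n)) {n : ℕ}
    (t : Fin n → A) : sortedLift F (str t) = F n t := by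
  by_cases ht : Function.Injective t
  · obtain ⟨σ, hσ⟩ := exists_sort ht
    have h1 := sortedLift_str F hσ
    rw [(hF n).perm, isAlt_str.perm] at h1
    rcases Int.units_eq_one_or (Equiv.Perm.sign σ) with h | h <;> simpa [h] using h1
  · rw [isAlt_str.zero t ht, (hF n).zero t ht, map_zero]

end sorted

/-- Strings span: for any linear order the increasing ones already form a basis. -/
theorem ext {T T' : Chains A →ₗ[ℤ] N}
    (h : ∀ n (t : Fin n → A), T (str t) = T' (str t)) : T = T' := by
  classical
  let _ : LinearOrder A := linearOrderOfSTO (WellOrderingRel (α := A))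
  exact ext_sorted fun n t _ => h n t

open Classical in
/-- The linear map with given values on strings, for alternating functions. -/
def altLift (F : ∀ n, (Fin n → A) → N) : Chains A →ₗ[ℤ] N :=
  letI : LinearOrder A := linearOrderOfSTO (WellOrderingRel (α := A))
  sortedLift F

theorem altLift_str {F : ∀ n, (Fin n → A) → N} (hF : ∀ n, IsAlt (F n)) {n : ℕ}
    (t : Fin n → A) : altLift F (str t) = F n t := by
  classical
  let _ : LinearOrder A := linearOrderOfSTO (WellOrderingRel (α := A))
  exact sortedLift_str_of_isAlt hF t

/-- Modulo `S` the map vanishes on strings, hence everywhere. -/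
theorem map_mem {T : Chains A →ₗ[ℤ] N} {S : AddSubgroup N}
    (h : ∀ n (t : Fin n → A), T (str t) ∈ S) (x : Chains A) : T x ∈ S := by
  have h1 : (QuotientAddGroup.mk' S).toIntLinearMap.comp T = 0 :=
    ext fun n t => (QuotientAddGroup.eq_zero_iff _).2 (h n t)
  exact (QuotientAddGroup.eq_zero_iff _).1 (LinearMap.congr_fun h1 x)

/-- The boundary of the augmented chain complex. -/
def bd : Chains A →ₗ[ℤ] Chains A :=
  -- The functional takes the value `1` on every vertex. Contraction with it is an antiderivation of
  -- square zero that sends each vertex to the empty string `1`, so the complex is augmented.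
  CliffordAlgebra.contractLeft (Finsupp.linearCombination ℤ fun _ : A => (1 : ℤ))

theorem bd_one : bd (1 : Chains A) = 0 := CliffordAlgebra.contractLeft_one _ _

theorem bd_bd (x : Chains A) : bd (bd x) = 0 := CliffordAlgebra.contractLeft_contractLeft _ _

/-- Left multiplication by a vertex is a contracting homotopy. Both the prism formula and the cone
construction rest on this rule. -/
theorem bd_vert_mul (a : A) (x : Chains A) : bd (vert a * x) = x - vert a * bd x := by
  refine (CliffordAlgebra.contractLeft_ι_mul _ _ _).trans ?_
  simp [bd, vert, ExteriorAlgebra.ι]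

theorem bd_vert (a : A) : bd (vert a) = 1 := by
  rw [← mul_one (vert a), bd_vert_mul, bd_one, mul_zero, sub_zero]

theorem bd_str {n : ℕ} (t : Fin (n + 1) → A) :
    bd (str t) = ∑ k : Fin (n + 1), (-1 : ℤ) ^ (k : ℕ) • str (t ∘ k.succAbove) := by
  induction n with
  | zero =>
    rw [str_succ, bd_vert_mul]
    simp [str_zero, bd_one]
  | succ n ih =>
    rw [str_succ, bd_vert_mul, ih, sub_eq_add_neg]
    refine Eq.trans ?_ (Fin.sum_univ_succ _).symm
    congr 1
    · simp only [Fin.val_zero, pow_zero, one_smul]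
      rfl
    · rw [Finset.mul_sum, ← Finset.sum_neg_distrib]
      refine Finset.sum_congr rfl fun k _ => ?_
      rw [str_succ (t ∘ k.succ.succAbove), Fin.val_succ, pow_succ, mul_neg_one, neg_smul,
        mul_smul_comm]
      have h1 : (t ∘ k.succ.succAbove) 0 = t 0 := by simp
      have h2 : Fin.tail (t ∘ k.succ.succAbove) = Fin.tail t ∘ k.succAbove := by
        funext i
        simp [Fin.tail]
      rw [h1, h2]

/-- The map on chains induced by a map on vertices. -/
def map (f : A → B) : Chains A →ₗ[ℤ] Chains B :=
  (ExteriorAlgebra.map (Finsupp.lmapDomain ℤ ℤ f)).toLinearMap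

theorem map_str (f : A → B) {n : ℕ} (t : Fin n → A) : map f (str t) = str (f ∘ t) := by
  refine (ExteriorAlgebra.map_apply_ιMulti _ _).trans ?_
  simp only [str]
  congr 1
  funext i
  simp

theorem map_bd (f : A → B) (x : Chains A) : map f (bd x) = bd (map f x) := by
  refine LinearMap.congr_fun (f := (map f).comp bd) (g := bd.comp (map f)) (ext fun n t => ?_) x
  rw [LinearMap.comp_apply, LinearMap.comp_apply, map_str]
  cases n with
  | zero => rw [str_zero, str_zero, bd_one, bd_one, map_zero]
  | succ n =>
    rw [bd_str, bd_str, map_sum]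
    refine Finset.sum_congr rfl fun k _ => ?_
    rw [map_zsmul, map_str]
    rfl

/-! ### The prism operator -/

/-- The chain `∑_j (-1)^j f t₀ … f t_j g t_j … g t_p`. -/
def prism (f g : A → B) : ∀ n, (Fin n → A) → Chains B
  | 0, _ => 0
  | n + 1, t => vert (f (t 0)) * (vert (g (t 0)) * str (g ∘ Fin.tail t)) -
      vert (f (t 0)) * prism f g n (Fin.tail t)

/-- Induction by the product rule. The face omitting `t 0` is the prism on the tail and cancels one
term of the boundary; the other faces keep the factor `f (t 0)`. Their pure `g` part cancels the
boundary of the `g` tail, and what remains is `f (t 0)` times the inductive hypothesis. -/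
theorem bd_prism (f g : A → B) {n : ℕ} (t : Fin (n + 1) → A) :
    bd (prism f g (n + 1) t) +
      ∑ k : Fin (n + 1), (-1 : ℤ) ^ (k : ℕ) • prism f g n (t ∘ k.succAbove) =
      str (g ∘ t) - str (f ∘ t) := by
  induction n with
  | zero =>
    simp [prism, bd_vert_mul, bd_vert, str_succ, str_zero]
  | succ n ih =>
    rw [prism, map_sub, bd_vert_mul, bd_vert_mul, bd_vert_mul, Fin.sum_univ_succ]
    have h0 : t ∘ (0 : Fin (n + 2)).succAbove = Fin.tail t := rfl
    have h1 (k : Fin (n + 1)) : (t ∘ k.succ.succAbove) 0 = t 0 := by simp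
    have h2 (k : Fin (n + 1)) : Fin.tail (t ∘ k.succ.succAbove) = Fin.tail t ∘ k.succAbove := by
      funext i
      simp [Fin.tail]
    have h3 : ∑ k : Fin (n + 1), (-1 : ℤ) ^ (k.succ : ℕ) • prism f g (n + 1)
        (t ∘ k.succ.succAbove) =
        -(vert (f (t 0)) * (vert (g (t 0)) * bd (str (g ∘ Fin.tail t)))) +
        vert (f (t 0)) * ∑ k : Fin (n + 1), (-1 : ℤ) ^ (k : ℕ) •
          prism f g n (Fin.tail t ∘ k.succAbove) := by
      rw [bd_str, Finset.mul_sum, Finset.mul_sum, Finset.mul_sum, ← Finset.sum_neg_distrib,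
        ← Finset.sum_add_distrib]
      refine Finset.sum_congr rfl fun k _ => ?_
      rw [prism, h1, h2, Fin.val_succ, pow_succ, mul_neg_one, neg_smul, smul_sub, neg_sub,
        mul_smul_comm, mul_smul_comm, mul_smul_comm, sub_eq_neg_add]
      rfl
    have h4 := ih (Fin.tail t)
    have h5 : str (g ∘ t) = vert (g (t 0)) * str (g ∘ Fin.tail t) := str_succ _
    have h6 : str (f ∘ t) = vert (f (t 0)) * str (f ∘ Fin.tail t) := str_succ _
    rw [h3, h0, Fin.val_zero, pow_zero, one_smul, h5, h6, eq_sub_of_add_eq' h4]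
    noncomm_ring

section sorted

variable [LinearOrder A]

/-- The prism operator defined by means of the increasing strings. -/
def prismOp (f g : A → B) : Chains A →ₗ[ℤ] Chains B := sortedLift (prism f g)

theorem prismOp_str (f g : A → B) {n : ℕ} {t : Fin n → A} (ht : StrictMono t) :
    prismOp f g (str t) = prism f g n t := sortedLift_str _ ht

theorem prismOp_one (f g : A → B) : prismOp f g (1 : Chains A) = 0 := by
  rw [← str_zero (Fin.elim0 : Fin 0 → A), prismOp_str f g fun i => i.elim0]
  rfl

/-- The prism does not alternate in its string, so it becomes an operator only through an order. The
formula extends from increasing strings because their faces are increasing. -/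
theorem bd_prismOp (f g : A → B) (x : Chains A) :
    bd (prismOp f g x) + prismOp f g (bd x) = map g x - map f x := by
  refine LinearMap.congr_fun (f := bd.comp (prismOp f g) + (prismOp f g).comp bd)
    (g := map g - map f) (ext_sorted fun n t ht => ?_) x
  simp only [LinearMap.add_apply, LinearMap.comp_apply, LinearMap.sub_apply, map_str]
  cases n with
  | zero => simp [str_zero, prismOp_one, bd_one]
  | succ n =>
    rw [prismOp_str f g ht, bd_str, ← bd_prism, map_sum]
    refine congrArg _ (Finset.sum_congr rfl fun k _ => ?_)
    rw [map_zsmul, prismOp_str f g (ht.comp (Fin.strictMono_succAbove k))]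

end sorted

/-! ### Contraction of carried chain maps -/

/-- The approximations of the contraction by cones with vertices `v t`. -/
def coneApprox (D : Chains A →ₗ[ℤ] Chains B) (v : ∀ p, (Fin (p + 1) → A) → B) :
    ℕ → (Chains A →ₗ[ℤ] Chains B)
  | 0 => 0
  | n + 1 => altLift fun
    | 0, _ => 0
    | p + 1, t => vert (v p t) * (D (str t) + coneApprox D v n (bd (str t)))

section cone

variable {D : Chains A →ₗ[ℤ] Chains B} {v : ∀ p, (Fin (p + 1) → A) → B}

/-- The recursion `s ↦ v(s) · (D s + cone (∂s))` lowers the length of strings, but a linear map on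
chains has to be given for all lengths at once, hence the stages: stage `n` is final on strings of
length at most `n`. Each stage alternates because the apex `v` is symmetric in the string while
`str` alternates. -/
theorem coneApprox_succ_zero (hv : ∀ p t j k, v p (t ∘ Equiv.swap j k) = v p t) (n : ℕ) :
    coneApprox D v (n + 1) 1 = 0 ∧ ∀ p (t : Fin (p + 1) → A), coneApprox D v (n + 1) (str t) =
      vert (v p t) * (D (str t) + coneApprox D v n (bd (str t))) := by
  have h : ∀ m, IsAlt ((fun
    | 0, _ => 0
    | p + 1, t => vert (v p t) * (D (str t) + coneApprox D v n (bd (str t))) :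
      ∀ m, (Fin m → A) → Chains B) m) := by
    intro m
    cases m with
    | zero => exact ⟨fun t j => j.elim0, fun _ _ => rfl⟩
    | succ p =>
      refine ⟨fun t j k hjk => ?_, fun t ht => ?_⟩
      · simp only [hv]
        rw [isAlt_str.swap t j k hjk]
        simp only [map_neg]
        noncomm_ring
      · simp only [isAlt_str.zero t ht, map_zero, add_zero, mul_zero]
  refine ⟨?_, fun p t => altLift_str h t⟩
  rw [← str_zero (Fin.elim0 : Fin 0 → A)]
  exact altLift_str h _

/-- The contraction by cones with vertices `v t`. -/
def cone (D : Chains A →ₗ[ℤ] Chains B) (v : ∀ p, (Fin (p + 1) → A) → B) :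
    Chains A →ₗ[ℤ] Chains B := altLift fun m t => coneApprox D v m (str t)

theorem cone_str {m : ℕ} (t : Fin m → A) : cone D v (str t) = coneApprox D v m (str t) :=
  altLift_str (fun m => isAlt_str.map (coneApprox D v m).toAddMonoidHom) t

theorem cone_one : cone D v 1 = 0 := by
  rw [← str_zero (Fin.elim0 : Fin 0 → A), cone_str]
  rfl

theorem cone_str_succ (hv : ∀ p t j k, v p (t ∘ Equiv.swap j k) = v p t) {p : ℕ}
    (t : Fin (p + 1) → A) :
    cone D v (str t) = vert (v p t) * (D (str t) + cone D v (bd (str t))) := by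
  rw [cone_str, (coneApprox_succ_zero hv p).2, bd_str, map_sum, map_sum]
  congr 2
  refine Finset.sum_congr rfl fun k _ => ?_
  rw [map_zsmul, map_zsmul, cone_str]

/-- By the product rule, the boundary of `v · (D s + cone ∂s)` is the bracket minus `v` times its
boundary. The latter is `∂D s + ∂ cone ∂s`, which by induction equals `∂D s + D ∂s = 0`. -/
theorem bd_cone (hv : ∀ p t j k, v p (t ∘ Equiv.swap j k) = v p t) (h1 : D 1 = 0)
    (hD : ∀ x, bd (D x) + D (bd x) = 0) (x : Chains A) :
    bd (cone D v x) - cone D v (bd x) = D x := by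
  refine LinearMap.congr_fun (f := bd.comp (cone D v) - (cone D v).comp bd) (ext fun n => ?_) x
  simp only [LinearMap.sub_apply, LinearMap.comp_apply]
  induction n with
  | zero =>
    intro t
    rw [str_zero, bd_one, cone_one, h1, map_zero, map_zero, sub_zero]
  | succ n ih =>
    intro t
    have h2 : bd (cone D v (bd (str t))) - cone D v (bd (bd (str t))) = D (bd (str t)) := by
      rw [bd_str]
      simp only [map_sum, map_zsmul, ← Finset.sum_sub_distrib, ← zsmul_sub, ih]
    rw [bd_bd, map_zero, sub_zero] at h2
    have h3 := hD (str t)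
    rw [cone_str_succ hv, bd_vert_mul, map_add, h2, h3, mul_zero, sub_zero, add_sub_cancel_right]

/-- The acyclic carrier argument: the carrier of a face lies in that of the string, and coning with
the apex of the string stays in its carrier. -/
theorem cone_mem (hv : ∀ p t j k, v p (t ∘ Equiv.swap j k) = v p t)
    {C : ∀ p, (Fin (p + 1) → A) → Submodule ℤ (Chains B)}
    (hC : ∀ p t (k : Fin (p + 2)), C p (t ∘ k.succAbove) ≤ C (p + 1) t)
    (hCv : ∀ p t, ∀ x ∈ C p t, vert (v p t) * x ∈ C p t)
    (hCD : ∀ p t, D (str t) ∈ C p t) (p : ℕ) :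
    ∀ t, cone D v (str t) ∈ C p t := by
  induction p with
  | zero =>
    intro t
    rw [cone_str_succ hv]
    refine hCv _ _ _ (add_mem (hCD _ _) ?_)
    rw [bd_str]
    simp [str_zero, cone_one]
  | succ p ih =>
    intro t
    rw [cone_str_succ hv]
    refine hCv _ _ _ (add_mem (hCD _ _) ?_)
    rw [bd_str, map_sum]
    refine sum_mem fun k _ => ?_
    rw [map_zsmul]
    exact zsmul_mem (hC p t k (ih _)) _

end cone

end Chains

end

end SparkOrb

namespace SparkOrb

/-! ### Evaluation of cochains on chains -/

noncomputable section

open GPreOrb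

/-- The group of invariant forms on `Ũ_I`. -/
def invForms {U : GPreOrb.{u, v}} (I : U.Idx) (q : ℕ) : AddSubgroup (Form (U.dom I) q) where
  carrier := {w | IsInvariant w}
  zero_mem' _ _ := map_zero _
  add_mem' ha hb g hg := (map_add _ _ _).trans (congrArg₂ (· + ·) (ha g hg) (hb g hg))
  neg_mem' ha g hg := (map_neg _ _).trans (congrArg (- ·) (ha g hg))

/-- The group of the `0`-forms which are integer constants. -/
def intForms {n : ℕ} (s : Op n) : AddSubgroup (Form s 0) where
  carrier := {w | ∃ m : ℤ, ∀ x, w.1 x ![] = m}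
  zero_mem' := ⟨0, fun x => by simp⟩
  add_mem' := by
    rintro a b ⟨m, hm⟩ ⟨n, hn⟩
    refine ⟨m + n, fun x => ?_⟩
    push_cast
    rw [← hm x, ← hn x]
    rfl
  neg_mem' := by
    rintro a ⟨m, hm⟩
    refine ⟨-m, fun x => ?_⟩
    push_cast
    rw [← hm x]
    rfl

theorem Form.d_eq_zero_of_mem_intForms {n : ℕ} {s : Op n} {w : Form s 0} (hw : w ∈ intForms s) :
    Form.d 0 w = 0 := by
  obtain ⟨m, hm⟩ := hw
  refine Form.ext fun x => ?_
  rw [Form.d_apply]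
  have h : zeroExt (s := (s : Set (E n))) w.1 =ᶠ[𝓝 (x : E n)] fun _ => w.1 x := by
    filter_upwards [s.isOpen.mem_nhds x.2] with y hy
    rw [zeroExt_of_mem _ hy]
    ext a
    rw [Subsingleton.elim a ![], hm, hm]
  rw [h.extDeriv_eq, extDeriv, fderiv_const_apply]
  exact map_zero (ContinuousAlternatingMap.alternatizeUncurryFinCLM ℝ (E n) ℝ (n := 0))

theorem GPreOrb.pull_eqToHom_of_eq {U : GPreOrb.{u, v}} {p q : ℕ} (w : U.RawCochain p q)
    {s t : Fin (p + 1) → U.Idx} (h : t = s) (e : union s = union t) :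
    pull (eqToHom e) q (w t) = w s := by
  subst h
  exact pull_id _

/-- Exchanging two equal entries changes the sign of the value but not the string, and forms have no
2-torsion. -/
theorem GPreOrb.eq_zero_of_mem_cochains {U : GPreOrb.{u, v}} {p q : ℕ} {w : U.RawCochain p q}
    (hw : w ∈ U.cochains p q) {s : Fin (p + 1) → U.Idx} (hs : ¬ Function.Injective s) :
    w s = 0 := by
  obtain ⟨j, k, hjk, hne⟩ : ∃ j k, s j = s k ∧ j ≠ k := by
    simpa [Function.Injective] using hs
  have h1 : s ∘ Equiv.swap j k = s := by
    funext i
    simp only [Function.comp_apply]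
    by_cases hi : i = j
    · rw [hi, Equiv.swap_apply_left, hjk]
    · by_cases hi' : i = k
      · rw [hi', Equiv.swap_apply_right, hjk]
      · rw [Equiv.swap_apply_of_ne_of_ne hi hi']
  have h2 := hw.2 s j k hne
  rw [pull_eqToHom_of_eq w h1] at h2
  refine Form.ext fun x => ContinuousAlternatingMap.ext fun a => ?_
  exact self_eq_neg.1 (congrArg (fun z : Form (U.dom (union s)) q => z.1 x a) h2)

theorem GPreOrb.subset_image_union {U : GPreOrb.{u, v}} {p : ℕ} {s : Fin (p + 1) → U.Idx}
    {S : Set U.X} : S ⊆ U.image (union s) ↔ ∀ k, S ⊆ U.image (s k) := by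
  rw [image_union_eq, Set.subset_iInter_iff]

namespace CompatSystem

variable {U V W : GPreOrb.{u, v}}

open Classical in
/-- The values of the evaluation on strings. -/
def evString (f : CompatSystem U V) (I : U.Idx) {p q : ℕ} (w : V.RawCochain p q) :
    ∀ n, (Fin n → V.Idx) → Form (U.dom I) q
  -- The empty string has degree `-1` in the augmented complex; all cochains vanish on it.
  | 0, _ => 0
  | n + 1, t => if h : p = n then f.res I (union t) q ((h ▸ w : V.RawCochain n q) t) else 0

/-- The evaluation of a cochain of `V` on chains, with values in the forms on `Ũ_I`. -/
def ev (f : CompatSystem U V) (I : U.Idx) {p q : ℕ} (w : V.RawCochain p q) :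
    Chains V.Idx →ₗ[ℤ] Form (U.dom I) q := Chains.altLift (f.evString I w)

theorem evString_isAlt (f : CompatSystem U V) (I : U.Idx) {p q : ℕ} {w : V.RawCochain p q}
    (hw : w ∈ V.cochains p q) (n : ℕ) : Chains.IsAlt (f.evString I w n) := by
  cases n with
  | zero => exact ⟨fun t j => j.elim0, fun _ _ => rfl⟩
  | succ n =>
    by_cases h : p = n
    · subst h
      refine ⟨fun t j k hjk => ?_, fun t ht => ?_⟩
      · simp only [evString, dif_pos]
        rw [hw.2 t j k hjk, map_neg, res_pull_eqToHom]
      · simp only [evString, dif_pos]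
        rw [eq_zero_of_mem_cochains hw ht, map_zero]
    · refine ⟨fun t j k hjk => ?_, fun t ht => ?_⟩ <;> simp [evString, h]

section

variable (f : CompatSystem U V) {I : U.Idx} {p q : ℕ} {w : V.RawCochain p q}
  (hw : w ∈ V.cochains p q)
include hw

theorem ev_str (t : Fin (p + 1) → V.Idx) :
    f.ev I w (Chains.str t) = f.res I (union t) q (w t) := by
  rw [ev, Chains.altLift_str (f.evString_isAlt I hw)]
  simp [evString]

theorem ev_str_of_ne {n : ℕ} (h : n ≠ p) (t : Fin (n + 1) → V.Idx) :
    f.ev I w (Chains.str t) = 0 := by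
  rw [ev, Chains.altLift_str (f.evString_isAlt I hw)]
  simp [evString, h.symm]

theorem ev_one : f.ev I w 1 = 0 := by
  rw [← Chains.str_zero (Fin.elim0 : Fin 0 → V.Idx), ev,
    Chains.altLift_str (f.evString_isAlt I hw)]
  rfl

theorem ev_ext {N : Type*} [AddCommGroup N] {F G : Chains V.Idx →ₗ[ℤ] N}
    (h1 : F 1 = G 1) (h2 : ∀ n, n ≠ p → ∀ t : Fin (n + 1) → V.Idx, F (Chains.str t) =
      G (Chains.str t)) (h3 : ∀ t : Fin (p + 1) → V.Idx, F (Chains.str t) = G (Chains.str t)) :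
    F = G := by
  refine Chains.ext fun n t => ?_
  cases n with
  | zero => rw [Chains.str_zero, h1]
  | succ n =>
    by_cases h : n = p
    · subst h
      exact h3 t
    · exact h2 n h t

theorem ev_mem {S : AddSubgroup (Form (U.dom I) q)}
    (h : ∀ t : Fin (p + 1) → V.Idx, f.res I (union t) q (w t) ∈ S) (x : Chains V.Idx) :
    f.ev I w x ∈ S := by
  refine Chains.map_mem (fun n t => ?_) x
  cases n with
  | zero => rw [Chains.str_zero, ev_one f hw]; exact zero_mem _
  | succ n =>
    by_cases hn : n = p
    · subst hn
      rw [ev_str f hw]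
      exact h t
    · rw [ev_str_of_ne f hw hn]
      exact zero_mem _

theorem isInvariant_ev (x : Chains V.Idx) : IsInvariant (f.ev I w x) :=
  f.ev_mem (S := invForms I q) hw (fun t => f.isInvariant_res (hw.1 t)) x

end

theorem ev_add (f : CompatSystem U V) {I : U.Idx} {p q : ℕ} {w w' : V.RawCochain p q}
    (hw : w ∈ V.cochains p q) (hw' : w' ∈ V.cochains p q) :
    f.ev I (w + w') = f.ev I w + f.ev I w' := by
  have h := add_mem hw hw'
  refine ev_ext hw ?_ ?_ ?_
  · rw [LinearMap.add_apply, ev_one f h, ev_one f hw, ev_one f hw', add_zero]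
  · intro n hn t
    rw [LinearMap.add_apply, ev_str_of_ne f h hn, ev_str_of_ne f hw hn, ev_str_of_ne f hw' hn,
      add_zero]
  · intro t
    rw [LinearMap.add_apply, ev_str f h, ev_str f hw, ev_str f hw', Pi.add_apply, map_add]

theorem pull_eqToHom_ev (f : CompatSystem U V) {I J : U.Idx} (e : I = J) {p q : ℕ}
    (w : V.RawCochain p q) (x : Chains V.Idx) :
    pull (eqToHom e) q (f.ev J w x) = f.ev I w x := by
  subst e
  exact pull_id _

end CompatSystem

/-! ### The differentials `δ` and `d` on alternating invariant cochains -/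

namespace GPreOrb

variable {U : GPreOrb.{u, v}}

theorem extd_mem {p q : ℕ} {w : U.RawCochain p q} (hw : w ∈ U.cochains p q) :
    U.extd p q w ∈ U.cochains p (q + 1) := by
  refine ⟨fun s g hg => ?_, fun s j k hjk => ?_⟩
  · exact (Form.d_pullback ((U.chart _).smooth_grp g hg) (w s)).symm.trans
      (congrArg _ (hw.1 s g hg))
  · refine (congrArg (Form.d q) (hw.2 s j k hjk)).trans ?_
    rw [map_neg]
    exact congrArg (- ·) (Form.d_pullback (emb_smooth _) _)

theorem extd_extd {p q : ℕ} (w : U.RawCochain p q) : U.extd p (q + 1) (U.extd p q w) = 0 :=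
  funext fun s => Form.d_d (w s)

theorem restrict_eq_id_res {I J : U.Idx} (h : U.image I ⊆ U.image J) (q : ℕ)
    (w : Form (U.dom J) q) : restrict h q w = (CompatSystem.id U).res I J q w :=
  (CompatSystem.id_res h w).symm

theorem delta_apply {p q : ℕ} (w : U.RawCochain p q) (s : Fin (p + 2) → U.Idx) :
    U.delta p q w s = ∑ k : Fin (p + 2),
      (-1 : ℤ) ^ (k : ℕ) • restrict (image_face s k) q (w (s ∘ k.succAbove)) := rfl

theorem delta_apply_eq_ev {p q : ℕ} {w : U.RawCochain p q} (hw : w ∈ U.cochains p q)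
    (s : Fin (p + 2) → U.Idx) :
    U.delta p q w s = (CompatSystem.id U).ev (union s) w (Chains.bd (Chains.str s)) := by
  rw [Chains.bd_str, map_sum, delta_apply]
  refine Finset.sum_congr rfl fun k _ => ?_
  rw [map_zsmul, CompatSystem.ev_str _ hw, restrict_eq_id_res]

/-- Written as evaluation on the boundary of the string, `δω` inherits alternation from `str` and
invariance from `ev`. -/
theorem delta_mem {p q : ℕ} {w : U.RawCochain p q} (hw : w ∈ U.cochains p q) :
    U.delta p q w ∈ U.cochains (p + 1) q := by
  refine ⟨fun s => ?_, fun s j k hjk => ?_⟩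
  · rw [delta_apply_eq_ev hw]
    exact CompatSystem.isInvariant_ev _ hw _
  · rw [delta_apply_eq_ev hw, delta_apply_eq_ev hw, CompatSystem.pull_eqToHom_ev,
      Chains.isAlt_str.swap s j k hjk, map_neg, map_neg]

theorem delta_extd {p q : ℕ} (w : U.RawCochain p q) :
    U.delta p (q + 1) (U.extd p q w) = U.extd (p + 1) q (U.delta p q w) := by
  funext s
  change _ = Form.d q (U.delta p q w s)
  rw [delta_apply, delta_apply, map_sum]
  refine Finset.sum_congr rfl fun k _ => ?_
  rw [map_zsmul]
  exact congrArg _ (Form.d_pullback (emb_smooth _) _).symm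

end GPreOrb

/-! ### Carried chains and the duality between `δ` and `bd` -/

namespace CompatSystem

variable {U V W : GPreOrb.{u, v}}

/-- The chains carried by the vertices `K` with `V_{f I} ⊆ V_K`. -/
def carrier (f : CompatSystem U V) (I : U.Idx) : Submodule ℤ (Chains V.Idx) :=
  Submodule.span ℤ {x | ∃ n, ∃ t : Fin n → V.Idx,
    (∀ i, V.image (f.functor.obj I) ⊆ V.image (t i)) ∧ x = Chains.str t}

theorem str_mem_carrier (f : CompatSystem U V) {I : U.Idx} {n : ℕ} {t : Fin n → V.Idx}
    (h : ∀ i, V.image (f.functor.obj I) ⊆ V.image (t i)) : Chains.str t ∈ f.carrier I :=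
  Submodule.subset_span ⟨n, t, h, rfl⟩

theorem vert_mul_mem_carrier (f : CompatSystem U V) {I : U.Idx} {K : V.Idx}
    (h : V.image (f.functor.obj I) ⊆ V.image K) {x : Chains V.Idx} (hx : x ∈ f.carrier I) :
    Chains.vert K * x ∈ f.carrier I := by
  induction hx using Submodule.span_induction with
  | mem x hx =>
    obtain ⟨n, t, ht, rfl⟩ := hx
    rw [← Chains.str_cons]
    exact f.str_mem_carrier (Fin.cases h ht)
  | zero => rw [mul_zero]; exact zero_mem _
  | add x y _ _ hx hy => rw [mul_add]; exact add_mem hx hy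
  | smul a x _ hx => rw [mul_smul_comm]; exact Submodule.smul_mem _ _ hx

theorem carrier_mono (f : CompatSystem U V) {I J : U.Idx} (h : U.image I ⊆ U.image J) :
    f.carrier J ≤ f.carrier I := by
  refine Submodule.span_mono ?_
  rintro x ⟨n, t, ht, rfl⟩
  exact ⟨n, t, fun i => (f.image_obj_mono h).trans (ht i), rfl⟩

theorem carrier_le_of_trans {f g : CompatSystem U V} (a : CompatNatTrans f g) (I : U.Idx) :
    g.carrier I ≤ f.carrier I := by
  refine Submodule.span_mono ?_
  rintro x ⟨n, t, ht, rfl⟩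
  exact ⟨n, t, fun i => (image_subset_of_hom (a.trans.app I)).trans (ht i), rfl⟩

/-- Linear maps on evaluations agree on carried chains if they agree on carried strings of the
right length. -/
theorem eq_on_carrier (f : CompatSystem U V) {I : U.Idx} (p : ℕ) {N : Type*} [AddCommGroup N]
    {F G : Chains V.Idx →ₗ[ℤ] N}
    (h1 : F 1 = G 1) (h2 : ∀ n, n ≠ p → ∀ t : Fin (n + 1) → V.Idx, F (Chains.str t) =
      G (Chains.str t))
    (h3 : ∀ t : Fin (p + 1) → V.Idx, V.image (f.functor.obj I) ⊆ V.image (union t) →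
      F (Chains.str t) = G (Chains.str t)) {x : Chains V.Idx} (hx : x ∈ f.carrier I) :
    F x = G x := by
  induction hx using Submodule.span_induction with
  | mem x hx =>
    obtain ⟨n, t, ht, rfl⟩ := hx
    cases n with
    | zero => rw [Chains.str_zero, h1]
    | succ n =>
      by_cases h : n = p
      · subst h
        exact h3 t (subset_image_union.2 ht)
      · exact h2 n h t
  | zero => rw [map_zero, map_zero]
  | add x y _ _ hx hy => rw [map_add, map_add, hx, hy]
  | smul a x _ hx => rw [map_smul, map_smul, hx]

/-- On a carried string all restrictions are genuine and compose, so the faces match one by one.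
Carriedness matters: `V_{fI}` may lie in the set of a face without lying in that of the whole
string, and then the default zero of `res` spoils the identity. -/
theorem ev_delta (f : CompatSystem U V) {I : U.Idx} {p q : ℕ} {w : V.RawCochain p q}
    (hw : w ∈ V.cochains p q) {x : Chains V.Idx} (hx : x ∈ f.carrier I) :
    f.ev I (V.delta p q w) x = f.ev I w (Chains.bd x) := by
  have hd := delta_mem hw
  refine f.eq_on_carrier (G := (f.ev I w).comp Chains.bd) (p + 1) ?_ ?_ ?_ hx
  · rw [ev_one f hd, LinearMap.comp_apply, Chains.bd_one, map_zero]
  · intro n hn t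
    rw [ev_str_of_ne f hd hn, LinearMap.comp_apply, Chains.bd_str, map_sum]
    refine (Finset.sum_eq_zero fun k _ => ?_).symm
    rw [map_zsmul]
    cases n with
    | zero => rw [Chains.str_zero, ev_one f hw, smul_zero]
    | succ n => rw [ev_str_of_ne f hw (by omega), smul_zero]
  · intro t ht
    rw [ev_str f hd, LinearMap.comp_apply, Chains.bd_str, map_sum, delta_apply, map_sum]
    refine Finset.sum_congr rfl fun k _ => ?_
    rw [map_zsmul, map_zsmul, ev_str f hw, restrict_eq_id_res,
      res_res f (CompatSystem.id V) ht (image_face t k) (hw.1 _)]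
    rfl

theorem d_ev (f : CompatSystem U V) {I : U.Idx} {p q : ℕ} {w : V.RawCochain p q}
    (hw : w ∈ V.cochains p q) (x : Chains V.Idx) :
    Form.d q (f.ev I w x) = f.ev I (V.extd p q w) x := by
  have hd := extd_mem hw
  refine LinearMap.congr_fun (f := (Form.d q).toIntLinearMap.comp (f.ev I w))
    (ev_ext hw ?_ ?_ ?_) x
  · rw [LinearMap.comp_apply, ev_one f hw, ev_one f hd, map_zero]
  · intro n hn t
    rw [LinearMap.comp_apply, ev_str_of_ne f hw hn, ev_str_of_ne f hd hn, map_zero]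
  · intro t
    rw [LinearMap.comp_apply, ev_str f hw, ev_str f hd]
    exact d_res f _ _ _

theorem res_ev (f : CompatSystem U V) (g : CompatSystem V W) {I : U.Idx} {K : V.Idx}
    (h : V.image (f.functor.obj I) ⊆ V.image K) {p q : ℕ} {w : W.RawCochain p q}
    (hw : w ∈ W.cochains p q) {x : Chains W.Idx} (hx : x ∈ g.carrier K) :
    f.res I K q (g.ev K w x) = (f.comp g).ev I w x := by
  refine g.eq_on_carrier (F := (f.res I K q).toIntLinearMap.comp (g.ev K w)) p ?_ ?_ ?_ hx
  · rw [LinearMap.comp_apply, ev_one g hw, ev_one _ hw, map_zero]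
  · intro n hn t
    rw [LinearMap.comp_apply, ev_str_of_ne g hw hn, ev_str_of_ne _ hw hn, map_zero]
  · intro t ht
    rw [LinearMap.comp_apply, ev_str g hw, ev_str _ hw]
    exact res_res f g h ht (hw.1 t)

theorem restrict_ev (g : CompatSystem V W) {I K : V.Idx} (h : V.image I ⊆ V.image K) {p q : ℕ}
    {w : W.RawCochain p q} (hw : w ∈ W.cochains p q) {x : Chains W.Idx} (hx : x ∈ g.carrier K) :
    restrict h q (g.ev K w x) = g.ev I w x := by
  rw [restrict_eq_id_res]
  exact res_ev (CompatSystem.id V) g h hw hx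

/-- This allows operators belonging to `g` to be computed along `f`, so that all terms of a homotopy
formula live over one system. -/
theorem ev_eq_of_trans {f g : CompatSystem U V} (a : CompatNatTrans f g) {I : U.Idx} {p q : ℕ}
    {w : V.RawCochain p q} (hw : w ∈ V.cochains p q) {x : Chains V.Idx} (hx : x ∈ g.carrier I) :
    g.ev I w x = f.ev I w x := by
  refine g.eq_on_carrier p ?_ ?_ ?_ hx
  · rw [ev_one g hw, ev_one f hw]
  · intro n hn t
    rw [ev_str_of_ne g hw hn, ev_str_of_ne f hw hn]
  · intro t ht
    rw [ev_str g hw, ev_str f hw]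
    exact res_eq_of_trans a ht (hw.1 t)

end CompatSystem

end

end SparkOrb

namespace SparkOrb

/-! ### Operators on cochains induced by operators on chains -/

noncomputable section

open GPreOrb

namespace CompatSystem

variable {U V W : GPreOrb.{u, v}}

/-- The operator on cochains induced by a linear map `T` on chains:
`(T^* ω)_𝐈 = f_𝐈^* (ω_{T 𝐈} |_{f 𝐈})`. -/
def chainOp (f : CompatSystem U V) (T : Chains U.Idx →ₗ[ℤ] Chains V.Idx) (p p' : ℕ) {q : ℕ}
    (w : V.RawCochain p' q) : U.RawCochain p q :=
  fun s => f.ev (union s) w (T (Chains.str s))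

/-- The linear map `T` on chains is carried by `f`. -/
def Carries (f : CompatSystem U V) (T : Chains U.Idx →ₗ[ℤ] Chains V.Idx) : Prop :=
  ∀ p (s : Fin (p + 1) → U.Idx), T (Chains.str s) ∈ f.carrier (union s)

section

variable (f : CompatSystem U V) {T : Chains U.Idx →ₗ[ℤ] Chains V.Idx} {p p' q : ℕ}
  {w : V.RawCochain p' q} (hw : w ∈ V.cochains p' q)
include hw

theorem chainOp_mem : f.chainOp T p p' w ∈ U.cochains p q := by
  refine ⟨fun s => f.isInvariant_ev hw _, fun s j k hjk => ?_⟩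
  simp only [chainOp]
  rw [pull_eqToHom_ev, Chains.isAlt_str.swap s j k hjk, map_neg, map_neg]

theorem extd_chainOp : U.extd p q (f.chainOp T p p' w) = f.chainOp T p p' (V.extd p' q w) :=
  funext fun _ => f.d_ev hw _

/-- `T` sends the face of a string to a chain carried at the face, whose evaluation restricts to
evaluation over the whole string. Hence `δ` on the outside becomes `bd` before `T`; on the inside,
in the next lemma, it becomes `bd` after `T`. -/
theorem delta_chainOp (hT : f.Carries T) :
    U.delta p q (f.chainOp T p p' w) = f.chainOp (T.comp Chains.bd) (p + 1) p' w := by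
  funext s
  rw [delta_apply, chainOp, LinearMap.comp_apply, Chains.bd_str, map_sum, map_sum]
  refine Finset.sum_congr rfl fun k _ => ?_
  rw [map_zsmul, map_zsmul, chainOp, restrict_ev f _ hw (hT p _)]

theorem chainOp_delta (hT : f.Carries T) :
    f.chainOp T p (p' + 1) (V.delta p' q w) = f.chainOp (Chains.bd.comp T) p p' w :=
  funext fun _ => f.ev_delta hw (hT p _)

theorem chainOp_add {w' : V.RawCochain p' q} (hw' : w' ∈ V.cochains p' q) :
    f.chainOp T p p' (w + w') = f.chainOp T p p' w + f.chainOp T p p' w' :=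
  funext fun _ => by
    simp only [chainOp, ev_add f hw hw']
    rfl

/-- Since `f` preserves unions, pulling back is evaluation on the image string. Compatibility with
`δ` thereby reduces to `Chains.map_bd`. -/
theorem pullCochain_eq_chainOp :
    f.pullCochain p' q w = f.chainOp (Chains.map f.functor.obj) p' p' w := by
  funext s
  have h := subset_rfl.trans_eq (congrArg V.image (f.map_union p' s))
  simp only [chainOp]
  rw [Chains.map_str, ev_str f hw]
  refine Eq.trans ?_ (res_apply f h _).symm
  exact congrArg (Form.pullback (f.lift (union s)) (f.lift_smooth _) q)
    (restrict_eq_pull (hw.1 _) h (eqToHom (f.map_union p' s))).symm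

theorem pullCochain_apply_eq_res (s : Fin (p' + 1) → U.Idx) :
    f.pullCochain p' q w s =
      f.res (union s) (union (f.functor.obj ∘ s)) q (w (f.functor.obj ∘ s)) := by
  rw [pullCochain_eq_chainOp f hw, chainOp, Chains.map_str, ev_str f hw]

end

theorem chainOp_linear_add (f : CompatSystem U V) (T T' : Chains U.Idx →ₗ[ℤ] Chains V.Idx) (p : ℕ)
    {p' q : ℕ} (w : V.RawCochain p' q) :
    f.chainOp (T + T') p p' w = f.chainOp T p p' w + f.chainOp T' p p' w :=
  funext fun _ => map_add _ _ _

theorem chainOp_linear_sub (f : CompatSystem U V) (T T' : Chains U.Idx →ₗ[ℤ] Chains V.Idx) (p : ℕ)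
    {p' q : ℕ} (w : V.RawCochain p' q) :
    f.chainOp (T - T') p p' w = f.chainOp T p p' w - f.chainOp T' p p' w :=
  funext fun _ => map_sub _ _ _

theorem chainOp_eq_zero (f : CompatSystem U V) {T : Chains U.Idx →ₗ[ℤ] Chains V.Idx} {p : ℕ}
    (p' : ℕ) {q : ℕ} (w : V.RawCochain p' q) (h : ∀ s : Fin (p + 1) → U.Idx, T (Chains.str s) = 0) :
    f.chainOp T p p' w = 0 :=
  funext fun s => by simp only [chainOp, h, map_zero]; rfl

theorem chainOp_zero (f : CompatSystem U V) (T : Chains U.Idx →ₗ[ℤ] Chains V.Idx) (p p' q : ℕ) :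
    f.chainOp T p p' (0 : V.RawCochain p' q) = 0 := by
  have h := f.chainOp_add (T := T) (p := p) (zero_mem (V.cochains p' q))
    (zero_mem (V.cochains p' q))
  rwa [add_zero, left_eq_add] at h

theorem chainOp_neg (f : CompatSystem U V) (T : Chains U.Idx →ₗ[ℤ] Chains V.Idx) (p : ℕ)
    {p' q : ℕ} {w : V.RawCochain p' q} (hw : w ∈ V.cochains p' q) :
    f.chainOp T p p' (-w) = -f.chainOp T p p' w := by
  refine eq_neg_of_add_eq_zero_left ?_
  rw [← chainOp_add f (neg_mem hw) hw, neg_add_cancel, chainOp_zero]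

theorem chainOp_sign (f : CompatSystem U V) (T : Chains U.Idx →ₗ[ℤ] Chains V.Idx) (p : ℕ)
    {p' q : ℕ} {w : V.RawCochain p' q} (hw : w ∈ V.cochains p' q) (n : ℕ) :
    f.chainOp T p p' ((-1 : ℤ) ^ n • w) = (-1 : ℤ) ^ n • f.chainOp T p p' w := by
  rcases neg_one_pow_eq_or ℤ n with h | h
  · simp only [h, one_smul]
  · simp only [h, neg_smul, one_smul, chainOp_neg f T p hw]

theorem mem_intCochains {p : ℕ} {w : U.RawCochain p 0} :
    w ∈ U.intCochains p ↔ w ∈ U.cochains p 0 ∧ ∀ s, w s ∈ intForms (U.dom (union s)) := Iff.rfl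

theorem ev_mem_intForms (f : CompatSystem U V) {I : U.Idx} {p : ℕ} {w : V.RawCochain p 0}
    (hw : w ∈ V.intCochains p) (x : Chains V.Idx) : f.ev I w x ∈ intForms (U.dom I) :=
  f.ev_mem hw.1 (fun t => by
    obtain ⟨m, hm⟩ := hw.2 t
    exact f.res_apply_const hm) x

theorem chainOp_mem_intCochains (f : CompatSystem U V) {T : Chains U.Idx →ₗ[ℤ] Chains V.Idx}
    {p p' : ℕ} {w : V.RawCochain p' 0} (hw : w ∈ V.intCochains p') :
    f.chainOp T p p' w ∈ U.intCochains p :=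
  mem_intCochains.2 ⟨f.chainOp_mem hw.1, fun _ => f.ev_mem_intForms hw _⟩

theorem carries_map (f : CompatSystem U V) : f.Carries (Chains.map f.functor.obj) := by
  intro p s
  rw [Chains.map_str]
  refine f.str_mem_carrier fun i => ?_
  exact f.image_obj_mono (subset_image_union.1 subset_rfl i)

end CompatSystem

/-! ### The triple of a good atlas -/

namespace GPreOrb

variable {U : GPreOrb.{u, v}}

open CompatSystem

theorem delta_eq_chainOp {p q : ℕ} {w : U.RawCochain p q} (hw : w ∈ U.cochains p q) :
    U.delta p q w = (CompatSystem.id U).chainOp Chains.bd (p + 1) p w :=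
  funext fun s => delta_apply_eq_ev hw s

/-- The faces of `s` are carried at `∪s`, so the inner `δ` also turns into a boundary, and `bd_bd`
applies. -/
theorem delta_delta {p q : ℕ} {w : U.RawCochain p q} (hw : w ∈ U.cochains p q) :
    U.delta (p + 1) q (U.delta p q w) = 0 := by
  funext s
  rw [delta_apply_eq_ev (delta_mem hw), Chains.bd_str]
  rw [map_sum]
  have h (k : Fin (p + 3)) : Chains.str (s ∘ k.succAbove) ∈
      (CompatSystem.id U).carrier (union s) :=
    str_mem_carrier _ fun i => subset_image_union.1 (image_face s k) i
  simp only [map_zsmul, ev_delta _ hw (h _)]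
  simp only [← map_zsmul, ← map_sum]
  rw [← Chains.bd_str, Chains.bd_bd, map_zero]
  rfl

theorem mem_totF {k : ℤ} {x : U.RawTot k} :
    x ∈ U.totF k ↔ ∀ p q e, x ⟨p, q, e⟩ ∈ U.cochains p q :=
  ⟨fun h p q e => h ⟨p, q, e⟩, fun h t => h t.p t.q t.eq⟩

theorem totD_apply {i j : ℤ} (h : i + 1 = j) (x : U.RawTot i) (t : Bideg j) :
    U.totD h x t = U.totDelta h x t + U.totExtd h x t := rfl

theorem totDelta_succ {i j : ℤ} (h : i + 1 = j) (x : U.RawTot i) (p q : ℕ)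
    (e : ((p + 1 : ℕ) : ℤ) + q = j) :
    U.totDelta h x ⟨p + 1, q, e⟩ = U.delta p q (x ⟨p, q, by push_cast at e; lia⟩) := rfl

theorem totExtd_succ {i j : ℤ} (h : i + 1 = j) (x : U.RawTot i) (p q : ℕ)
    (e : (p : ℤ) + (q + 1 : ℕ) = j) :
    U.totExtd h x ⟨p, q + 1, e⟩ =
      (-1 : ℤ) ^ p • U.extd p q (x ⟨p, q, by push_cast at e; lia⟩) := rfl

theorem totDelta_zero {i j : ℤ} (h : i + 1 = j) (x : U.RawTot i) (q : ℕ)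
    (e : ((0 : ℕ) : ℤ) + q = j) : U.totDelta h x ⟨0, q, e⟩ = 0 := rfl

theorem totExtd_zero {i j : ℤ} (h : i + 1 = j) (x : U.RawTot i) (p : ℕ)
    (e : (p : ℤ) + (0 : ℕ) = j) : U.totExtd h x ⟨p, 0, e⟩ = 0 := rfl

theorem totDelta_mem {i j : ℤ} (h : i + 1 = j) {x : U.RawTot i} (hx : x ∈ U.totF i) :
    U.totDelta h x ∈ U.totF j := by
  refine mem_totF.2 ?_
  rintro (_ | p) q e
  · exact zero_mem _
  · exact delta_mem (mem_totF.1 hx _ _ _)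

theorem totExtd_mem {i j : ℤ} (h : i + 1 = j) {x : U.RawTot i} (hx : x ∈ U.totF i) :
    U.totExtd h x ∈ U.totF j := by
  refine mem_totF.2 ?_
  rintro p (_ | q) e
  · exact zero_mem _
  · exact zsmul_mem (extd_mem (mem_totF.1 hx _ _ _)) _

theorem totDelta_add {i j : ℤ} (h : i + 1 = j) (x y : U.RawTot i) :
    U.totDelta h (x + y) = U.totDelta h x + U.totDelta h y := by
  funext ⟨p, q, e⟩
  cases p with
  | zero => exact (add_zero _).symm
  | succ p => exact map_add (U.delta p q) _ _

theorem totExtd_add {i j : ℤ} (h : i + 1 = j) (x y : U.RawTot i) :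
    U.totExtd h (x + y) = U.totExtd h x + U.totExtd h y := by
  funext ⟨p, q, e⟩
  cases q with
  | zero => exact (add_zero _).symm
  | succ q =>
    exact (congrArg (((-1 : ℤ) ^ p) • ·) (map_add (U.extd p q) _ _)).trans (zsmul_add _ _ _)

theorem totDelta_totDelta {i j k : ℤ} (h : i + 1 = j) (h' : j + 1 = k) {x : U.RawTot i}
    (hx : x ∈ U.totF i) : U.totDelta h' (U.totDelta h x) = 0 := by
  funext ⟨p, q, e⟩
  rcases p with _ | _ | p
  · rfl
  · exact map_zero _
  · exact delta_delta (mem_totF.1 hx _ _ _)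

theorem totExtd_totExtd {i j k : ℤ} (h : i + 1 = j) (h' : j + 1 = k) (x : U.RawTot i) :
    U.totExtd h' (U.totExtd h x) = 0 := by
  funext ⟨p, q, e⟩
  rcases q with _ | _ | q
  · rfl
  · rw [totExtd_succ, totExtd_zero, map_zero, smul_zero]
    rfl
  · rw [totExtd_succ, totExtd_succ, map_zsmul, extd_extd, smul_zero, smul_zero]
    rfl

/-- `δ` commutes with `d` and raises `p` by one, so the sign `(-1)^p` makes the two parts of `D`
anticommute. -/
theorem totDelta_totExtd {i j k : ℤ} (h : i + 1 = j) (h' : j + 1 = k) (x : U.RawTot i) :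
    U.totDelta h' (U.totExtd h x) + U.totExtd h' (U.totDelta h x) = 0 := by
  funext ⟨p, q, e⟩
  rw [Pi.add_apply, Pi.zero_apply]
  rcases p with _ | p <;> rcases q with _ | q
  · exact add_zero _
  · rw [totDelta_zero, totExtd_succ, totDelta_zero, map_zero, smul_zero, add_zero]
  · rw [totDelta_succ, totExtd_zero, totExtd_zero, map_zero, add_zero]
  · rw [totDelta_succ, totExtd_succ, totExtd_succ, totDelta_succ, map_zsmul, delta_extd, pow_succ,
      mul_neg_one, neg_smul, add_neg_cancel]

theorem totD_totD {i j k : ℤ} (h : i + 1 = j) (h' : j + 1 = k) {x : U.RawTot i}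
    (hx : x ∈ U.totF i) : U.totD h' (U.totD h x) = 0 := by
  change U.totDelta h' (U.totDelta h x + U.totExtd h x) +
    U.totExtd h' (U.totDelta h x + U.totExtd h x) = 0
  rw [totDelta_add, totExtd_add, totDelta_totDelta h h' hx, totExtd_totExtd, zero_add, add_zero,
    totDelta_totExtd]

/-- The restriction of forms, extended by zero to all pairs of charts. -/
abbrev res (I J : U.Idx) (q : ℕ) : Form (U.dom J) q →+ Form (U.dom I) q :=
  (CompatSystem.id U).res I J q

theorem res_trans {I J K : U.Idx} {q : ℕ} (h1 : U.image I ⊆ U.image J)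
    (h2 : U.image J ⊆ U.image K) {w : Form (U.dom K) q} (hw : IsInvariant w) :
    res I J q (res J K q w) = res I K q w :=
  res_res (CompatSystem.id U) (CompatSystem.id U) h1 h2 hw

theorem pull_eq_res {I J : U.Idx} {q : ℕ} {w : Form (U.dom J) q} (hw : IsInvariant w)
    (l : I ⟶ J) : pull l q w = res I J q w := by
  rw [← restrict_eq_id_res (image_subset_of_hom l), restrict_eq_pull hw _ l]

theorem isInvariant_pull_eqToHom {I J : U.Idx} (e : I = J) {q : ℕ} {w : Form (U.dom J) q}
    (hw : IsInvariant w) : IsInvariant (pull (eqToHom e) q w) := by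
  subst e
  exact (pull_id w).symm ▸ hw

theorem delta_zero_apply {q : ℕ} {w : U.RawCochain 0 q} (s : Fin 2 → U.Idx) :
    U.delta 0 q w s =
      res (union s) (union (s ∘ Fin.succAbove 0)) q (w (s ∘ Fin.succAbove 0)) -
      res (union s) (union (s ∘ Fin.succAbove 1)) q (w (s ∘ Fin.succAbove 1)) := by
  rw [delta_apply, Fin.sum_univ_two, restrict_eq_id_res, restrict_eq_id_res]
  simp [sub_eq_add_neg]

/-- The forms on the atlas are the cocycles of degree zero. -/
theorem mem_map_ofFamily_iff {q : ℕ} {w : U.RawCochain 0 q} :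
    w ∈ (U.orbiForms q).map (U.ofFamily q) ↔ w ∈ U.cochains 0 q ∧ U.delta 0 q w = 0 := by
  constructor
  · rintro ⟨a, ha, rfl⟩
    -- Each component of a compatible family restricts over `∪s` to `a (union s)`, so the two terms
    -- of `δ` coincide.
    have hm : ∀ s, (U.ofFamily q a) s = a (union s) := fun s => ha.2 _ _ _
    refine ⟨⟨fun s => ?_, fun s j k hjk => ?_⟩, ?_⟩
    · rw [hm]
      exact ha.1 _
    · exact (hjk (Subsingleton.elim (α := Fin 1) j k)).elim
    · funext s
      have h (k : Fin 2) : res (union s) (union (s ∘ k.succAbove)) q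
          ((U.ofFamily q a) (s ∘ k.succAbove)) = a (union s) := by
        rw [hm, ← pull_eq_res (ha.1 _) (U.exists_embedding _ _ (image_face s k)).some]
        exact ha.2 _ _ _
      rw [delta_zero_apply, h, h, sub_self]
      rfl
  · rintro ⟨hw, hd⟩
    obtain ⟨a, ha'⟩ : ∃ a : ∀ I : U.Idx, Form (U.dom I) q, ∀ I, a I =
      pull (eqToHom (union_zero fun _ => I).symm) q (w fun _ => I) := ⟨_, fun _ => rfl⟩
    have ha : ∀ I, a I = res I (union fun _ : Fin 1 => I) q (w fun _ => I) := fun I =>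
      (ha' I).trans (pull_eq_res (hw.1 _) _)
    have hinv : ∀ I, IsInvariant (a I) := fun I =>
      ha' I ▸ isInvariant_pull_eqToHom _ (hw.1 _)
    refine ⟨a, ⟨hinv, fun I J l => ?_⟩, ?_⟩
    -- The cocycle condition on the string `IJ` lives over `U_I ∩ U_J`, which contains `U_I` because
    -- `I` embeds into `J`. Restricting it further to `Ũ_I` compares the two components there.
    · have hs := congrFun hd ![I, J]
      rw [delta_zero_apply] at hs
      have h1 : (![I, J] : Fin 2 → U.Idx) ∘ Fin.succAbove 0 = fun _ : Fin 1 => J := by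
        funext i; fin_cases i; rfl
      have h2 : (![I, J] : Fin 2 → U.Idx) ∘ Fin.succAbove 1 = fun _ : Fin 1 => I := by
        funext i; fin_cases i; rfl
      rw [h1, h2] at hs
      have hI : U.image I ⊆ U.image (union ![I, J]) :=
        subset_image_union.2 (Fin.forall_fin_two.2 ⟨subset_rfl, image_subset_of_hom l⟩)
      have hI' : U.image (union ![I, J]) ⊆ U.image (union fun _ : Fin 1 => I) :=
        subset_image_union.2 fun _ => subset_image_union.1 subset_rfl 0
      have hJ' : U.image (union ![I, J]) ⊆ U.image (union fun _ : Fin 1 => J) :=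
        subset_image_union.2 fun _ => subset_image_union.1 subset_rfl 1
      have hJ : U.image J ⊆ U.image (union fun _ : Fin 1 => J) :=
        subset_image_union.2 fun _ => subset_rfl
      have h3 := congrArg (res I (union ![I, J]) q) (sub_eq_zero.1 hs)
      rw [res_trans hI hI' (hw.1 _), res_trans hI hJ' (hw.1 _)] at h3
      rw [pull_eq_res (hinv J), ha, ha,
        res_trans (image_subset_of_hom l) hJ (hw.1 _), h3]
    · funext s
      obtain ⟨I, rfl⟩ : ∃ I, s = fun _ => I := ⟨s 0, funext fun i => by
        rw [Subsingleton.elim (α := Fin 1) i 0]⟩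
      have h1 := res_trans (I := union fun _ : Fin 1 => I) (J := I) (K := union fun _ : Fin 1 => I)
        (q := q) (w := w fun _ => I) (subset_image_union.1 subset_rfl 0)
        (subset_image_union.2 fun _ => subset_rfl) (hw.1 _)
      rw [id_res_self (hw.1 _), ← ha,
        ← pull_eq_res (hinv I) (eqToHom (union_zero fun _ : Fin 1 => I))] at h1
      exact h1

/-- With `E` described as the kernel of `δ` in column zero, stability under `D` and under pullback
is formal, and exactness of the rows can be applied to it. -/
theorem mem_totE_iff {k : ℤ} {x : U.RawTot k} :
    x ∈ U.totE k ↔ x ∈ U.totF k ∧ (∀ p q e, x ⟨p + 1, q, e⟩ = 0) ∧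
      ∀ q e, U.delta 0 q (x ⟨0, q, e⟩) = 0 := by
  constructor
  · rintro ⟨h1, h2⟩
    refine ⟨mem_totF.2 ?_, h1, fun q e => (mem_map_ofFamily_iff.1 (h2 q e)).2⟩
    rintro (_ | p) q e
    · exact (mem_map_ofFamily_iff.1 (h2 q e)).1
    · rw [h1]
      exact zero_mem _
  · rintro ⟨h1, h2, h3⟩
    exact ⟨h2, fun q e => mem_map_ofFamily_iff.2 ⟨mem_totF.1 h1 _ _ _, h3 q e⟩⟩

theorem totI_le (k : ℤ) : U.totI k ≤ U.totF k := by
  rintro x ⟨h1, h2⟩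
  refine mem_totF.2 ?_
  rintro p (_ | q) e
  · exact (h2 p e).1
  · rw [h1]
    exact zero_mem _

theorem isTriple (U : GPreOrb.{u, v}) : U.IsTriple where
  D_mem h x hx := add_mem (totDelta_mem h hx) (totExtd_mem h hx)
  D_D h h' x hx := totD_totD h h' hx
  E_le k x hx := (mem_totE_iff.1 hx).1
  D_mem_E h x hx := by
    obtain ⟨h1, h2, h3⟩ := mem_totE_iff.1 hx
    refine mem_totE_iff.2 ⟨add_mem (totDelta_mem h h1) (totExtd_mem h h1), ?_, ?_⟩
    · intro p q e
      rw [totD_apply, totDelta_succ]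
      have h4 : U.totExtd h x ⟨p + 1, q, e⟩ = 0 := by
        cases q with
        | zero => rfl
        | succ q => rw [totExtd_succ, h2, map_zero, smul_zero]
      rw [h4, add_zero]
      cases p with
      | zero => exact h3 _ _
      | succ p => rw [h2, map_zero]
    · rintro (_ | q) e
      · exact (congrArg (U.delta 0 0) (add_zero _)).trans (map_zero _)
      · refine (congrArg (U.delta 0 (q + 1)) (zero_add _)).trans ?_
        rw [totExtd_succ, pow_zero, one_smul, delta_extd, h3, map_zero]
  I_le := totI_le
  D_mem_I h x hx := by
    have hF := totI_le _ hx
    obtain ⟨h1, h2⟩ := hx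
    refine ⟨fun p q e => ?_, fun p e => ?_⟩
    · rw [totD_apply, totExtd_succ]
      have h4 : U.totDelta h x ⟨p, q + 1, e⟩ = 0 := by
        cases p with
        | zero => rfl
        | succ p => rw [totDelta_succ, h1, map_zero]
      rw [h4, zero_add]
      cases q with
      | zero =>
        have h5 : U.extd p 0 (x ⟨p, 0, by push_cast at e; lia⟩) = 0 :=
          funext fun s => Form.d_eq_zero_of_mem_intForms ((h2 p _).2 s)
        rw [h5, smul_zero]
      | succ q => rw [h1, map_zero, smul_zero]
    · rw [totD_apply, totExtd_zero, add_zero]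
      cases p with
      | zero => exact zero_mem _
      | succ p =>
        rw [totDelta_succ, delta_eq_chainOp (h2 p _).1]
        exact chainOp_mem_intCochains _ (h2 p _)

end GPreOrb

/-! ### Spark homomorphisms of compatible systems -/

namespace CompatSystem

variable {U V W : GPreOrb.{u, v}}

theorem pullCochain_delta (f : CompatSystem U V) {p q : ℕ} {w : V.RawCochain p q}
    (hw : w ∈ V.cochains p q) :
    f.pullCochain (p + 1) q (V.delta p q w) = U.delta p q (f.pullCochain p q w) := by
  rw [pullCochain_eq_chainOp f (delta_mem hw), pullCochain_eq_chainOp f hw,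
    chainOp_delta f hw f.carries_map, delta_chainOp f hw f.carries_map]
  congr 1
  exact LinearMap.ext fun x => (Chains.map_bd _ x).symm

theorem pullCochain_extd (f : CompatSystem U V) {p q : ℕ} {w : V.RawCochain p q}
    (hw : w ∈ V.cochains p q) :
    f.pullCochain p (q + 1) (V.extd p q w) = U.extd p q (f.pullCochain p q w) := by
  rw [pullCochain_eq_chainOp f (extd_mem hw), pullCochain_eq_chainOp f hw, extd_chainOp f hw]

theorem pullTot_apply (f : CompatSystem U V) {k : ℤ} (x : V.RawTot k) (p q : ℕ)
    (e : (p : ℤ) + q = k) : f.pullTot k x ⟨p, q, e⟩ = f.pullCochain p q (x ⟨p, q, e⟩) := rfl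

theorem isSparkHom (f : CompatSystem U V) : f.IsSparkHom := by
  have hF : ∀ k, ∀ x ∈ V.totF k, f.pullTot k x ∈ U.totF k := fun k x hx => mem_totF.2
    fun p q e => by
      rw [pullTot_apply, pullCochain_eq_chainOp f (mem_totF.1 hx _ _ _)]
      exact chainOp_mem f (mem_totF.1 hx _ _ _)
  refine ⟨hF, fun {i j} h x hx => ?_, fun k x hx => ?_, fun k x hx => ?_⟩
  · have h1 : f.pullTot j (V.totDelta h x) = U.totDelta h (f.pullTot i x) := by
      funext ⟨p, q, e⟩
      cases p with
      | zero => exact map_zero (f.pullCochain 0 q)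
      | succ p => exact pullCochain_delta f (mem_totF.1 hx _ _ _)
    have h2 : f.pullTot j (V.totExtd h x) = U.totExtd h (f.pullTot i x) := by
      funext ⟨p, q, e⟩
      cases q with
      | zero => exact map_zero (f.pullCochain p 0)
      | succ q =>
        rw [pullTot_apply, totExtd_succ, totExtd_succ, map_zsmul,
          pullCochain_extd f (mem_totF.1 hx _ _ _)]
        rfl
    exact (map_add _ _ _).trans (congrArg₂ (· + ·) h1 h2)
  · obtain ⟨h1, h2, h3⟩ := mem_totE_iff.1 hx
    refine mem_totE_iff.2 ⟨hF k x h1, fun p q e => ?_, fun q e => ?_⟩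
    · rw [pullTot_apply, h2, map_zero]
    · rw [pullTot_apply, ← pullCochain_delta f (mem_totF.1 h1 _ _ _), h3, map_zero]
  · refine ⟨fun p q e => ?_, fun p e => ?_⟩
    · rw [pullTot_apply, hx.1, map_zero]
    · rw [pullTot_apply, pullCochain_eq_chainOp f (hx.2 p e).1]
      exact chainOp_mem_intCochains f (hx.2 p e)

end CompatSystem

end

end SparkOrb

namespace SparkOrb

/-! ### Spark homotopies induced by operators on chains -/

noncomputable section

open GPreOrb CochainComplex.HomComplex

namespace Chains

variable {A B : Type*}

/-- The string `f t₀ … f t_j g t_j … g t_p`. -/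
def prismStr (f g : A → B) {p : ℕ} (t : Fin (p + 1) → A) (j : Fin (p + 1)) : Fin (p + 2) → B :=
  fun k => if k ≤ j.castSucc then f (t (j.predAbove k)) else g (t (j.predAbove k))

theorem prismStr_zero (f g : A → B) {p : ℕ} (t : Fin (p + 1) → A) :
    prismStr f g t 0 = Fin.cons (f (t 0)) (g ∘ t) := by
  funext k
  refine Fin.cases ?_ (fun k => ?_) k
  · simp [prismStr]
  · simp [prismStr]

theorem prismStr_succ (f g : A → B) {p : ℕ} (t : Fin (p + 2) → A) (j : Fin (p + 1)) :
    prismStr f g t j.succ = Fin.cons (f (t 0)) (prismStr f g (Fin.tail t) j) := by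
  funext k
  refine Fin.cases ?_ (fun k => ?_) k
  · simp [prismStr]
  · have h : (k.succ ≤ j.succ.castSucc) ↔ k ≤ j.castSucc := by
      rw [← Fin.succ_castSucc, Fin.succ_le_succ_iff]
    simp only [prismStr, h, Fin.cons_succ, Fin.succ_predAbove_succ]
    rfl

theorem prism_eq_sum (f g : A → B) {p : ℕ} (t : Fin (p + 1) → A) :
    prism f g (p + 1) t = ∑ j : Fin (p + 1), (-1 : ℤ) ^ (j : ℕ) • str (prismStr f g t j) := by
  induction p with
  | zero =>
    rw [Fin.sum_univ_succ, prismStr_zero, str_cons, str_succ (g ∘ t), prism]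
    simp [prism]
    rfl
  | succ p ih =>
    rw [Fin.sum_univ_succ, prismStr_zero, str_cons, str_succ (g ∘ t), prism, ih, Finset.mul_sum,
      sub_eq_add_neg, ← Finset.sum_neg_distrib, Fin.val_zero, pow_zero, one_smul]
    congr 1
    refine Finset.sum_congr rfl fun j _ => ?_
    rw [prismStr_succ, str_cons, Fin.val_succ, pow_succ, mul_neg_one, neg_smul, mul_smul_comm]

end Chains

namespace CompatSystem

variable {U V W : GPreOrb.{u, v}}

/-! #### Operators on the total complex -/

/-- The operator of degree `-n` on total complexes induced by an operator on chains. -/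
def totOp (f : CompatSystem U V) (T : Chains U.Idx →ₗ[ℤ] Chains V.Idx) (n : ℕ) {i j : ℤ}
    (h : i + (-(n : ℤ)) = j) (x : V.RawTot i) : U.RawTot j :=
  fun t => f.chainOp T t.p (t.p + n) (x ⟨t.p + n, t.q, by have := t.eq; push_cast; lia⟩)

section

variable (f : CompatSystem U V) (T : Chains U.Idx →ₗ[ℤ] Chains V.Idx)

theorem totOp_apply (n : ℕ) {i j : ℤ} (h : i + (-(n : ℤ)) = j) (x : V.RawTot i) (p q : ℕ)
    (e : (p : ℤ) + q = j) : f.totOp T n h x ⟨p, q, e⟩ =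
      f.chainOp T p (p + n) (x ⟨p + n, q, by push_cast; lia⟩) := rfl

theorem totOp_mem (n : ℕ) {i j : ℤ} (h : i + (-(n : ℤ)) = j) {x : V.RawTot i}
    (hx : x ∈ V.totF i) : f.totOp T n h x ∈ U.totF j :=
  mem_totF.2 fun _ _ _ => f.chainOp_mem (mem_totF.1 hx _ _ _)

theorem totOp_add (n : ℕ) {i j : ℤ} (h : i + (-(n : ℤ)) = j) {x y : V.RawTot i}
    (hx : x ∈ V.totF i) (hy : y ∈ V.totF i) :
    f.totOp T n h (x + y) = f.totOp T n h x + f.totOp T n h y := by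
  funext ⟨p, q, e⟩
  exact f.chainOp_add (mem_totF.1 hx _ _ _) (mem_totF.1 hy _ _ _)

theorem totOp_linear_sub (T' : Chains U.Idx →ₗ[ℤ] Chains V.Idx) (n : ℕ) {i j : ℤ}
    (h : i + (-(n : ℤ)) = j) (x : V.RawTot i) :
    f.totOp (T - T') n h x = f.totOp T n h x - f.totOp T' n h x :=
  funext fun _ => chainOp_linear_sub f T T' _ _

theorem totOp_linear_add (T' : Chains U.Idx →ₗ[ℤ] Chains V.Idx) (n : ℕ) {i j : ℤ}
    (h : i + (-(n : ℤ)) = j) (x : V.RawTot i) :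
    f.totOp (T + T') n h x = f.totOp T n h x + f.totOp T' n h x :=
  funext fun _ => chainOp_linear_add f T T' _ _

theorem chainOp_congr_deg {i : ℤ} (x : V.RawTot i) (p q : ℕ) {a b : ℕ} (h : a = b)
    (ea : (a : ℤ) + q = i) (eb : (b : ℤ) + q = i) :
    f.chainOp T p a (x ⟨a, q, ea⟩) = f.chainOp T p b (x ⟨b, q, eb⟩) := by
  subst h
  rfl

variable {T}

theorem totDelta_totOp (hT : f.Carries T) (h1 : T 1 = 0) (m : ℕ) {i j k : ℤ}
    (h : i + (-((m + 1 : ℕ) : ℤ)) = j) (h' : j + 1 = k) (h'' : i + (-(m : ℤ)) = k)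
    {x : V.RawTot i} (hx : x ∈ V.totF i) :
    U.totDelta h' (f.totOp T (m + 1) h x) = f.totOp (T.comp Chains.bd) m h'' x := by
  funext ⟨p, q, e⟩
  rw [totOp_apply]
  cases p with
  | zero =>
    -- In column zero the boundary of a vertex is the empty string, and `T` is assumed to kill it.
    rw [totDelta_zero, chainOp_eq_zero]
    intro s
    rw [LinearMap.comp_apply, Chains.bd_str]
    simp [Chains.str_zero, h1]
  | succ p =>
    rw [totDelta_succ, totOp_apply, delta_chainOp f (mem_totF.1 hx _ _ _) hT]
    exact f.chainOp_congr_deg _ x _ _ (by omega) _ _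

theorem totOp_totDelta (hT : f.Carries T) (m : ℕ) {i j k : ℤ} (h : i + 1 = j)
    (h' : j + (-((m + 1 : ℕ) : ℤ)) = k) (h'' : i + (-(m : ℤ)) = k)
    {x : V.RawTot i} (hx : x ∈ V.totF i) :
    f.totOp T (m + 1) h' (V.totDelta h x) = f.totOp (Chains.bd.comp T) m h'' x := by
  funext ⟨p, q, e⟩
  exact chainOp_delta f (mem_totF.1 hx _ _ _) hT

/-- The operator reads column `p + n` and writes column `p`, so the signs `(-1)^p` on the two sides
differ by `(-1)^n`. -/
theorem totExtd_totOp (n : ℕ) {i i' j k : ℤ} (h : i + (-(n : ℤ)) = j) (h' : j + 1 = k)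
    (h1 : i + 1 = i') (h2 : i' + (-(n : ℤ)) = k) {x : V.RawTot i} (hx : x ∈ V.totF i) :
    U.totExtd h' (f.totOp T n h x) = (-1 : ℤ) ^ n • f.totOp T n h2 (V.totExtd h1 x) := by
  funext ⟨p, q, e⟩
  rw [Pi.smul_apply, totOp_apply]
  cases q with
  | zero => rw [totExtd_zero, totExtd_zero, chainOp_zero, smul_zero]
  | succ q =>
    rw [totExtd_succ, totExtd_succ, totOp_apply, extd_chainOp f (mem_totF.1 hx _ _ _),
      chainOp_sign f T _ (extd_mem (mem_totF.1 hx _ _ _)), smul_smul, ← pow_add]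
    congr 1
    rw [show n + (p + n) = p + 2 * n by ring, pow_add, pow_mul]
    simp

end

/-- The operator on the total complexes as a homomorphism. -/
def totOpHom (f : CompatSystem U V) (T : Chains U.Idx →ₗ[ℤ] Chains V.Idx) (n : ℕ) {i j : ℤ}
    (h : i + (-(n : ℤ)) = j) : V.totF i →+ U.totF j :=
  AddMonoidHom.mk' (fun x => ⟨f.totOp T n h x.1, f.totOp_mem T n h x.2⟩)
    fun x y => Subtype.ext (f.totOp_add T n h x.2 y.2)

/-- The operator on the total complexes as a cochain of degree `-n`. -/
def opCochain (f : CompatSystem U V) (T : Chains U.Idx →ₗ[ℤ] Chains V.Idx) (n : ℕ) :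
    Cochain (isTriple V).triple.F (isTriple U).triple.F (-(n : ℤ)) :=
  Cochain.mk fun _ _ h => AddCommGrpCat.ofHom (f.totOpHom T n h)

theorem opCochain_v_apply (f : CompatSystem U V) (T : Chains U.Idx →ₗ[ℤ] Chains V.Idx) (n : ℕ)
    {i j : ℤ} (h : i + (-(n : ℤ)) = j) (x : V.totF i) :
    (show U.totF j from (f.opCochain T n).v i j h x).1 = f.totOp T n h x.1 := rfl

theorem cochain_ext {n : ℤ} {y z : Cochain (isTriple V).triple.F (isTriple U).triple.F n}
    (h : ∀ i j (hij : i + n = j) (x : V.totF i),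
      (show U.totF j from y.v i j hij x).1 = (show U.totF j from z.v i j hij x).1) : y = z := by
  refine Cochain.ext _ _ fun i j hij => ?_
  ext x
  exact Subtype.ext (h i j hij x)

/-- An operator of negative degree reads only positive columns, where elements of `E` vanish.
Integer constants pull back to integer constants, so row zero with integer values is preserved. -/
theorem opCochain_mem (f : CompatSystem U V) (T : Chains U.Idx →ₗ[ℤ] Chains V.Idx) (m : ℕ) :
    f.opCochain T (m + 1) ∈ sparkCochains (isTriple V).triple (isTriple U).triple _ := by
  refine ⟨fun i j hij (x : V.totF i) hx => ?_, fun i j hij (x : V.totF i) hx => ?_⟩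
  · have hx' := (mem_totE_iff.1 (AddSubgroup.mem_addSubgroupOf.1 hx)).2.1
    refine Subtype.ext ((opCochain_v_apply f T (m + 1) hij x).trans ?_)
    funext ⟨p, q, e⟩
    rw [totOp_apply]
    exact (congrArg _ (hx' (p + m) q _)).trans (chainOp_zero _ _ _ _ _)
  · have hx' : x.1 ∈ V.totI i := AddSubgroup.mem_addSubgroupOf.1 hx
    refine AddSubgroup.mem_addSubgroupOf.2 ?_
    change f.totOp T (m + 1) hij x.1 ∈ U.totI j
    refine ⟨fun p q e => ?_, fun p e => ?_⟩
    · rw [totOp_apply, hx'.1, chainOp_zero]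
    · rw [totOp_apply]
      exact chainOp_mem_intCochains f (hx'.2 _ _)

/-- For `n = 1` the exterior derivatives in `dΦ + Φd` have opposite signs and cancel; the two `δ`
terms are dual to `T ∘ ∂` and `∂ ∘ T`. -/
theorem δ_opCochain_one (f : CompatSystem U V) {T : Chains U.Idx →ₗ[ℤ] Chains V.Idx}
    (hT : f.Carries T) (h1 : T 1 = 0) :
    δ (-((1 : ℕ) : ℤ)) (-((0 : ℕ) : ℤ)) (f.opCochain T 1) =
      f.opCochain (Chains.bd.comp T + T.comp Chains.bd) 0 := by
  refine cochain_ext fun i j hij x => ?_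
  rw [δ_v _ _ (by norm_num) _ i j hij (j - 1) (i + 1) rfl rfl]
  have hx := x.2
  have ha : i + (-((1 : ℕ) : ℤ)) = j - 1 := by push_cast at hij ⊢; lia
  have hb : (i + 1) + (-((1 : ℕ) : ℤ)) = j := by push_cast at hij ⊢; lia
  have e1 : (show U.totF j from ((f.opCochain T 1).v i (j - 1) ha ≫
      (isTriple U).triple.F.d (j - 1) j) x).1 = U.totD (by lia) (f.totOp T 1 ha x.1) :=
    (isTriple U).d_apply (by lia) (f.totOpHom T 1 ha x)
  have e2 : (show U.totF j from ((isTriple V).triple.F.d i (i + 1) ≫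
      (f.opCochain T 1).v (i + 1) j hb) x).1 = f.totOp T 1 hb (V.totD rfl x.1) :=
    congrArg (f.totOp T 1 hb) ((isTriple V).d_apply rfl x)
  have e3 : (show U.totF j from ((f.opCochain T 1).v i (j - 1) ha ≫
      (isTriple U).triple.F.d (j - 1) j + (-((0 : ℕ) : ℤ)).negOnePow •
      (isTriple V).triple.F.d i (i + 1) ≫ (f.opCochain T 1).v (i + 1) j hb) x).1 =
      U.totD (by lia) (f.totOp T 1 ha x.1) + f.totOp T 1 hb (V.totD rfl x.1) := by
    rw [← e1, ← e2]
    simp only [Nat.cast_zero, neg_zero, Int.negOnePow_zero, one_smul]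
    rfl
  refine e3.trans ?_
  rw [opCochain_v_apply]
  change (U.totDelta _ _ + U.totExtd _ _) + f.totOp T 1 hb (V.totDelta _ _ + V.totExtd _ _) = _
  rw [totOp_add f T 1 hb (totDelta_mem _ hx) (totExtd_mem _ hx),
    totDelta_totOp f hT h1 0 ha _ hij hx, totOp_totDelta f hT 0 rfl hb hij hx,
    totExtd_totOp f 1 ha _ rfl hb hx, totOp_linear_add]
  simp only [pow_one, neg_smul, one_smul]
  abel

/-- In degree `-2` the differential is `dΓ - Γd`, and for `n = 2` the exterior derivatives enter
with equal signs, so they cancel again. -/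
theorem δ_opCochain_two (f : CompatSystem U V) {T : Chains U.Idx →ₗ[ℤ] Chains V.Idx}
    (hT : f.Carries T) (h1 : T 1 = 0) :
    δ (-((2 : ℕ) : ℤ)) (-((1 : ℕ) : ℤ)) (f.opCochain T 2) =
      f.opCochain (T.comp Chains.bd - Chains.bd.comp T) 1 := by
  refine cochain_ext fun i j hij x => ?_
  rw [δ_v _ _ (by norm_num) _ i j hij (j - 1) (i + 1) rfl rfl]
  have hx := x.2
  have ha : i + (-((2 : ℕ) : ℤ)) = j - 1 := by push_cast at hij ⊢; lia
  have hb : (i + 1) + (-((2 : ℕ) : ℤ)) = j := by push_cast at hij ⊢; lia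
  have e1 : (show U.totF j from ((f.opCochain T 2).v i (j - 1) ha ≫
      (isTriple U).triple.F.d (j - 1) j) x).1 = U.totD (by lia) (f.totOp T 2 ha x.1) :=
    (isTriple U).d_apply (by lia) (f.totOpHom T 2 ha x)
  have e2 : (show U.totF j from ((isTriple V).triple.F.d i (i + 1) ≫
      (f.opCochain T 2).v (i + 1) j hb) x).1 = f.totOp T 2 hb (V.totD rfl x.1) :=
    congrArg (f.totOp T 2 hb) ((isTriple V).d_apply rfl x)
  have e3 : (show U.totF j from ((f.opCochain T 2).v i (j - 1) ha ≫
      (isTriple U).triple.F.d (j - 1) j + (-((1 : ℕ) : ℤ)).negOnePow •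
      (isTriple V).triple.F.d i (i + 1) ≫ (f.opCochain T 2).v (i + 1) j hb) x).1 =
      U.totD (by lia) (f.totOp T 2 ha x.1) - f.totOp T 2 hb (V.totD rfl x.1) := by
    rw [← e1, ← e2]
    refine Eq.trans ?_ (sub_eq_add_neg _ _).symm
    simp only [Nat.cast_one, Int.negOnePow_neg, Int.negOnePow_one, Units.neg_smul, one_smul]
    rfl
  refine e3.trans ?_
  rw [opCochain_v_apply]
  change (U.totDelta _ _ + U.totExtd _ _) - f.totOp T 2 hb (V.totDelta _ _ + V.totExtd _ _) = _
  rw [totOp_add f T 2 hb (totDelta_mem _ hx) (totExtd_mem _ hx),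
    totDelta_totOp f hT h1 1 ha _ hij hx, totOp_totDelta f hT 1 rfl hb hij hx,
    totExtd_totOp f 2 ha _ rfl hb hx, totOp_linear_sub]
  simp only [even_two, Even.neg_pow, one_pow, one_smul]
  abel

end CompatSystem

end

end SparkOrb

namespace SparkOrb

/-! ### Spark homotopies of natural transformations -/

noncomputable section

open GPreOrb CochainComplex.HomComplex

namespace CompatSystem

variable {U V W : GPreOrb.{u, v}}

/-- The spark homomorphism induced by a compatible system. -/
abbrev spark (f : CompatSystem U V) : SparkHom (isTriple V).triple (isTriple U).triple :=
  (isSparkHom f).sparkHom (isTriple U) (isTriple V)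

/-- The operator `T` is a chain homotopy from `f` to `g`, carried by `f`. -/
structure IsChainHomotopy (f g : CompatSystem U V) (T : Chains U.Idx →ₗ[ℤ] Chains V.Idx) :
    Prop where
  carries : f.Carries T
  one : T 1 = 0
  comm : Chains.bd.comp T + T.comp Chains.bd =
    Chains.map g.functor.obj - Chains.map f.functor.obj

/-- The vertices `g I` are carried by `f` as well, because `V_{fI} ⊆ V_{gI}`. Evaluating them along
`f` or along `g` gives the same forms. -/
theorem opCochain_map_eq {f g : CompatSystem U V} (a : CompatNatTrans f g) :
    f.opCochain (Chains.map g.functor.obj) 0 = Cochain.ofHom g.spark.hom := by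
  refine cochain_ext fun i j hij x => ?_
  obtain rfl : i = j := by simpa using hij
  refine Eq.trans ?_ (congrArg (fun z => (show U.totF i from z x).1)
    (Cochain.ofHom_v g.spark.hom i)).symm
  change f.totOp (Chains.map g.functor.obj) 0 hij x.1 = g.pullTot i x.1
  funext ⟨p, q, e⟩
  have hx := mem_totF.1 x.2 p q e
  rw [pullTot_apply, pullCochain_eq_chainOp g hx, totOp_apply]
  funext s
  exact (ev_eq_of_trans a hx (g.carries_map p s)).symm

/-- The spark homotopy defined by a chain homotopy. -/
def homotopyOf {f g : CompatSystem U V} (a : CompatNatTrans f g)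
    {T : Chains U.Idx →ₗ[ℤ] Chains V.Idx} (hT : IsChainHomotopy f g T) :
    SparkHomotopy f.spark g.spark where
  hom := f.opCochain T 1
  mem := f.opCochain_mem T 0
  comm := by
    refine (δ_opCochain_one f hT.carries hT.one).trans ?_
    rw [hT.comm, ← opCochain_map_eq a, ← opCochain_map_eq (𝟙 f : f ⟶ f)]
    refine cochain_ext fun i j hij x => ?_
    exact totOp_linear_sub f _ _ 0 hij x.1

/-- Spark homotopies which are given by chain homotopies carried by the same compatible system are
equivalent. -/
theorem cls_eq_of_isChainHomotopy {f g : CompatSystem U V}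
    {T T' : Chains U.Idx →ₗ[ℤ] Chains V.Idx}
    (hT : IsChainHomotopy f g T) (hT' : IsChainHomotopy f g T')
    {Φ Φ' : SparkHomotopy f.spark g.spark} (h : Φ.hom = f.opCochain T 1)
    (h' : Φ'.hom = f.opCochain T' 1) : Φ.cls = Φ'.cls := by
  -- The apex of the cone depends only on the union of the string, as alternation requires, and
  -- belongs to the carrier at that union, so coning preserves carriers.
  let v : ∀ p, (Fin (p + 1) → U.Idx) → V.Idx := fun p s => f.functor.obj (union s)
  have hv : ∀ p t j k, v p (t ∘ Equiv.swap j k) = v p t := fun p t j k =>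
    congrArg f.functor.obj (union_swap t j k).symm
  have h1 : (T - T') 1 = 0 := by rw [LinearMap.sub_apply, hT.one, hT'.one, sub_zero]
  have hD : ∀ x, Chains.bd ((T - T') x) + (T - T') (Chains.bd x) = 0 := by
    intro x
    have e1 := LinearMap.congr_fun hT.comm x
    have e2 := LinearMap.congr_fun hT'.comm x
    simp only [LinearMap.add_apply, LinearMap.comp_apply] at e1 e2
    rw [LinearMap.sub_apply, LinearMap.sub_apply, map_sub]
    rw [← sub_eq_zero.2 (e1.trans e2.symm)]
    abel
  have hc : f.Carries (Chains.cone (T - T') v) := by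
    refine Chains.cone_mem hv (C := fun p s => f.carrier (union s))
      (fun p t k => f.carrier_mono (image_face t k)) (fun p t x hx => ?_) (fun p t => ?_)
    · exact f.vert_mul_mem_carrier subset_rfl hx
    · exact sub_mem (hT.carries p t) (hT'.carries p t)
  -- The required `Γ` is the operator of the cone over `T - T'`. Its differential is dual to `cone ∘
  -- ∂ - ∂ ∘ cone = T' - T`, which is the order demanded by `Φ' - Φ`.
  refine Quotient.sound ⟨f.opCochain (Chains.cone (T - T') v) 2, f.opCochain_mem _ 1, ?_⟩
  refine (δ_opCochain_two f hc Chains.cone_one).trans ?_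
  rw [h, h']
  refine cochain_ext fun i j hij x => ?_
  refine Eq.trans ?_ (totOp_linear_sub f T' T 1 hij x.1)
  rw [opCochain_v_apply]
  congr 1
  refine LinearMap.ext fun y => ?_
  have e1 := Chains.bd_cone hv h1 hD y
  simp only [LinearMap.sub_apply, LinearMap.comp_apply] at e1 ⊢
  rw [← neg_sub, e1, neg_sub]

/-- The prism involves only vertices `f sᵢ` and `g sᵢ`; the second kind is carried because the
components of `a` give `V_{f sᵢ} ⊆ V_{g sᵢ}`. -/
theorem prism_mem_carrier {f g : CompatSystem U V} (a : CompatNatTrans f g) {I : U.Idx} {n : ℕ}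
    (s : Fin n → U.Idx)
    (h : ∀ i, V.image (f.functor.obj I) ⊆ V.image (f.functor.obj (s i))) :
    Chains.prism f.functor.obj g.functor.obj n s ∈ f.carrier I := by
  have hg : ∀ i, V.image (f.functor.obj I) ⊆ V.image (g.functor.obj (s i)) := fun i =>
    (h i).trans (image_subset_of_hom (a.trans.app _))
  induction n with
  | zero => exact zero_mem _
  | succ n ih =>
    refine sub_mem (f.vert_mul_mem_carrier (h 0) (f.vert_mul_mem_carrier (hg 0) ?_))
      (f.vert_mul_mem_carrier (h 0) (ih (Fin.tail s) (fun i => h _) fun i => hg _))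
    exact f.str_mem_carrier fun i => hg _

theorem isChainHomotopy_prismOp [LinearOrder U.Idx] {f g : CompatSystem U V}
    (a : CompatNatTrans f g) :
    IsChainHomotopy f g (Chains.prismOp f.functor.obj g.functor.obj) where
  carries p s := by
    -- The prism describes the operator only on increasing strings. Other strings reduce to these by
    -- sorting, up to sign, or have a repetition and give zero.
    by_cases hs : Function.Injective s
    · obtain ⟨σ, hσ⟩ := Chains.exists_sort hs
      have h1 : Chains.prismOp f.functor.obj g.functor.obj (Chains.str (s ∘ σ)) ∈
          f.carrier (union s) := by
        rw [Chains.prismOp_str _ _ hσ]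
        exact prism_mem_carrier a _ fun i => f.image_obj_mono (subset_image_union.1 subset_rfl _)
      rw [Chains.isAlt_str.perm] at h1
      rcases Int.units_eq_one_or (Equiv.Perm.sign σ) with h | h
      · simpa [h] using h1
      · simpa [h] using h1
    · rw [Chains.isAlt_str.zero s hs, map_zero]
      exact zero_mem _
  one := Chains.prismOp_one _ _
  comm := LinearMap.ext fun x => Chains.bd_prismOp _ _ x

theorem isChainHomotopy_zero (f : CompatSystem U V) : IsChainHomotopy f f 0 where
  carries _ _ := zero_mem _
  one := rfl
  comm := by simp

/-- The second homotopy is carried by `g`, hence by `f`, since `a` makes the carriers of `g`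
smaller. -/
theorem IsChainHomotopy.add {f g h : CompatSystem U V} (a : CompatNatTrans f g)
    {T T' : Chains U.Idx →ₗ[ℤ] Chains V.Idx} (hT : IsChainHomotopy f g T)
    (hT' : IsChainHomotopy g h T') : IsChainHomotopy f h (T + T') where
  carries p s := add_mem (hT.carries p s) (carrier_le_of_trans a _ (hT'.carries p s))
  one := by rw [LinearMap.add_apply, hT.one, hT'.one, add_zero]
  comm := by
    rw [LinearMap.comp_add, LinearMap.add_comp, add_add_add_comm, hT.comm, hT'.comm]
    abel

theorem opCochain_add_of_trans {f g : CompatSystem U V} (a : CompatNatTrans f g)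
    (T : Chains U.Idx →ₗ[ℤ] Chains V.Idx) {T' : Chains U.Idx →ₗ[ℤ] Chains V.Idx}
    (hT' : g.Carries T') :
    f.opCochain T 1 + g.opCochain T' 1 = f.opCochain (T + T') 1 := by
  refine cochain_ext fun i j hij x => ?_
  rw [opCochain_v_apply, totOp_linear_add]
  refine congrArg (f.totOp T 1 hij x.1 + ·) ?_
  funext ⟨p, q, e⟩ s
  exact ev_eq_of_trans a (mem_totF.1 x.2 _ _ _) (hT' p s)

theorem map_mem_carrier (f : CompatSystem U V) (h : CompatSystem V W) {I : U.Idx}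
    {x : Chains V.Idx} (hx : x ∈ f.carrier I) :
    Chains.map h.functor.obj x ∈ (f.comp h).carrier I := by
  induction hx using Submodule.span_induction with
  | mem x hx =>
    obtain ⟨n, t, ht, rfl⟩ := hx
    rw [Chains.map_str]
    exact str_mem_carrier _ fun i => h.image_obj_mono (ht i)
  | zero => rw [map_zero]; exact zero_mem _
  | add x y _ _ hx hy => rw [map_add]; exact add_mem hx hy
  | smul a x _ hx => rw [map_smul]; exact Submodule.smul_mem _ _ hx

theorem ev_pullCochain (f : CompatSystem U V) (h : CompatSystem V W) {I : U.Idx} {p q : ℕ}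
    {w : W.RawCochain p q} (hw : w ∈ W.cochains p q) {x : Chains V.Idx} (hx : x ∈ f.carrier I) :
    f.ev I (h.pullCochain p q w) x = (f.comp h).ev I w (Chains.map h.functor.obj x) := by
  have hp : h.pullCochain p q w ∈ V.cochains p q := by
    rw [pullCochain_eq_chainOp h hw]
    exact chainOp_mem h hw
  refine f.eq_on_carrier (G := ((f.comp h).ev I w).comp (Chains.map h.functor.obj)) p ?_ ?_ ?_ hx
  · rw [ev_one f hp, LinearMap.comp_apply, ← Chains.str_zero (Fin.elim0 : Fin 0 → V.Idx),
      Chains.map_str, Chains.str_zero, ev_one _ hw]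
  · intro n hn t
    rw [ev_str_of_ne f hp hn, LinearMap.comp_apply, Chains.map_str, ev_str_of_ne _ hw hn]
  · intro t ht
    rw [ev_str f hp, LinearMap.comp_apply, Chains.map_str, ev_str _ hw,
      pullCochain_apply_eq_res h hw]
    exact res_res f h ht (congrArg W.image (h.map_union p t)).subset (hw.1 _)

/-- Here `f(∪𝐈) = ∪ f𝐈` is essential: a chain carried by `g` at the union of the image string is
carried by the composite at `∪𝐈`. -/
theorem carrier_union_obj_le (f : CompatSystem U V) (g : CompatSystem V W) {p : ℕ}
    (s : Fin (p + 1) → U.Idx) :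
    g.carrier (union (f.functor.obj ∘ s)) ≤ (f.comp g).carrier (union s) := by
  refine g.carrier_mono (I := f.functor.obj (union s)) ?_
  exact (congrArg V.image (f.map_union p s)).subset

theorem Carries.comp_map (f : CompatSystem U V) {g : CompatSystem V W}
    {T : Chains V.Idx →ₗ[ℤ] Chains W.Idx} (hT : g.Carries T) :
    (f.comp g).Carries (T.comp (Chains.map f.functor.obj)) := by
  intro p s
  rw [LinearMap.comp_apply, Chains.map_str]
  exact carrier_union_obj_le f g s (hT p _)

theorem IsChainHomotopy.comp_map (f : CompatSystem U V) {g h : CompatSystem V W}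
    {T : Chains V.Idx →ₗ[ℤ] Chains W.Idx} (hT : IsChainHomotopy g h T) :
    IsChainHomotopy (f.comp g) (f.comp h) (T.comp (Chains.map f.functor.obj)) where
  carries := hT.carries.comp_map f
  one := by
    rw [LinearMap.comp_apply, ← Chains.str_zero (Fin.elim0 : Fin 0 → U.Idx), Chains.map_str,
      Chains.str_zero, hT.one]
  comm := by
    refine Chains.ext fun n t => ?_
    have e := LinearMap.congr_fun hT.comm (Chains.map f.functor.obj (Chains.str t))
    simp only [LinearMap.add_apply, LinearMap.comp_apply, LinearMap.sub_apply, Chains.map_bd,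
      Chains.map_str] at e ⊢
    exact e

theorem IsChainHomotopy.map_comp {f g : CompatSystem U V} (h : CompatSystem V W)
    {T : Chains U.Idx →ₗ[ℤ] Chains V.Idx} (hT : IsChainHomotopy f g T) :
    IsChainHomotopy (f.comp h) (g.comp h) ((Chains.map h.functor.obj).comp T) where
  carries p s := map_mem_carrier f h (hT.carries p s)
  one := by rw [LinearMap.comp_apply, hT.one, map_zero]
  comm := by
    refine Chains.ext fun n t => ?_
    have e := congrArg (Chains.map h.functor.obj) (LinearMap.congr_fun hT.comm (Chains.str t))
    simp only [LinearMap.add_apply, LinearMap.comp_apply, LinearMap.sub_apply, map_add, map_sub,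
      Chains.map_bd, Chains.map_str] at e ⊢
    exact e

/-- Operators on cochains compose contravariantly, so postcomposition with the pullback along `f`
amounts to precomposing `T` with the chain map of `f`. -/
theorem opCochain_comp_spark (f : CompatSystem U V) (g : CompatSystem V W)
    {T : Chains V.Idx →ₗ[ℤ] Chains W.Idx} (hT : g.Carries T) (n : ℕ) :
    (g.opCochain T n).comp (Cochain.ofHom f.spark.hom) (add_zero _) =
      (f.comp g).opCochain (T.comp (Chains.map f.functor.obj)) n := by
  refine cochain_ext fun i j hij x => ?_
  rw [Cochain.comp_zero_cochain_v, Cochain.ofHom_v]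
  change f.pullTot j (g.totOp T n hij x.1) = (f.comp g).totOp _ n hij x.1
  funext ⟨p, q, e⟩ s
  have hx := mem_totF.1 x.2 (p + n) q (by push_cast; lia)
  rw [pullTot_apply, totOp_apply, totOp_apply, pullCochain_apply_eq_res f (chainOp_mem g hx)]
  refine (res_ev f g (congrArg V.image (f.map_union p s)).subset hx (hT p _)).trans ?_
  rw [chainOp, LinearMap.comp_apply, Chains.map_str]
  rfl

theorem spark_comp_opCochain {f : CompatSystem U V} (h : CompatSystem V W)
    {T : Chains U.Idx →ₗ[ℤ] Chains V.Idx} (hT : f.Carries T) (n : ℕ) :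
    (Cochain.ofHom h.spark.hom).comp (f.opCochain T n) (zero_add _) =
      (f.comp h).opCochain ((Chains.map h.functor.obj).comp T) n := by
  refine cochain_ext fun i j hij x => ?_
  rw [Cochain.zero_cochain_comp_v, Cochain.ofHom_v]
  change f.totOp T n hij (h.pullTot i x.1) = (f.comp h).totOp _ n hij x.1
  funext ⟨p, q, e⟩ s
  exact ev_pullCochain f h (mem_totF.1 x.2 _ _ _) (hT p s)

/-! #### Functoriality of the induced homomorphisms -/

theorem SparkHom.ext_totF {f g : SparkHom (isTriple V).triple (isTriple U).triple}
    (h : ∀ k (x : V.totF k), (show U.totF k from f.hom.f k x).1 =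
      (show U.totF k from g.hom.f k x).1) : f = g := by
  refine SparkHom.ext (HomologicalComplex.Hom.ext (funext fun k => ?_))
  ext x
  exact Subtype.ext (h k x)

theorem spark_id (U : GPreOrb.{u, v}) :
    (CompatSystem.id U).spark = SparkHom.id (isTriple U).triple := by
  refine SparkHom.ext_totF fun k x => ?_
  change (CompatSystem.id U).pullTot k x.1 = x.1
  funext ⟨p, q, e⟩ s
  have hx := mem_totF.1 x.2 p q e
  rw [pullTot_apply, pullCochain_apply_eq_res _ hx]
  exact id_res_self (hx.1 s)

theorem spark_comp (f : CompatSystem U V) (g : CompatSystem V W) :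
    (f.comp g).spark = g.spark.comp f.spark := by
  refine SparkHom.ext_totF fun k x => ?_
  change (f.comp g).pullTot k x.1 = f.pullTot k (g.pullTot k x.1)
  funext ⟨p, q, e⟩ s
  have hx := mem_totF.1 x.2 p q e
  have hg : g.pullCochain p q (x.1 ⟨p, q, e⟩) ∈ V.cochains p q := by
    rw [pullCochain_eq_chainOp g hx]
    exact chainOp_mem g hx
  rw [pullTot_apply, pullTot_apply, pullTot_apply, pullCochain_apply_eq_res _ hx,
    pullCochain_apply_eq_res f hg, pullCochain_apply_eq_res g hx]
  exact (res_res f g (congrArg V.image (f.map_union p s)).subset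
    (congrArg W.image (g.map_union p _)).subset (hx.1 _)).symm

/-! #### The prism operator -/

theorem chainOp_prism_eq {f g : CompatSystem U V} (a : CompatNatTrans f g) {p q : ℕ}
    {w : V.RawCochain (p + 1) q} (hw : w ∈ V.cochains (p + 1) q) (s : Fin (p + 1) → U.Idx) :
    f.ev (union s) w (Chains.prism f.functor.obj g.functor.obj (p + 1) s) = prism a w s := by
  rw [Chains.prism_eq_sum, map_sum, prism]
  refine Finset.sum_congr rfl fun j _ => ?_
  rw [map_zsmul, ev_str f hw]
  exact congrArg _ (res_apply f (prism_subset a s j) _)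

theorem isPrism_homotopyOf [LinearOrder U.Idx] {f g : CompatSystem U V} (a : CompatNatTrans f g) :
    IsPrism a (· < ·) (homotopyOf a (isChainHomotopy_prismOp a)) := by
  intro i j hij x p q e s hs
  have hx := mem_totF.1 (show V.totF i from x).2 (p + 1) q (by push_cast; lia)
  refine Eq.trans ?_ (chainOp_prism_eq a hx s)
  change f.ev (union s) _ (Chains.prismOp f.functor.obj g.functor.obj (Chains.str s)) = _
  rw [Chains.prismOp_str _ _ fun k l => hs k l]

end CompatSystem

end

end SparkOrb

namespace SparkOrb

/-! ### Quasi-isomorphisms of complexes of abelian groups -/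

/-- With homology realised as kernel modulo image, `hs` is surjectivity and `hi` injectivity of the
induced map. -/
theorem ShortComplex.quasiIso_of_forall {S T : ShortComplex Ab.{v}} (f : S ⟶ T)
    (hs : ∀ x : T.X₂, T.g x = 0 → ∃ y : S.X₂, S.g y = 0 ∧ ∃ z : T.X₁, x = f.τ₂ y + T.f z)
    (hi : ∀ y : S.X₂, S.g y = 0 → ∀ z : T.X₁, f.τ₂ y = T.f z → ∃ y' : S.X₁, y = S.f y') :
    ShortComplex.QuasiIso f := by
  have γ : ShortComplex.LeftHomologyMapData f S.abLeftHomologyData T.abLeftHomologyData := default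
  have hi' (y : AddMonoidHom.ker S.g.hom) :
      (show AddMonoidHom.ker T.g.hom from γ.φK y).1 = f.τ₂ y.1 :=
    (ConcreteCategory.congr_hom γ.commi (show S.abLeftHomologyData.K from y) :)
  have hp (y : AddMonoidHom.ker S.g.hom) :
      γ.φH (QuotientAddGroup.mk' (AddMonoidHom.range S.abToCycles) y) =
        QuotientAddGroup.mk' (AddMonoidHom.range T.abToCycles)
          (show AddMonoidHom.ker T.g.hom from γ.φK y) :=
    (ConcreteCategory.congr_hom γ.commπ (show S.abLeftHomologyData.K from y) :)
  rw [γ.quasiIso_iff, ConcreteCategory.isIso_iff_bijective]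
  constructor
  · refine (injective_iff_map_eq_zero γ.φH.hom).2 fun h => ?_
    obtain ⟨y, rfl⟩ := QuotientAddGroup.mk'_surjective _ h
    intro h0
    have h1 := (hp y).symm.trans h0
    obtain ⟨z, hz⟩ := (QuotientAddGroup.eq_zero_iff _).1 h1
    obtain ⟨y', hy'⟩ := hi y.1 y.2 z ((hi' y).symm.trans (congrArg Subtype.val hz).symm)
    exact (QuotientAddGroup.eq_zero_iff _).2 ⟨y', Subtype.ext hy'.symm⟩
  · intro h
    obtain ⟨x, rfl⟩ := QuotientAddGroup.mk'_surjective _ h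
    obtain ⟨y, hy, z, hz⟩ := hs x.1 x.2
    refine ⟨QuotientAddGroup.mk' (AddMonoidHom.range S.abToCycles) ⟨y, hy⟩, (hp _).trans ?_⟩
    refine QuotientAddGroup.eq.2 ⟨z, Subtype.ext ?_⟩
    refine Eq.trans ?_ (congrArg (fun a => -a + x.1) (hi' ⟨y, hy⟩)).symm
    change T.f z = _
    rw [hz]
    abel

theorem quasiIso_of_forall {K L : CochainComplex AddCommGrpCat.{v} ℤ} (f : K ⟶ L)
    (hs : ∀ (i j k : ℤ), i + 1 = j → j + 1 = k → ∀ x : L.X j, L.d j k x = 0 →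
      ∃ y : K.X j, K.d j k y = 0 ∧ ∃ z : L.X i, x = f.f j y + L.d i j z)
    (hi : ∀ (i j k : ℤ), i + 1 = j → j + 1 = k → ∀ y : K.X j, K.d j k y = 0 →
      ∀ z : L.X i, f.f j y = L.d i j z → ∃ y' : K.X i, y = K.d i j y') : QuasiIso f := by
  refine ⟨fun j => ?_⟩
  rw [quasiIsoAt_iff' f (j - 1) j (j + 1) (by simp) (by simp)]
  exact ShortComplex.quasiIso_of_forall _ (hs _ _ _ (by simp) rfl) (hi _ _ _ (by simp) rfl)

namespace GPreOrb

variable {U : GPreOrb.{u, v}}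

/-! ### The spark complex of a good atlas with exact rows -/

/-- The rows of the double complex are exact in positive degrees. -/
def HasExactRows (U : GPreOrb.{u, v}) : Prop :=
  ∀ (p q : ℕ), ∀ w ∈ U.cochains (p + 1) q, U.delta (p + 1) q w = 0 →
    ∃ y ∈ U.cochains p q, U.delta p q y = w

/-- The only other contribution to this component of `D x` is the exterior derivative of `x` in
column `p + 1`, where `x` vanishes. -/
theorem totD_succ_eq_zero {i j : ℤ} {h : i + 1 = j} {x : U.RawTot i} {p q : ℕ}
    {e : (p : ℤ) + q = i} (hx : ∀ q e, x ⟨p + 1, q, e⟩ = 0)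
    (hD : ∀ q e, U.totD h x ⟨p + 1, q, e⟩ = 0) : U.delta p q (x ⟨p, q, e⟩) = 0 := by
  have h1 := hD q (by push_cast; lia)
  rw [totD_apply, totDelta_succ] at h1
  refine Eq.trans (add_zero _).symm (Eq.trans (congrArg _ ?_) h1)
  cases q with
  | zero => rfl
  | succ q => rw [totExtd_succ, hx, map_zero, smul_zero]

/-- Staircase argument: the component of `x` in its last nonzero column is `δ`-closed, hence
`δ`-exact; subtracting `D` of a primitive removes that column. What is left in column zero is
`δ`-closed and so lies in `E`. Only the positive columns of `D x` have to vanish, so the statement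
yields both surjectivity and injectivity on cohomology. -/
theorem HasExactRows.exists_sub_mem_totE (hU : U.HasExactRows) {i j k : ℤ} (h : i + 1 = j)
    (h' : j + 1 = k) {x : U.RawTot j} (hx : x ∈ U.totF j)
    (hD : ∀ p q e, U.totD h' x ⟨p + 1, q, e⟩ = 0) :
    ∃ y ∈ U.totF i, x - U.totD h y ∈ U.totE j := by
  suffices H : ∀ (N : ℕ) (x : U.RawTot j), x ∈ U.totF j →
      (∀ p q e, U.totD h' x ⟨p + 1, q, e⟩ = 0) → (∀ p q e, N < p → x ⟨p, q, e⟩ = 0) →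
      ∃ y ∈ U.totF i, x - U.totD h y ∈ U.totE j from
    -- Columns beyond the total degree are empty, so the induction can start at `j`.
    H j.toNat x hx hD fun p q e hp => by lia
  intro N
  induction N with
  | zero =>
    intro x hx hD hN
    refine ⟨0, zero_mem _, ?_⟩
    rw [map_zero, sub_zero]
    exact mem_totE_iff.2 ⟨hx, fun p q e => hN _ _ _ p.succ_pos, fun q e =>
      totD_succ_eq_zero (fun q e => hN _ _ _ (Nat.succ_pos 0)) (hD 0)⟩
  | succ N ih =>
    intro x hx hD hN
    have hx' : ∀ q e, ∃ y ∈ U.cochains N q, U.delta N q y = x ⟨N + 1, q, e⟩ := fun q e =>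
      hU N q _ (mem_totF.1 hx _ _ _) (totD_succ_eq_zero (fun q e => hN _ _ _ (Nat.lt_succ_self _))
        (hD (N + 1)))
    choose y hy hyx using hx'
    classical
    -- The primitives are placed in column `N`. Then `δz` matches column `N + 1` of `x`, while `dz`
    -- stays in column `N`, so nothing new appears above.
    let z : U.RawTot i := fun t =>
      if h : t.p = N then h ▸ y t.q (by have := t.eq; push_cast; lia) else 0
    have hz1 (q e) : z ⟨N, q, e⟩ = y q (by push_cast; lia) := dif_pos rfl
    have hz2 (p q e) (hp : p ≠ N) : z ⟨p, q, e⟩ = 0 := dif_neg hp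
    have hz : z ∈ U.totF i := by
      refine mem_totF.2 fun p q e => ?_
      by_cases hp : p = N
      · subst hp
        rw [hz1]
        exact hy _ _
      · rw [hz2 _ _ _ hp]
        exact zero_mem _
    obtain ⟨w, hw, hw'⟩ := ih (x - U.totD h z) (sub_mem hx ((isTriple U).D_mem h z hz))
      (fun p q e => by rw [map_sub, totD_totD h h' hz, sub_zero, hD]) (by
        intro p q e hp
        obtain ⟨p, rfl⟩ := Nat.exists_eq_succ_of_ne_zero (Nat.ne_zero_of_lt hp)
        have h2 : U.totExtd h z ⟨p + 1, q, e⟩ = 0 := by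
          cases q with
          | zero => rfl
          | succ q => rw [totExtd_succ, hz2 _ _ _ (by lia), map_zero, smul_zero]
        rw [Pi.sub_apply, totD_apply, h2, add_zero, totDelta_succ]
        by_cases hpN : p = N
        · subst hpN
          rw [hz1, hyx, sub_self]
        · rw [hz2 _ _ _ hpN, map_zero, sub_zero]
          exact hN _ _ _ (by lia))
    refine ⟨z + w, add_mem hz hw, ?_⟩
    rwa [map_add, ← sub_sub]

theorem HasExactRows.isSpark (hU : U.HasExactRows) : (isTriple U).triple.IsSpark where
  inter k hk := by
    refine (AddSubgroup.eq_bot_iff_forall _).2 ?_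
    rintro x ⟨hI, hE⟩
    have hI' := AddSubgroup.mem_addSubgroupOf.1 hI
    have hE' := AddSubgroup.mem_addSubgroupOf.1 hE
    refine Subtype.ext (funext ?_)
    rintro ⟨p, q, e⟩
    -- `E` lives in column zero and `I` in row zero. They could meet only in bidegree `(0, 0)`,
    -- which positive total degree excludes.
    cases p with
    | succ p => exact hE'.1 p q e
    | zero =>
      cases q with
      | zero => lia
      | succ q => exact hI'.1 0 q e
  neg k hk x := Subtype.ext (funext fun t => by
    have := t.eq
    lia)
  quasiIso := by
    refine quasiIso_of_forall _ ?_ ?_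
    · intro i j k h h' (x : U.totF j) hx
      have hx' : U.totD h' x.1 = 0 := ((isTriple U).d_apply h' x).symm.trans
        (congrArg Subtype.val hx)
      obtain ⟨y, hy, hy'⟩ := hU.exists_sub_mem_totE h h' x.2 fun p q e => by rw [hx']; rfl
      let x' : U.totF j := ⟨x.1 - U.totD h y, (isTriple U).E_le _ hy'⟩
      refine ⟨⟨x', AddSubgroup.mem_addSubgroupOf.2 hy'⟩, ?_, ⟨y, hy⟩, Subtype.ext ?_⟩
      · refine Subtype.ext (Subtype.ext ?_)
        refine ((isTriple U).d_apply h' x').trans ?_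
        change U.totD h' (x.1 - U.totD h y) = 0
        rw [map_sub, hx', totD_totD h h' hy, sub_zero]
      · refine Eq.trans ?_ (congrArg (x.1 - U.totD h y + ·) ((isTriple U).d_apply h ⟨y, hy⟩).symm)
        exact (sub_add_cancel _ _).symm
    · rintro i j k h h' ⟨y, hyE⟩ hy (z : U.totF i) hz
      have hz' : (show U.totF j from y).1 = U.totD h z.1 :=
        (congrArg Subtype.val hz).trans ((isTriple U).d_apply h z)
      have hE := AddSubgroup.mem_addSubgroupOf.1 hyE
      change (show U.totF j from y).1 ∈ U.totE j at hE
      rw [hz'] at hE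
      -- A primitive `z` of an element of `E` has `D z` without positive columns, so the staircase
      -- moves `z` into `E` without changing `D z`.
      obtain ⟨w, hw, hw'⟩ := hU.exists_sub_mem_totE (i := i - 1) (by lia) h z.2 hE.1
      let z' : U.totF i := ⟨_, (isTriple U).E_le _ hw'⟩
      refine ⟨⟨z', AddSubgroup.mem_addSubgroupOf.2 hw'⟩, Subtype.ext (Subtype.ext ?_)⟩
      refine hz'.trans (Eq.symm ?_)
      refine ((isTriple U).d_apply h z').trans ?_
      change U.totD h (z.1 - U.totD _ w) = _
      rw [map_sub, totD_totD _ h hw, sub_zero]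

end GPreOrb

end SparkOrb

namespace SparkOrb

/-! ### Smooth functions on open subsets of Euclidean spaces -/

section

variable {m n : ℕ} {B : Type*} [NormedAddCommGroup B] [NormedSpace ℝ B]

/-- Smoothness of a function on an open subset of `ℝⁿ`. -/
def IsSmoothFun {s : Op n} (f : s → B) : Prop :=
  ContDiffOn ℝ ∞ (zeroExt (s := (s : Set (E n))) f) s

theorem eventually_forall_mem {s : Op n} {x : s} {P : s → Prop} (h : ∀ᶠ y in 𝓝 x, P y) :
    ∀ᶠ y in 𝓝 (x : E n), ∀ hy : y ∈ s, P ⟨y, hy⟩ := by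
  have h2 := (s.isOpen.isOpenEmbedding_subtypeVal.map_nhds_eq x).symm
  rw [h2, Filter.eventually_map]
  filter_upwards [h] with z hz _ using hz

theorem zeroExt_eventuallyEq {n : ℕ} {B : Type*} [Zero B] {s t : Op n} {f : s → B} {g : t → B}
    {x : s} (hx : x.1 ∈ t)
    (h : ∀ᶠ y in 𝓝 x, ∀ hy : y.1 ∈ t, f y = g ⟨y.1, hy⟩) :
    zeroExt (s := (s : Set (E n))) f =ᶠ[𝓝 x.1] zeroExt (s := (t : Set (E n))) g := by
  filter_upwards [s.isOpen.mem_nhds x.2, t.isOpen.mem_nhds hx, eventually_forall_mem h]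
    with y hy hy' h1
  rw [zeroExt_of_mem _ hy, zeroExt_of_mem _ hy', h1 hy hy']

theorem IsSmoothFun.contDiffAt {s : Op n} {f : s → B} (hf : IsSmoothFun f) (x : s) :
    ContDiffAt ℝ ∞ (zeroExt (s := (s : Set (E n))) f) x :=
  ContDiffOn.contDiffAt hf (s.isOpen.mem_nhds x.2)

theorem isSmoothFun_of_local {s : Op n} {f : s → B}
    (h : ∀ x : s, ∃ t : Op n, x.1 ∈ t ∧ ∃ g : t → B, IsSmoothFun g ∧
      ∀ᶠ y in 𝓝 x, ∀ hy : y.1 ∈ t, f y = g ⟨y.1, hy⟩) : IsSmoothFun f := by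
  intro x hx
  obtain ⟨t, ht, g, hg, hfg⟩ := h ⟨x, hx⟩
  exact ((hg.contDiffAt ⟨x, ht⟩).congr_of_eventuallyEq
    (zeroExt_eventuallyEq (x := ⟨x, hx⟩) ht hfg)).contDiffWithinAt

theorem IsSmoothFun.comp {s : Op m} {t : Op n} {f : t → B} (hf : IsSmoothFun f) {g : s → t}
    (hg : IsSmooth g) : IsSmoothFun (f ∘ g) := by
  refine (ContDiffOn.comp (t := (t : Set (E n))) hf hg fun _ hx => ?_).congr fun x hx => ?_
  · rw [zeroExt_of_mem _ hx]
    exact (g ⟨_, hx⟩).2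
  · rw [zeroExt_of_mem _ hx, Function.comp_apply, Function.comp_apply, zeroExt_of_mem _ hx]
    exact (zeroExt_apply (s := (t : Set (E n))) f _).symm

theorem IsSmoothFun.zero {s : Op n} : IsSmoothFun (0 : s → B) :=
  (contDiffOn_const (c := 0)).congr fun _ hx => zeroExt_of_mem _ hx

theorem IsSmoothFun.add {s : Op n} {f g : s → B} (hf : IsSmoothFun f) (hg : IsSmoothFun g) :
    IsSmoothFun (f + g) :=
  (ContDiffOn.add hf hg).congr fun x hx => by
    simp only [zeroExt_of_mem _ hx, Pi.add_apply]

theorem IsSmoothFun.sum {s : Op n} {ι : Type*} (A : Finset ι) {f : ι → s → B}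
    (hf : ∀ a ∈ A, IsSmoothFun (f a)) : IsSmoothFun (fun x => ∑ a ∈ A, f a x) := by
  classical
  induction A using Finset.induction_on with
  | empty => exact IsSmoothFun.zero
  | insert a A ha ih =>
    simp only [Finset.sum_insert ha]
    exact (hf a (Finset.mem_insert_self _ _)).add
      (ih fun b hb => hf b (Finset.mem_insert_of_mem hb))

theorem IsSmoothFun.smul {s : Op n} {r : s → ℝ} {f : s → B} (hr : IsSmoothFun r)
    (hf : IsSmoothFun f) : IsSmoothFun (fun x => r x • f x) :=
  (ContDiffOn.smul hr hf).congr fun x hx => by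
    change _ = zeroExt r x • zeroExt f x
    simp only [zeroExt_of_mem _ hx]

theorem IsSmoothFun.inv {s : Op n} {r : s → ℝ} (hr : IsSmoothFun r) (h : ∀ x, r x ≠ 0) :
    IsSmoothFun (fun x => (r x)⁻¹) :=
  (ContDiffOn.inv hr fun x hx => by
    rw [zeroExt_of_mem _ hx]; exact h _).congr fun x hx => by
      simp only [zeroExt_of_mem _ hx, Pi.inv_apply]

theorem IsSmoothFun.of_contDiffOn {s : Op n} {f : E n → B} (hf : ContDiffOn ℝ ∞ f s) :
    IsSmoothFun (fun x : s => f x) :=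
  hf.congr fun _ hx => zeroExt_of_mem _ hx

theorem IsSmooth.of_contDiffOn {s : Op m} {t : Op n} {f : s → t} {g : E m → E n}
    (hg : ContDiffOn ℝ ∞ g s) (h : ∀ x, (f x : E n) = g x) : IsSmooth f :=
  hg.congr fun _ hx => (zeroExt_of_mem _ hx).trans (h _)

/-- The inclusion of an open subset. -/
def Op.incl {s t : Op n} (h : s ≤ t) (x : s) : t := ⟨x.1, h x.2⟩

theorem Op.isSmooth_incl {s t : Op n} (h : s ≤ t) : IsSmooth (Op.incl h) :=
  IsSmooth.of_contDiffOn (g := fun x => x) contDiffOn_id fun _ => rfl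

theorem mapDeriv_incl {s t : Op n} (h : s ≤ t) (x : s) :
    mapDeriv (Op.incl h) x = ContinuousLinearMap.id ℝ (E n) := by
  rw [← fderiv_id (𝕜 := ℝ) (x := (x : E n))]
  refine Filter.EventuallyEq.fderiv_eq ?_
  filter_upwards [s.isOpen.mem_nhds x.2] with y hy
  exact zeroExt_of_mem _ hy

/-- An injective smooth map with injective differentials between open subsets of `ℝⁿ` has a smooth
inverse on its image. -/
theorem IsSmooth.exists_inverse {s t : Op n} {h : s → t} (hh : IsSmooth h)
    (hinj : Function.Injective h) (hd : ∀ x, Function.Injective (mapDeriv h x)) :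
    ∃ (W : Op n) (k : W → s), W ≤ t ∧ IsSmooth k ∧ (∀ x, (h x).1 ∈ W) ∧
      ∀ y, (h (k y)).1 = y.1 := by
  let H : E n → E n := zeroExt (s := (s : Set (E n))) fun x => (h x : E n)
  have hH : ∀ x (hx : x ∈ s), H x = h ⟨x, hx⟩ := fun x hx => zeroExt_of_mem _ hx
  have hsm : ∀ x (hx : x ∈ s), ContDiffAt ℝ ∞ H x := fun x hx =>
    ContDiffOn.contDiffAt hh (s.isOpen.mem_nhds hx)
  have hder : ∀ x (hx : x ∈ s), ∃ D : E n ≃L[ℝ] E n,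
      HasStrictFDerivAt H (D : E n →L[ℝ] E n) x := fun x hx => by
    -- In finite dimension an injective endomorphism is invertible, which is what the inverse
    -- function theorem needs.
    let D : E n ≃L[ℝ] E n := (LinearEquiv.ofInjectiveEndo (mapDeriv h ⟨x, hx⟩).toLinearMap
      (hd ⟨x, hx⟩)).toContinuousLinearEquiv
    have hD : (D : E n →L[ℝ] E n) = fderiv ℝ H x := ContinuousLinearMap.ext fun v => rfl
    exact ⟨D, hD ▸ (hsm x hx).hasStrictFDerivAt (by simp)⟩
  have hinj' : Set.InjOn H s := fun x hx y hy hxy => by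
    rw [hH x hx, hH y hy] at hxy
    exact congrArg Subtype.val (hinj (Subtype.ext hxy))
  have hopen : IsOpenMap ((s : Set (E n)).domRestrict H) := by
    refine isOpenMap_iff_nhds_le.2 fun x => ?_
    obtain ⟨D, hD⟩ := hder x x.2
    rw [Set.domRestrict_eq, ← Filter.map_map, s.isOpen.isOpenEmbedding_subtypeVal.map_nhds_eq,
      hD.map_nhds_eq_of_equiv]
    rfl
  let e : OpenPartialHomeomorph (E n) (E n) := OpenPartialHomeomorph.ofContinuousOpenRestrict
    (hinj'.toPartialEquiv H s) hh.continuousOn hopen s.isOpen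
  have hk : ∀ y ∈ e.target, e.symm y ∈ s := fun y hy => e.map_target hy
  refine ⟨⟨e.target, e.open_target⟩, fun y => ⟨e.symm y, hk y y.2⟩, ?_, ?_, ?_, ?_⟩
  · rintro _ ⟨x, hx, rfl⟩
    rw [hH x hx]
    exact (h ⟨x, hx⟩).2
  · refine IsSmooth.of_contDiffOn (g := e.symm) (fun y hy => ?_) fun _ => rfl
    obtain ⟨D, hD⟩ := hder _ (hk y hy)
    exact (e.contDiffAt_symm hy hD.hasFDerivAt (hsm _ (hk y hy))).contDiffWithinAt
  · intro x
    refine ⟨x.1, x.2, hH x.1 x.2⟩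
  · intro y
    refine (hH _ (hk y y.2)).symm.trans ?_
    exact e.right_inv y.2

end

end SparkOrb

namespace SparkOrb

/-! ### Local liftings between charts -/

theorem Chart.isOpenMap_proj {X : Type u} [TopologicalSpace X] {n : ℕ} (c : Chart X n) :
    IsOpenMap c.proj := by
  obtain ⟨e, he⟩ := c.homeo
  have : ContinuousConstSMul c.grp c.dom := ⟨fun g => (c.smooth_grp g.1 g.2).continuous⟩
  have h : c.proj = Subtype.val ∘ e ∘ Quotient.mk (MulAction.orbitRel c.grp c.dom) :=
    funext fun x => (he x).symm
  rw [h]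
  exact c.isOpen_range.isOpenMap_subtype_val.comp
    (e.isOpenMap.comp isOpenMap_quotient_mk'_mul)

theorem Chart.mapDeriv_injective {X : Type u} [TopologicalSpace X] {n : ℕ} (c : Chart X n)
    {g : Equiv.Perm c.dom} (hg : g ∈ c.grp) (x : c.dom) :
    Function.Injective (mapDeriv (g : c.dom → c.dom) x) := by
  have h := mapDeriv_comp (c.smooth_grp _ (inv_mem hg)) (c.smooth_grp g hg) x
  have h1 : (g⁻¹ : Equiv.Perm c.dom) ∘ (g : c.dom → c.dom) = id :=
    funext fun y => Equiv.symm_apply_apply g y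
  rw [h1, mapDeriv_id] at h
  refine Function.LeftInverse.injective (g := mapDeriv (g⁻¹ : Equiv.Perm c.dom) (g x)) fun v => ?_
  exact (DFunLike.congr_fun h v).symm

namespace GPreOrb

variable {U : GPreOrb.{u, v}}

theorem isOpenMap_proj (I : U.Idx) : IsOpenMap (U.proj I) := Chart.isOpenMap_proj _

/-- A smooth lifting of the identity of `X`, defined on an open subset of `Ũ_I` and with values
in `Ũ_J`. -/
structure LocalLift (I J : U.Idx) where
  /-- the domain -/
  dom : Op U.dim
  le : dom ≤ U.dom I
  /-- the lifting -/
  map : dom → U.dom J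
  smooth : IsSmooth map
  proj_map : ∀ z, U.proj J (map z) = U.proj I (Op.incl le z)

/-- The chart over `U_I ∩ U_J` embeds into both charts. Composing its embedding into `Ũ_I` with a
suitable element of `G_I` makes the image contain `y`; inverting this map locally and following with
the embedding into `Ũ_J` gives the lift. -/
theorem exists_localLift {I J : U.Idx} (y : U.dom I) (h : U.proj I y ∈ U.image J) :
    ∃ L : LocalLift I J, y.1 ∈ L.dom := by
  let K : U.Idx := union ![I, J]
  have hK : U.image K = U.image I ∩ U.image J := by
    rw [image_union_eq]
    ext z
    simp
  obtain ⟨x, hx⟩ : U.proj I y ∈ U.image K := hK.symm ▸ ⟨proj_mem_image I y, h⟩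
  obtain ⟨l⟩ : Nonempty (K ⟶ I) := U.exists_embedding K I (hK.subset.trans Set.inter_subset_left)
  obtain ⟨m⟩ : Nonempty (K ⟶ J) := U.exists_embedding K J (hK.subset.trans Set.inter_subset_right)
  obtain ⟨g, hg, hgx⟩ := (U.chart I).exists_smul_eq (x := emb l x) (y := y)
    ((proj_emb l x).trans hx)
  have hs := (U.chart I).smooth_grp g hg
  obtain ⟨W, k, hW, hk, hW', hk'⟩ := (hs.comp (emb_smooth l)).exists_inverse
    (g.injective.comp (Embedding.isEmbedding l).injective) fun z => by
      rw [mapDeriv_comp hs (emb_smooth l)]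
      exact ((U.chart I).mapDeriv_injective hg _).comp (Embedding.immersion l z)
  refine ⟨⟨W, hW, emb m ∘ k, (emb_smooth m).comp hk, fun z => ?_⟩, ?_⟩
  · have h1 : g (emb l (k z)) = Op.incl (t := U.dom I) hW z := Subtype.ext (hk' z)
    exact ((proj_emb m _).trans ((proj_emb l _).symm.trans
      ((U.chart I).invariant g hg _).symm)).trans (congrArg (U.proj I) h1)
  · have h2 : (g (emb l x)).1 ∈ W := hW' x
    rwa [hgx] at h2

/-! ### Transport of invariant forms between charts -/

open Classical in
/-- The transport of a form on `Ũ_J` to the part of `Ũ_I` over `U_I ∩ U_J`, extended by zero. -/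
noncomputable def transport (I J : U.Idx) {q : ℕ} (w : Form (U.dom J) q) (y : U.dom I) :
    Alt U.dim q :=
  if h : ∃ L : LocalLift I J, y.1 ∈ L.dom then
    (Form.pullback h.choose.map h.choose.smooth q w).1 ⟨y.1, h.choose_spec⟩ else 0

section

variable {I I' J K : U.Idx} {q : ℕ} {w : Form (U.dom J) q}

theorem transport_of_notMem {y : U.dom I} (h : U.proj I y ∉ U.image J) (w : Form (U.dom J) q) :
    transport I J w y = 0 := by
  refine dif_neg ?_
  rintro ⟨L, hL⟩
  refine h ?_
  have := L.proj_map ⟨y.1, hL⟩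
  exact this ▸ proj_mem_image J _

theorem transport_add (w w' : Form (U.dom J) q) (y : U.dom I) :
    transport I J (w + w') y = transport I J w y + transport I J w' y := by
  by_cases h : ∃ L : LocalLift I J, y.1 ∈ L.dom
  · simp only [transport, dif_pos h, map_add]
    rfl
  · simp only [transport, dif_neg h, add_zero]

theorem transport_neg (w : Form (U.dom J) q) (y : U.dom I) :
    transport I J (-w) y = -transport I J w y := by
  have h := transport_add w (-w) y
  rw [add_neg_cancel] at h
  have h0 := transport_add (0 : Form (U.dom J) q) 0 y
  rw [add_zero, left_eq_add] at h0
  rw [h0] at h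
  exact (neg_eq_of_add_eq_zero_right h.symm).symm

theorem transport_pull_eqToHom {J' : U.Idx} (e : J' = J) (w : Form (U.dom J) q) (y : U.dom I) :
    transport I J' (pull (eqToHom e) q w) y = transport I J w y := by
  subst e
  rw [eqToHom_refl, pull_id]

/-- The local lift chosen in `transport` composed with `b`, and `a` itself, have the same projection
where both are defined, so they pull `w` back equally. The choice of lift is therefore irrelevant,
and transport may be computed from any smooth pair over the base. -/
theorem transport_pullback (hw : IsInvariant w) {m : ℕ} {s : Op m} {a : s → U.dom J}
    (ha : IsSmooth a) {b : s → U.dom I} (hb : IsSmooth b)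
    (h : ∀ x, U.proj J (a x) = U.proj I (b x)) (x : s) :
    (transport I J w (b x)).compContinuousLinearMap (mapDeriv b x) =
      (Form.pullback a ha q w).1 x := by
  have hex : ∃ L : LocalLift I J, (b x).1 ∈ L.dom :=
    exists_localLift (b x) (h x ▸ proj_mem_image J _)
  suffices H : ∀ (L : LocalLift I J) (hL : (b x).1 ∈ L.dom),
      ((Form.pullback L.map L.smooth q w).1 ⟨(b x).1, hL⟩).compContinuousLinearMap
        (mapDeriv b x) = (Form.pullback a ha q w).1 x by
    rw [transport, dif_pos hex]
    exact H _ hex.choose_spec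
  intro L hL
  -- The comparison takes place on the open part of `s` that `b` sends into the domain of the lift.
  let r : Op m := ⟨Subtype.val '' {z : s | (b z).1 ∈ L.dom}, s.isOpen.isOpenMap_subtype_val _
    (L.dom.isOpen.preimage (continuous_subtype_val.comp hb.continuous))⟩
  have hr : r ≤ s := by
    rintro _ ⟨z, _, rfl⟩
    exact z.2
  have hrL : ∀ z : r, (b (Op.incl hr z)).1 ∈ L.dom := by
    rintro ⟨_, z, hz, rfl⟩
    exact hz
  let c : r → L.dom := fun z => ⟨b (Op.incl hr z), hrL z⟩
  have hbr := hb.comp (Op.isSmooth_incl hr)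
  have hc : IsSmooth c := hbr
  let x' : r := ⟨x.1, x, hL, rfl⟩
  have h1 := hw.pullback_eq (L.smooth.comp hc) (ha.comp (Op.isSmooth_incl hr)) fun z => by
    rw [Function.comp_apply, Function.comp_apply, h, L.proj_map]
    rfl
  rw [← Form.pullback_comp L.smooth hc, ← Form.pullback_comp ha (Op.isSmooth_incl hr)] at h1
  have h2 := congrArg (fun z : Form r q => z.1 x') h1
  simp only [Form.pullback_apply _ _ q (Form.pullback _ _ _ _)] at h2
  have h3 : mapDeriv c x' = mapDeriv b x := by
    refine (mapDeriv_comp hb (Op.isSmooth_incl hr) x').trans ?_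
    rw [mapDeriv_incl]
    rfl
  rw [h3, mapDeriv_incl] at h2
  exact h2

theorem transport_eq (hw : IsInvariant w) (L : LocalLift I J) (z : L.dom) :
    transport I J w (Op.incl L.le z) = (Form.pullback L.map L.smooth q w).1 z := by
  rw [← transport_pullback hw L.smooth (Op.isSmooth_incl L.le) L.proj_map, mapDeriv_incl]
  rfl

/-- Transport is compatible with smooth maps between charts over the identity of `X`. -/
theorem transport_comp (hw : IsInvariant w) {b : U.dom I → U.dom I'} (hb : IsSmooth b)
    (h : ∀ x, U.proj I' (b x) = U.proj I x) (y : U.dom I) :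
    (transport I' J w (b y)).compContinuousLinearMap (mapDeriv b y) = transport I J w y := by
  by_cases hy : U.proj I y ∈ U.image J
  · obtain ⟨L, hL⟩ := exists_localLift y hy
    have h1 := transport_eq hw L ⟨y.1, hL⟩
    rw [← transport_pullback hw L.smooth (hb.comp (Op.isSmooth_incl L.le)) (fun z => by
      rw [L.proj_map, Function.comp_apply, h]), mapDeriv_comp hb (Op.isSmooth_incl L.le),
      mapDeriv_incl] at h1
    exact h1.symm
  · rw [transport_of_notMem hy, transport_of_notMem (by rwa [h])]
    rfl

theorem transport_eq_res (hw : IsInvariant w) (h : U.image K ⊆ U.image J) (L : LocalLift I K)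
    (z : L.dom) :
    transport I J w (Op.incl L.le z) = (Form.pullback L.map L.smooth q (res K J q w)).1 z := by
  have h1 := transport_pullback hw ((emb_smooth (U.exists_embedding K J h).some).comp L.smooth)
    (Op.isSmooth_incl L.le) (fun z => by rw [Function.comp_apply, proj_emb, L.proj_map]) z
  rw [mapDeriv_incl] at h1
  refine Eq.trans h1 ?_
  rw [← Form.pullback_comp (emb_smooth _) L.smooth]
  exact congrArg (fun x => (Form.pullback L.map L.smooth q x).1 z) (CompatSystem.id_res h w).symm

theorem transport_self (hw : IsInvariant w) (y : U.dom J) : transport J J w y = w.1 y := by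
  have h := transport_pullback (I := J) hw IsSmooth.id IsSmooth.id (fun _ => rfl) y
  rw [mapDeriv_id, Form.pullback_id] at h
  exact h

end

/-! ### Smooth functions on `X` -/

/-- A function on `X` is smooth if its pullbacks to all charts are smooth. -/
def IsSmoothOn (r : U.X → ℝ) : Prop := ∀ I : U.Idx, IsSmoothFun fun y => r (U.proj I y)

/-- Over `U_J` a local lift exhibits the transported form as a smooth pullback. At the remaining
points `r` vanishes on a neighbourhood, since its closed support within `U_I` lies in `U_J`. -/
theorem isSmoothFun_smul_transport {r : U.X → ℝ} (hr : IsSmoothOn r) {I J : U.Idx}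
    (h : tsupport r ∩ U.image I ⊆ U.image J) {q : ℕ} {w : Form (U.dom J) q} (hw : IsInvariant w) :
    IsSmoothFun fun y => r (U.proj I y) • transport I J w y := by
  refine isSmoothFun_of_local fun y => ?_
  by_cases hy : U.proj I y ∈ U.image J
  · obtain ⟨L, hL⟩ := exists_localLift y hy
    refine ⟨L.dom, hL, _, ((hr I).comp (Op.isSmooth_incl L.le)).smul
      (Form.pullback L.map L.smooth q w).2, Filter.Eventually.of_forall fun z hz => ?_⟩
    rw [← transport_eq hw L ⟨z.1, hz⟩]
    rfl
  · refine ⟨U.dom I, y.2, 0, IsSmoothFun.zero, ?_⟩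
    have h1 : ∀ᶠ x in 𝓝 (U.proj I y), r x = 0 :=
      notMem_tsupport_iff_eventuallyEq.1 fun h' => hy (h ⟨h', proj_mem_image I y⟩)
    filter_upwards [(U.continuous_proj I).continuousAt.eventually h1] with z hz _
    rw [hz, zero_smul]
    rfl

end GPreOrb

end SparkOrb

namespace SparkOrb

/-! ### Smooth partitions of unity -/

namespace GPreOrb

variable {U : GPreOrb.{u, v}}

theorem exists_proj_eq (x : U.X) : ∃ (I : U.Idx) (y : U.dom I), U.proj I y = x := by
  have h : x ∈ ⋃ I, (U.chart I).image := U.isAtlas.cover ▸ Set.mem_univ x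
  obtain ⟨I, y, hy⟩ := Set.mem_iUnion.1 h
  exact ⟨I, y, hy⟩

/-- A smooth function on `Ũ_I` which is invariant and supported in a compact set descends to a
smooth function on `X`. -/
theorem exists_descent {I : U.Idx} {F : U.dom I → ℝ} (hF : IsSmoothFun F)
    (hinv : ∀ y z, U.proj I y = U.proj I z → F y = F z) {C : Set (U.dom I)} (hC : IsCompact C)
    (hFC : ∀ y, F y ≠ 0 → U.proj I y ∈ U.proj I '' C) :
    ∃ r : U.X → ℝ, IsSmoothOn r ∧ (∀ y, r (U.proj I y) = F y) ∧
      Function.support r ⊆ U.proj I '' C := by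
  classical
  let r : U.X → ℝ := fun x => if h : ∃ y, U.proj I y = x then F h.choose else 0
  have hr : ∀ y, r (U.proj I y) = F y := fun y => by
    have h : ∃ z, U.proj I z = U.proj I y := ⟨y, rfl⟩
    exact (dif_pos h).trans (hinv _ _ h.choose_spec)
  have hsupp : Function.support r ⊆ U.proj I '' C := by
    intro x hx
    by_cases h : ∃ y, U.proj I y = x
    · obtain ⟨y, rfl⟩ := h
      refine hFC y ?_
      rw [← hr]
      exact hx
    · exact absurd (dif_neg h) hx
  refine ⟨r, fun J => isSmoothFun_of_local fun y => ?_, hr, hsupp⟩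
  by_cases hy : U.proj J y ∈ U.image I
  · obtain ⟨L, hL⟩ := exists_localLift y hy
    refine ⟨L.dom, hL, _, hF.comp L.smooth, Filter.Eventually.of_forall fun z hz => ?_⟩
    rw [Function.comp_apply, ← hr, L.proj_map]
    rfl
  · refine ⟨U.dom J, y.2, 0, IsSmoothFun.zero, ?_⟩
    -- Compactness of `C` and the Hausdorff property make the image closed in `X`, so outside `U_I`
    -- the extension by zero vanishes on a neighbourhood and is smooth there.
    have hc : IsClosed (U.proj I '' C) := (hC.image (U.continuous_proj I)).isClosed
    have hyC : U.proj J y ∉ U.proj I '' C := fun h => hy (Set.image_subset_range _ _ h)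
    filter_upwards [(U.continuous_proj J).continuousAt.eventually (hc.isOpen_compl.mem_nhds hyC)]
      with z hz _
    by_contra h
    exact hz (hsupp h)

/-- A bump function around a preimage of `x`, summed over the finite group of the chart, is
invariant and descends to `X`. Its support lies over the image of a closed ball chosen inside the
chart and over `N`. -/
theorem exists_bump (x : U.X) {N : Set U.X} (hN : N ∈ 𝓝 x) :
    ∃ r : U.X → ℝ, IsSmoothOn r ∧ (∀ z, 0 ≤ r z) ∧ Function.support r ∈ 𝓝 x ∧
      HasCompactSupport r ∧ tsupport r ⊆ N ∧ ∃ I, tsupport r ⊆ U.image I := by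
  obtain ⟨I, y, rfl⟩ := exists_proj_eq x
  have hfin : Finite (U.chart I).grp := (U.chart I).finite_grp
  have := Fintype.ofFinite (U.chart I).grp
  have h1 : ∀ᶠ z in 𝓝 (y : E U.dim), ∃ hz : z ∈ U.dom I, U.proj I ⟨z, hz⟩ ∈ N := by
    filter_upwards [(U.dom I).isOpen.mem_nhds y.2,
      eventually_forall_mem ((U.continuous_proj I).continuousAt.eventually hN)] with z hz h
    exact ⟨hz, h hz⟩
  obtain ⟨ε, hε, hball⟩ := Metric.nhds_basis_closedBall.mem_iff.1 h1
  let φ : ContDiffBump (y : E U.dim) := ⟨ε / 2, ε, half_pos hε, half_lt_self hε⟩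
  let C : Set (U.dom I) := Subtype.val ⁻¹' Metric.closedBall (y : E U.dim) ε
  have hC : IsCompact C := (Topology.IsInducing.subtypeVal.isCompact_preimage_iff
    (fun z hz => ⟨⟨z, (hball hz).1⟩, rfl⟩)).2 (isCompact_closedBall _ _)
  let F : U.dom I → ℝ := fun z => ∑ g : (U.chart I).grp, φ (g.1 z).1
  have hF : IsSmoothFun F := IsSmoothFun.sum _ fun g _ =>
    IsSmoothFun.comp (f := fun z : U.dom I => φ z.1)
      (IsSmoothFun.of_contDiffOn φ.contDiff.contDiffOn) ((U.chart I).smooth_grp g.1 g.2)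
  have hFnn : ∀ z, 0 ≤ F z := fun z => Finset.sum_nonneg fun _ _ => φ.nonneg
  have hinv : ∀ z z', U.proj I z = U.proj I z' → F z = F z' := by
    intro z z' h
    obtain ⟨g, hg, rfl⟩ := (U.chart I).exists_smul_eq h
    exact (Equiv.sum_comp (Equiv.mulRight (⟨g, hg⟩ : (U.chart I).grp)) fun k => φ (k.1 z).1).symm
  obtain ⟨r, hr, hrF, hrC⟩ := exists_descent hF hinv hC fun z hz => by
    obtain ⟨g, _, hg⟩ := Finset.exists_ne_zero_of_sum_ne_zero hz
    refine ⟨g.1 z, ?_, (U.chart I).invariant g.1 g.2 z⟩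
    have h2 : (g.1 z).1 ∈ Function.support φ := hg
    rw [φ.support_eq] at h2
    exact Metric.ball_subset_closedBall h2
  have hCc := hC.image (U.continuous_proj I)
  have hts : tsupport r ⊆ U.proj I '' C := closure_minimal hrC hCc.isClosed
  refine ⟨r, hr, fun z => ?_, ?_, hCc.of_isClosed_subset (isClosed_tsupport r) hts, ?_, I, ?_⟩
  · by_cases hz : r z = 0
    · exact hz.ge
    · obtain ⟨z', _, rfl⟩ := hrC hz
      rw [hrF]
      exact hFnn z'
  · refine Filter.mem_of_superset ((isOpenMap_proj I).image_mem_nhds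
      (((Metric.isOpen_ball (x := (y : E U.dim)) (ε := ε)).preimage
        continuous_subtype_val).mem_nhds (Metric.mem_ball_self hε))) ?_
    rintro _ ⟨z, hz, rfl⟩
    rw [Function.mem_support, hrF]
    -- The summand of the identity element is already positive on the open ball.
    refine (Finset.sum_pos' (fun _ _ => φ.nonneg) ⟨1, Finset.mem_univ _, ?_⟩).ne'
    exact φ.pos_of_mem_ball hz
  · rintro _ hz
    obtain ⟨z', hz', rfl⟩ := hts hz
    exact (hball hz').2
  · exact hts.trans (Set.image_subset_range _ _)

/-- Local compactness, together with second countability, supplies the hypotheses of the locally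
finite refinement theorem used for the partition of unity. -/
instance : WeaklyLocallyCompactSpace U.X where
  exists_compact_mem_nhds x := by
    obtain ⟨r, -, -, hr, hc, -⟩ := exists_bump x Filter.univ_mem
    exact ⟨tsupport r, hc, Filter.mem_of_superset hr (subset_tsupport r)⟩

theorem isSmoothFun_finsum {I : U.Idx} {α B : Type*} [NormedAddCommGroup B] [NormedSpace ℝ B]
    {f : α → U.X → ℝ} (hf : LocallyFinite fun a => Function.support (f a))
    {F : α → U.dom I → B} (hF : ∀ a, IsSmoothFun (F a))
    (h0 : ∀ a y, f a (U.proj I y) = 0 → F a y = 0) : IsSmoothFun fun y => ∑ᶠ a, F a y := by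
  refine isSmoothFun_of_local fun y => ?_
  obtain ⟨t, ht, hfin⟩ := hf (U.proj I y)
  refine ⟨U.dom I, y.2, _, IsSmoothFun.sum hfin.toFinset fun a _ => hF a, ?_⟩
  filter_upwards [(U.continuous_proj I).continuousAt.eventually ht] with z hz _
  refine finsum_eq_sum_of_support_subset _ fun a ha => ?_
  exact hfin.mem_toFinset.2 ⟨U.proj I z, fun h => ha (h0 a z h), hz⟩

/-- A smooth partition of unity subordinate to the cover of `X` by the sets `U_I`. -/
structure PartUnity (U : GPreOrb.{u, v}) where
  /-- the index set -/
  idx : Type u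
  /-- the functions -/
  toFun : idx → U.X → ℝ
  /-- the charts containing the supports -/
  ind : idx → U.Idx
  smooth : ∀ a, IsSmoothOn (toFun a)
  tsupport_subset : ∀ a, tsupport (toFun a) ⊆ U.image (ind a)
  locallyFinite : LocallyFinite fun a => Function.support (toFun a)
  sum_eq_one : ∀ x, ∑ᶠ a, toFun a x = 1

/-- Supports of the bump functions form neighbourhood bases, so a locally finite family of them
covers `X`. Its sum is smooth and nowhere zero, and dividing by it does not change the supports. -/
theorem exists_partUnity (U : GPreOrb.{u, v}) : Nonempty (PartUnity U) := by
  have hB (x : U.X) : (𝓝 x).HasBasis (fun r : U.X → ℝ => IsSmoothOn r ∧ (∀ z, 0 ≤ r z) ∧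
      Function.support r ∈ 𝓝 x ∧ ∃ I, tsupport r ⊆ U.image I) Function.support := by
    refine ⟨fun N => ⟨fun hN => ?_, ?_⟩⟩
    · obtain ⟨r, h1, h2, h3, -, h4, h5⟩ := exists_bump x hN
      exact ⟨r, ⟨h1, h2, h3, h5⟩, (subset_tsupport r).trans h4⟩
    · rintro ⟨r, ⟨-, -, hr, -⟩, h⟩
      exact Filter.mem_of_superset hr h
  obtain ⟨α, c, r, hr, hcov, hfin⟩ :=
    refinement_of_locallyCompact_sigmaCompact_of_nhds_basis hB
  choose hsm hnn _ ind hind using hr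
  have hfin' (x : U.X) : (Function.support fun a => r a x).Finite := hfin.point_finite x
  let S : U.X → ℝ := fun x => ∑ᶠ a, r a x
  have hS (x : U.X) : S x ≠ 0 := by
    obtain ⟨a, ha⟩ := Set.mem_iUnion.1 (hcov ▸ Set.mem_univ x : x ∈ ⋃ a, Function.support (r a))
    exact (finsum_pos (fun a => hnn a x) ⟨a, (hnn a x).lt_of_ne' ha⟩ (hfin' x)).ne'
  have hSsm : IsSmoothOn S := fun I =>
    isSmoothFun_finsum hfin (fun a => hsm a I) fun a y h => h
  have hsupp (a : α) : (Function.support fun x => (S x)⁻¹ • r a x) = Function.support (r a) := by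
    ext x
    simp [hS x]
  exact ⟨{
    idx := α
    toFun := fun a x => (S x)⁻¹ • r a x
    ind := ind
    smooth := fun a I => ((hSsm I).inv fun y => hS _).smul (hsm a I)
    tsupport_subset := fun a => by
      rw [tsupport, hsupp]
      exact hind a
    locallyFinite := by simpa only [hsupp] using hfin
    sum_eq_one := fun x => by
      rw [← smul_finsum, smul_eq_mul]
      exact inv_mul_cancel₀ (hS x) }⟩

end GPreOrb

end SparkOrb

namespace SparkOrb

/-! ### Exactness of the rows of the double complex -/

/-- The pullback of alternating forms along a linear map. -/
def altPullback {m n : ℕ} (q : ℕ) (D : E m →L[ℝ] E n) : Alt n q →+ Alt m q where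
  toFun w := w.compContinuousLinearMap D
  map_zero' := rfl
  map_add' _ _ := rfl

/-- The evaluation of forms at a point. -/
def Form.evalHom {n : ℕ} {s : Op n} (q : ℕ) (x : s) : Form s q →+ Alt n q where
  toFun w := w.1 x
  map_zero' := rfl
  map_add' _ _ := rfl

namespace GPreOrb

variable {U : GPreOrb.{u, v}}

open Matrix (vecCons)

theorem vecCons_comp_swap {α : Type*} {n : ℕ} (a : α) (s : Fin n → α) (j k : Fin n) :
    vecCons a s ∘ Equiv.swap j.succ k.succ = vecCons a (s ∘ Equiv.swap j k) := by
  funext i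
  refine Fin.cases ?_ (fun i => ?_) i
  · rw [Function.comp_apply, Equiv.swap_apply_of_ne_of_ne (Fin.succ_ne_zero _).symm
      (Fin.succ_ne_zero _).symm]
    rfl
  · rw [Function.comp_apply, (Fin.succ_injective n).swap_apply]
    rfl

theorem vecCons_comp_succAbove_succ {α : Type*} {n : ℕ} (a : α) (s : Fin (n + 1) → α)
    (k : Fin (n + 1)) : vecCons a s ∘ k.succ.succAbove = vecCons a (s ∘ k.succAbove) := by
  funext i
  refine Fin.cases ?_ (fun i => ?_) i
  · simp
  · simp

namespace PartUnity

variable (P : PartUnity U) {p q : ℕ}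

/-- The terms of the contraction of a cochain with a partition of unity, over any chart. -/
noncomputable def term (I : U.Idx) (w : U.RawCochain (p + 1) q) (s : Fin (p + 1) → U.Idx)
    (y : U.dom I) (a : P.idx) : Alt U.dim q :=
  P.toFun a (U.proj I y) •
    transport I (union (vecCons (P.ind a) s)) (w (vecCons (P.ind a) s)) y

theorem finite_support (x : U.X) : (Function.support fun a => P.toFun a x).Finite :=
  P.locallyFinite.point_finite x

theorem support_term_subset (I : U.Idx) (w : U.RawCochain (p + 1) q) (s : Fin (p + 1) → U.Idx)
    (y : U.dom I) :
    Function.support (P.term I w s y) ⊆ Function.support fun a => P.toFun a (U.proj I y) :=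
  fun _ ha h => ha ((congrArg (· • _) h).trans (zero_smul ℝ _))

theorem image_union_vecCons (a : U.Idx) (s : Fin (p + 1) → U.Idx) :
    U.image (union (vecCons a s)) = U.image a ∩ U.image (union s) := by
  ext x
  simp [image_union_eq, Fin.forall_fin_succ (n := p + 1)]

variable {w : U.RawCochain (p + 1) q} (hw : w ∈ U.cochains (p + 1) q)

/-- The contraction of a cochain with a partition of unity. -/
noncomputable def contract : U.RawCochain p q := fun s =>
  ⟨fun y => ∑ᶠ a, P.term (union s) w s y a, isSmoothFun_finsum P.locallyFinite
    (fun a => isSmoothFun_smul_transport (P.smooth a) (by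
      rw [image_union_vecCons]
      exact Set.inter_subset_inter_left _ (P.tsupport_subset a)) (hw.1 _))
    fun a y h => by rw [term, h, zero_smul]⟩

/-- At each point the sum is finite and pullback is additive, so it passes to the terms, where
`transport_comp` applies. Invariance, alternation and restriction of the contraction are all
instances of this formula. -/
theorem contract_pullback (s : Fin (p + 1) → U.Idx) {I : U.Idx} {b : U.dom I → U.dom (union s)}
    (hb : IsSmooth b) (h : ∀ x, U.proj _ (b x) = U.proj I x) (y : U.dom I) :
    (Form.pullback b hb q (P.contract hw s)).1 y = ∑ᶠ a, P.term I w s y a := by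
  refine ((altPullback q (mapDeriv b y)).map_finsum
    ((P.finite_support _).subset (P.support_term_subset _ w s _))).trans (finsum_congr fun a => ?_)
  rw [term, term, h, ← transport_comp (hw.1 _) hb h]
  rfl

theorem contract_mem : P.contract hw ∈ U.cochains p q := by
  refine ⟨fun s g hg => Form.ext fun y => ?_, fun s j k hjk => Form.ext fun y => ?_⟩
  · exact P.contract_pullback hw s _ (fun x => (U.chart _).invariant g hg x) y
  · refine Eq.trans ?_ (congrArg Neg.neg (P.contract_pullback hw (s ∘ Equiv.swap j k)
      (emb_smooth _) (proj_emb _) y)).symm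
    rw [← finsum_neg_distrib]
    refine finsum_congr fun a => ?_
    have h1 : ∀ t t', t = t' → transport (union s) (union t) (w t) y =
        transport (union s) (union t') (w t') y := by
      rintro t _ rfl
      rfl
    rw [term, term, hw.2 (vecCons (P.ind a) s) j.succ k.succ
      (fun h => hjk (Fin.succ_injective _ h)), transport_neg, transport_pull_eqToHom,
      smul_neg, h1 _ _ (vecCons_comp_swap _ _ _ _)]

/-- This is `δw = 0` on the string `a s₀ … s_{p+1}`, solved for the face that omits `a`. The
relation lives over `U_a ∩ U_s`, so a local lift into that chart carries it to the point `y`. -/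
theorem sum_transport (hw : w ∈ U.cochains (p + 1) q) (hd : U.delta (p + 1) q w = 0)
    (s : Fin (p + 2) → U.Idx) (y : U.dom (union s)) {a : U.Idx} (ha : U.proj _ y ∈ U.image a) :
    ∑ k : Fin (p + 2), (-1 : ℤ) ^ (k : ℕ) • transport (union s)
      (union (vecCons a (s ∘ k.succAbove))) (w (vecCons a (s ∘ k.succAbove))) y = (w s).1 y := by
  obtain ⟨L, hL⟩ := exists_localLift (J := union (vecCons a s)) y (by
    rw [image_union_vecCons]
    exact ⟨ha, proj_mem_image _ y⟩)
  let G (t : Fin (p + 2) → U.Idx) := res (union (vecCons a s)) (union t) q (w t)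
  have h1 := congrFun hd (vecCons a s)
  rw [delta_apply, Fin.sum_univ_succ] at h1
  simp only [restrict_eq_id_res] at h1
  change (-1 : ℤ) ^ 0 • G s + ∑ k : Fin (p + 2), (-1 : ℤ) ^ (k.succ : ℕ) •
    G (vecCons a s ∘ k.succ.succAbove) = 0 at h1
  simp only [vecCons_comp_succAbove_succ, Fin.val_succ, pow_succ, mul_neg, mul_one, neg_smul,
    Finset.sum_neg_distrib, pow_zero, one_smul] at h1
  rw [add_neg_eq_zero] at h1
  have hs : U.image (union (vecCons a s)) ⊆ U.image (union s) := by
    rw [image_union_vecCons]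
    exact Set.inter_subset_right
  rw [← transport_self (hw.1 s)]
  refine Eq.trans ?_ (transport_eq_res (hw.1 s) hs L ⟨y.1, hL⟩).symm
  refine Eq.trans ?_ (congrArg (fun x => (Form.pullback L.map L.smooth q x).1 ⟨y.1, hL⟩) h1).symm
  refine Eq.trans ?_ (map_sum ((Form.evalHom q (⟨y.1, hL⟩ : L.dom)).comp
    (Form.pullback L.map L.smooth q)) _ _).symm
  refine Finset.sum_congr rfl fun k _ => ?_
  rw [map_zsmul]
  refine congrArg _ (transport_eq_res (hw.1 _) ?_ L ⟨y.1, hL⟩)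
  rw [image_union_vecCons, image_union_vecCons]
  exact Set.inter_subset_inter_right _ (image_face s k)

/-- At a point only finitely many functions of the partition are nonzero, and each of them
contributes its value times `w s` by `sum_transport`. The values add up to `1`. -/
theorem delta_contract (hd : U.delta (p + 1) q w = 0) : U.delta p q (P.contract hw) = w := by
  funext s
  refine Form.ext fun y => ?_
  have hsum (I : U.Idx) (y : U.dom I) (t : Fin (p + 1) → U.Idx) :
      ∑ᶠ a, P.term I w t y a = ∑ a ∈ (P.finite_support (U.proj I y)).toFinset, P.term I w t y a :=
    finsum_eq_sum_of_support_subset _ (by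
      rw [Set.Finite.coe_toFinset]
      exact P.support_term_subset _ w t _)
  rw [delta_apply]
  refine (map_sum (Form.evalHom q y) _ _).trans ?_
  have h1 (k : Fin (p + 2)) : Form.evalHom q y ((-1 : ℤ) ^ (k : ℕ) • restrict (image_face s k) q
      (P.contract hw (s ∘ k.succAbove))) = (-1 : ℤ) ^ (k : ℕ) •
        ∑ a ∈ (P.finite_support (U.proj _ y)).toFinset, P.term _ w (s ∘ k.succAbove) y a := by
    rw [map_zsmul, ← hsum]
    exact congrArg _ (P.contract_pullback hw _ (emb_smooth _) (proj_emb _) y)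
  simp only [h1, Finset.smul_sum]
  rw [Finset.sum_comm]
  have h2 : ∀ a ∈ (P.finite_support (U.proj _ y)).toFinset, ∑ k : Fin (p + 2),
      (-1 : ℤ) ^ (k : ℕ) • P.term _ w (s ∘ k.succAbove) y a =
        P.toFun a (U.proj _ y) • (w s).1 y := by
    intro a ha
    have ha' : U.proj _ y ∈ U.image (P.ind a) :=
      P.tsupport_subset a (subset_tsupport _ ((P.finite_support _).mem_toFinset.1 ha))
    rw [← sum_transport hw hd s y ha', Finset.smul_sum]
    exact Finset.sum_congr rfl fun k _ => smul_comm _ _ _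
  rw [Finset.sum_congr rfl h2, ← Finset.sum_smul]
  have h3 := P.sum_eq_one (U.proj _ y)
  rw [finsum_eq_sum _ (P.finite_support _)] at h3
  rw [h3, one_smul]

end PartUnity

theorem hasExactRows (U : GPreOrb.{u, v}) : U.HasExactRows := fun _ _ _ hw hd =>
  let ⟨P⟩ := exists_partUnity U
  ⟨P.contract hw, P.contract_mem hw, P.delta_contract hw hd⟩

end GPreOrb

end SparkOrb

namespace SparkOrb

/-! ### The 2-functor from good atlases to spark complexes -/

noncomputable section

open GPreOrb CochainComplex.HomComplex Bicategory

/-- The assignment of spark homomorphisms preserves composition by a proved equality, which puts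
`eqToHom` into the whiskering axioms; it disappears once the equalities are substituted. -/
theorem SparkHomotopy.cls_eq_eqToHom {A B : Triple.{v}} {f f' g g' : SparkHom A B} (h : f = f')
    (h' : g' = g) {Φ : SparkHomotopy f' g'} {Φ' : SparkHomotopy f g} (e : Φ'.hom = Φ.hom) :
    (Φ'.cls : f ⟶ g) = eqToHom h ≫ (Φ.cls : f' ⟶ g') ≫ eqToHom h' := by
  subst h h'
  rw [eqToHom_refl, eqToHom_refl, Category.comp_id, Category.id_comp]
  exact SparkHomotopy.cls_eq e

namespace CompatSystem

variable {U V W : GPreOrb.{u, v}}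

/-- The spark homotopy associated to a natural transformation and a strict total order. -/
def prismHomotopy (r : U.Idx → U.Idx → Prop) (hr : IsStrictTotalOrder U.Idx r)
    {f g : CompatSystem U V} (a : CompatNatTrans f g) : SparkHomotopy f.spark g.spark := by
  classical
  letI := linearOrderOfSTO r
  exact homotopyOf a (isChainHomotopy_prismOp a)

theorem isPrism_prismHomotopy (r : U.Idx → U.Idx → Prop) (hr : IsStrictTotalOrder U.Idx r)
    {f g : CompatSystem U V} (a : CompatNatTrans f g) : IsPrism a r (prismHomotopy r hr a) := by
  classical
  let := linearOrderOfSTO r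
  exact isPrism_homotopyOf a

theorem exists_isChainHomotopy (r : U.Idx → U.Idx → Prop) (hr : IsStrictTotalOrder U.Idx r)
    {f g : CompatSystem U V} (a : CompatNatTrans f g) :
    ∃ T, IsChainHomotopy f g T ∧ (prismHomotopy r hr a).hom = f.opCochain T 1 := by
  classical
  let := linearOrderOfSTO r
  exact ⟨_, isChainHomotopy_prismOp a, rfl⟩

/-- The class of the spark homotopies associated to a natural transformation. -/
def sparkCls {f g : CompatSystem U V} (a : CompatNatTrans f g) :
    SparkHomotopyClass f.spark g.spark := (prismHomotopy WellOrderingRel inferInstance a).cls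

/-- The class depends on the 2-cell only through its source and target, and any carried chain
homotopy computes it. Each axiom below therefore reduces to naming a chain homotopy for one of its
sides. -/
theorem sparkCls_eq {f g : CompatSystem U V} (a : CompatNatTrans f g)
    {T : Chains U.Idx →ₗ[ℤ] Chains V.Idx} (hT : IsChainHomotopy f g T)
    {Φ : SparkHomotopy f.spark g.spark} (h : Φ.hom = f.opCochain T 1) : sparkCls a = Φ.cls := by
  obtain ⟨T', hT', h'⟩ := exists_isChainHomotopy WellOrderingRel inferInstance a
  exact cls_eq_of_isChainHomotopy hT' hT h' h

theorem exists_sparkCls_eq {f g : CompatSystem U V} (a : CompatNatTrans f g) :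
    ∃ (T : Chains U.Idx →ₗ[ℤ] Chains V.Idx) (hT : IsChainHomotopy f g T),
      sparkCls a = (homotopyOf a hT).cls := by
  obtain ⟨T, hT, h⟩ := exists_isChainHomotopy WellOrderingRel inferInstance a
  exact ⟨T, hT, SparkHomotopy.cls_eq h⟩

theorem sparkCls_id (f : CompatSystem U V) :
    sparkCls (𝟙 f : f ⟶ f) = (𝟙 f.spark : f.spark ⟶ f.spark) :=
  sparkCls_eq _ (isChainHomotopy_zero f) (cochain_ext fun i j hij x => by
    rw [opCochain_v_apply]
    funext ⟨p, q, e⟩ s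
    exact (map_zero (f.ev (union s) _)).symm)

theorem sparkCls_comp {f g h : CompatSystem U V} (a : f ⟶ g) (b : g ⟶ h) :
    sparkCls (a ≫ b) = CategoryStruct.comp (X := f.spark) (Y := g.spark) (Z := h.spark)
      (sparkCls a) (sparkCls b) := by
  obtain ⟨T, hT, ha⟩ := exists_sparkCls_eq a
  obtain ⟨T', hT', hb⟩ := exists_sparkCls_eq b
  rw [ha, hb]
  exact sparkCls_eq _ (hT.add a hT') (opCochain_add_of_trans a T hT'.carries)

/-- The sides of whiskering are exchanged because `S` reverses 1-cells. The chain homotopy is `T`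
followed by the chain map of `h`; in the companion lemma it is `T` preceded by the chain map of `f`.
-/
theorem sparkCls_whiskerRight {f g : CompatSystem U V} (a : CompatNatTrans f g)
    (h : CompatSystem V W) :
    (sparkCls (a.whiskerRight h) : (f.comp h).spark ⟶ (g.comp h).spark) =
      eqToHom (spark_comp f h) ≫ SparkHomotopyClass.whiskerLeft h.spark (sparkCls a) ≫
        eqToHom (spark_comp g h).symm := by
  obtain ⟨T, hT, ha⟩ := exists_sparkCls_eq a
  rw [ha, sparkCls_eq _ (hT.map_comp h) (Φ := homotopyOf (a.whiskerRight h) (hT.map_comp h)) rfl]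
  exact SparkHomotopy.cls_eq_eqToHom (spark_comp f h) (spark_comp g h).symm
    (Φ := SparkHomotopy.whiskerLeft h.spark (homotopyOf a hT))
    (spark_comp_opCochain h hT.carries 1).symm

theorem sparkCls_whiskerLeft (f : CompatSystem U V) {g h : CompatSystem V W}
    (b : CompatNatTrans g h) :
    (sparkCls (b.whiskerLeft f) : (f.comp g).spark ⟶ (f.comp h).spark) =
      eqToHom (spark_comp f g) ≫ SparkHomotopyClass.whiskerRight (sparkCls b) f.spark ≫
        eqToHom (spark_comp f h).symm := by
  obtain ⟨T, hT, ha⟩ := exists_sparkCls_eq b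
  rw [ha, sparkCls_eq _ (hT.comp_map f) (Φ := homotopyOf (b.whiskerLeft f) (hT.comp_map f)) rfl]
  exact SparkHomotopy.cls_eq_eqToHom (spark_comp f g) (spark_comp f h).symm
    (Φ := SparkHomotopy.whiskerRight (homotopyOf b hT) f.spark)
    (opCochain_comp_spark f g hT.carries 1).symm

end CompatSystem

instance : Bicategory.Strict GPreOrb.{u, v}ᵒᵖ where
  id_comp _ := rfl
  comp_id _ := rfl
  assoc _ _ _ := rfl
  leftUnitor_eqToIso _ := rfl
  rightUnitor_eqToIso _ := rfl
  associator_eqToIso _ _ _ := rfl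

/-- The 2-functor which sends a good atlas `U` to the spark complex `S_U`. -/
def sparkFunctor : StrictPseudofunctor GPreOrb.{u, v}ᵒᵖ SpCx.{v} :=
  StrictPseudofunctor.mk''
    { obj := fun U => ⟨(isTriple U.unop).triple, (hasExactRows U.unop).isSpark⟩
      map := fun f => CompatSystem.spark f.unop
      map₂ := fun a => CompatSystem.sparkCls a.unop2
      map₂_id := fun f => CompatSystem.sparkCls_id f.unop
      map₂_comp := fun a b => CompatSystem.sparkCls_comp a.unop2 b.unop2
      map_id := fun U => CompatSystem.spark_id U.unop
      map_comp := fun f g => CompatSystem.spark_comp g.unop f.unop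
      map₂_whisker_left := fun f _ _ a => CompatSystem.sparkCls_whiskerRight a.unop2 f.unop
      map₂_whisker_right := fun a f => CompatSystem.sparkCls_whiskerLeft f.unop a.unop2 }

end

end SparkOrb

/-! ### The main theorem -/

theorem mainTheorem3 :
    ∃ (hT : ∀ U : GPreOrb.{u, v}, U.IsTriple)
      (hS : ∀ U : GPreOrb.{u, v}, (hT U).triple.IsSpark)
      (hf : ∀ (U V : GPreOrb.{u, v}) (f : U ⟶ V), CompatSystem.IsSparkHom f)
      (S : StrictPseudofunctor GPreOrb.{u, v}ᵒᵖ SpCx.{v})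
      (H : StrictPseudofunctor GPreOrb.{u, v}ᵒᵖ (LocallyDiscrete GAb.{v})),
      -- `S` sends `U` to `S_U`, a compatible system to the induced spark homomorphism, and a
      -- natural transformation to the class of the associated spark homotopy
      (∀ r : ∀ U : GPreOrb.{u, v}, U.Idx → U.Idx → Prop,
        (∀ U, IsStrictTotalOrder U.Idx (r U)) →
        ∃ Φ : ∀ (U V : GPreOrb.{u, v}) (f g : U ⟶ V), (f ⟶ g) →
            SparkHomotopy ((hf U V f).sparkHom (hT U) (hT V)) ((hf U V g).sparkHom (hT U) (hT V)),
          (∀ (U V : GPreOrb.{u, v}) (f g : U ⟶ V) (a : f ⟶ g),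
            CompatSystem.IsPrism a (r U) (Φ U V f g a)) ∧
          S.toPrelaxFunctorStruct =
            { obj := fun U => ⟨(hT U.unop).triple, hS U.unop⟩
              map := fun {V U} f => (hf U.unop V.unop f.unop).sparkHom (hT U.unop) (hT V.unop)
              map₂ := fun {V U f g} a => (Φ U.unop V.unop f.unop g.unop a.unop2).cls }) ∧
      -- `H` sends `U` to the graded group of spark characters of `S_U`, a compatible system to the
      -- induced homomorphism, and a natural transformation to an identity
      H.toPrefunctor =
        { obj := fun U => ⟨charGroup (hT U.unop).triple⟩
          map := fun {V U} f =>
            ⟨((hf U.unop V.unop f.unop).sparkHom (hT U.unop) (hT V.unop)).charHom⟩ } ∧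
      (∀ (U V : GPreOrb.{u, v}) (f g : U ⟶ V), (f ⟶ g) →
        ((hf U V f).sparkHom (hT U) (hT V)).charHom =
          ((hf U V g).sparkHom (hT U) (hT V)).charHom) ∧
      (∀ (V U : GPreOrb.{u, v}ᵒᵖ) (f g : V ⟶ U) (a : f ⟶ g),
        ∃ h : H.map f = H.map g, H.map₂ a = eqToHom h) ∧
      H = S.comp Char := by
  -- The functor is built with a fixed well-order. Uniqueness of the class identifies it with the
  -- prism homotopy of any other strict total order.
  have hcls (r : ∀ U : GPreOrb.{u, v}, U.Idx → U.Idx → Prop)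
      (hr : ∀ U, IsStrictTotalOrder U.Idx (r U)) {U V : GPreOrb.{u, v}} {f g : U ⟶ V}
      (a : f ⟶ g) : CompatSystem.sparkCls a = (CompatSystem.prismHomotopy (r U) (hr U) a).cls := by
    obtain ⟨T, hT, h⟩ := CompatSystem.exists_isChainHomotopy (r U) (hr U) a
    exact CompatSystem.sparkCls_eq a hT h
  refine ⟨GPreOrb.isTriple, fun U => U.hasExactRows.isSpark, fun _ _ f => f.isSparkHom,
    sparkFunctor, sparkFunctor.comp Char, fun r hr => ⟨fun U V f g a =>
      CompatSystem.prismHomotopy (r U) (hr U) a, fun U V f g a =>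
        CompatSystem.isPrism_prismHomotopy _ _ a, ?_⟩, rfl, fun U V f g a =>
          (CompatSystem.sparkCls a).charHom_eq, fun V U f g a => ⟨?_, Subsingleton.elim _ _⟩, rfl⟩
  -- Objects and 1-cells agree by definition; only the values on 2-cells need `hcls`.
  · refine congrArg (PrelaxFunctorStruct.mk sparkFunctor.toPrefunctor) ?_
    funext V U f g a
    exact hcls r hr a.unop2
  · exact congrArg Discrete.mk (CompatSystem.sparkCls a.unop2).charHom_eq
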